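/- For $\alpha>-1$ let $$T_\alpha=-\frac{\alpha^2}{4}(1-|z|^2)^{-\alpha-1}+\frac{\alpha}{2}(1-|z|^2)^{-\alpha-1}\Bigl(z\frac{\partial}{\partial z}+\bar z\frac{\partial}{\partial\bar z}\Bigr)+\frac14(1-|z|^2)^{-\alpha}\Delta$$ on the open unit disk $\mathbb D$. A function $u:\mathbb D\to\mathbb C$ of class $C^2$ is called $\alpha$-harmonic if $T_\alpha u=0$ in $\mathbb D$. For $p>1$ let $h^p_\alpha(\mathbb D)$ be the space of $\alpha$-harmonic functions $u$ whose integral means $\bigl(\frac1{2\pi}\int_0^{2\pi}|u(re^{i\theta})|^p\,d\theta\bigr)^{1/p}$ are bounded in $0\le r<1$, and write $u(e^{i\theta})=\lim_{r\to1^-}u(re^{i\theta})$ for the radial boundary values. Put $$C(\alpha,p)=\frac{2^{\alpha-1}c_\alpha}{\pi}\,B\Bigl(\tfrac12\bigl(1+\alpha+\tfrac1p\bigr),\tfrac12\bigl(1-\tfrac1p\bigr)\Bigr)\sec^{p-1}\Bigl(\frac{\pi}{2p}\Bigr),\qquad c_\alpha=\frac{\Gamma(\alpha/2+1)^2}{\Gamma(1+\alpha)},$$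 where $B$ is the Beta function. **Theorem.** Let $p>1$. (1) Let $-1<\alpha\le0$ and $\alpha+\frac2p>0$. Every $u\in h^p_\alpha(\mathbb D)$ has a radial boundary value $u(e^{i\theta})$ for almost every $\theta$, the boundary function belongs to $L^p(0,2\pi)$, and for every $s\in\mathbb R$ $$\int_{-1}^{1}|u(re^{is})|^p\,dr\le C(\alpha,p)\int_0^{2\pi}|u(e^{i\theta})|^p\,d\theta .$$ (2) The constant is asymptotically sharp as $\alpha\to0$ (with $\alpha\le 0$): one has $C(\alpha,p)\to C(0,p)=\frac12\sec^p\bigl(\frac{\pi}{2p}\bigr)$ as $\alpha\to0^-$, and for every $\varepsilon>0$ there is $\delta>0$ such that, for all $\alpha\in(-\delta,0]$ and all $s\in\mathbb R$, every constant $K$ for which $\int_{-1}^{1}|u(re^{is})|^p\,dr\le K\int_0^{2\pi}|u(e^{i\theta})|^p\,d\theta$ holds for all $u\in h^p_\alpha(\mathbb D)$ satisfies $K\ge(1-\varepsilon)\,C(\alpha,p)$. -/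

import Mathlib

open Real Set Filter Topology MeasureTheory
open scoped ENNReal

namespace AlphaHarmonic

/-- The Wirtinger derivative `∂u/∂z = (∂u/∂x - i ∂u/∂y) / 2`. -/
noncomputable def wirtinger (u : ℂ → ℂ) (z : ℂ) : ℂ :=
  (1 / 2) * (fderiv ℝ u z 1 - Complex.I * fderiv ℝ u z Complex.I)

/-- The conjugate Wirtinger derivative `∂u/∂z̄ = (∂u/∂x + i ∂u/∂y) / 2`. -/
noncomputable def wirtingerBar (u : ℂ → ℂ) (z : ℂ) : ℂ :=
  (1 / 2) * (fderiv ℝ u z 1 + Complex.I * fderiv ℝ u z Complex.I)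

/-- The second-order differential operator
`T_α = -(α²/4)(1-|z|²)^(-α-1) + (α/2)(1-|z|²)^(-α-1)(z ∂_z + z̄ ∂_z̄) + (1/4)(1-|z|²)^(-α) Δ`. -/
noncomputable def opT (α : ℝ) (u : ℂ → ℂ) (z : ℂ) : ℂ :=
  -(((α ^ 2 / 4) * (1 - ‖z‖ ^ 2) ^ (-α - 1) : ℝ) : ℂ) * u z
    + (((α / 2) * (1 - ‖z‖ ^ 2) ^ (-α - 1) : ℝ) : ℂ)
        * (z * wirtinger u z + (starRingEnd ℂ) z * wirtingerBar u z)
    + (((1 / 4) * (1 - ‖z‖ ^ 2) ^ (-α) : ℝ) : ℂ) * Laplacian.laplacian u z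

/-- `u` is `α`-harmonic: of class `C²` on the open unit disk, with `T_α u = 0` there.
The values of `u` outside the open disk play no role. -/
def IsAlphaHarmonic (α : ℝ) (u : ℂ → ℂ) : Prop :=
  ContDiffOn ℝ 2 u (Metric.ball 0 1) ∧ ∀ z ∈ Metric.ball (0 : ℂ) 1, opT α u z = 0

/-- The point `r e^{iθ}`. -/
noncomputable def polar (r θ : ℝ) : ℂ := (r : ℂ) * Complex.exp ((θ : ℂ) * Complex.I)

/-- The integral mean `M_p(r, u) = ((1/2π) ∫_0^{2π} |u(r e^{iθ})|^p dθ)^{1/p}`. -/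
noncomputable def integralMean (p r : ℝ) (u : ℂ → ℂ) : ℝ :=
  ((1 / (2 * π)) * ∫ θ in (0 : ℝ)..(2 * π), ‖u (polar r θ)‖ ^ p) ^ (1 / p)

/-- The Hardy space `h^p_α(𝔻)`: the `α`-harmonic functions on the unit disk whose integral means
`M_p(r, u)`, `0 ≤ r < 1`, are bounded. -/
def MemHardy (α p : ℝ) (u : ℂ → ℂ) : Prop :=
  IsAlphaHarmonic α u ∧ ∃ M : ℝ, ∀ r ∈ Ico (0 : ℝ) 1, integralMean p r u ≤ M

/-- The boundary value `u(e^{iθ}) = lim_{r → 1⁻} u(r e^{iθ})` (radial limit; an arbitrary value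
at those `θ` where the limit does not exist). -/
noncomputable def radialLimit (u : ℂ → ℂ) (θ : ℝ) : ℂ :=
  limUnder (𝓝[<] (1 : ℝ)) (fun r : ℝ => u (polar r θ))

/-- `c_α = Γ(α/2 + 1)² / Γ(1 + α)`. -/
noncomputable def cConst (α : ℝ) : ℝ := Real.Gamma (α / 2 + 1) ^ 2 / Real.Gamma (1 + α)

/-- The secant function. -/
noncomputable def sec (x : ℝ) : ℝ := 1 / Real.cos x

/-- `C(α, p) = (2^(α-1) c_α / π) B((1 + α + 1/p)/2, (1 - 1/p)/2) sec^(p-1)(π/(2p))`. -/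
noncomputable def rfConst (α p : ℝ) : ℝ :=
  2 ^ (α - 1) * cConst α / π
    * ProbabilityTheory.beta ((1 / 2) * (1 + α + 1 / p)) ((1 / 2) * (1 - 1 / p))
    * sec (π / (2 * p)) ^ (p - 1)

/-- `K` is admissible in the Riesz-Fejér inequality on the diameter of direction `s`: for all
`u ∈ h^p_α`, `∫_{-1}^{1} |u(r e^{is})|^p dr ≤ K ∫_0^{2π} |u(e^{iθ})|^p dθ`. -/
def RieszFejerBound (α p s K : ℝ) : Prop :=
  ∀ u : ℂ → ℂ, MemHardy α p u →
    ∫⁻ r in Ioo (-1 : ℝ) 1, ‖u (polar r s)‖ₑ ^ p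
      ≤ ENNReal.ofReal K * ∫⁻ θ in Ioc (0 : ℝ) (2 * π), ‖radialLimit u θ‖ₑ ^ p

end AlphaHarmonic

/-! On the disk, `T_α u = 0` is equivalent to `(1 - |z|²) Δu + 2α Du(z)z - α² u = 0` (`redOp`),
which is linear and invariant under rotations, so everything can be decomposed into Fourier modes or
written as a convolution on circles. The proof has three ingredients.

Representation. The kernel `pk` is α-harmonic, and for `-1 < α ≤ 0` it is an approximate identity
that decreases on `[0, π]`; integration by parts against a primitive of the density then gives
radial limits almost everywhere (`ae_tendsto_pInt`). Bounded `L^p` means with `p > 1` make the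
traces on circles equi-integrable, so along an ultrafilter they have a weak limit `f` in `L¹`
(`exists_weak_limit`). Each Fourier mode of `u` minus the matching multiple of the mode of the
kernel solves a radial equation that makes its modulus increase with the radius
(`norm_sq_monotoneOn_of_homogeneous`). It tends to zero along the chosen radii, hence vanishes, and
`u` is the Poisson integral of `f` (`exists_pInt_eq`). Fatou's lemma puts `f` in `L^p`.

Inequality. This is Schur's test for the kernel `P_α(r e^{i(s-t)})`, with weight `|2 sin (s-t)|` in
the angle and a power of `1 - r²` in the radius. The angular half (`lintegral_pk_mul_rpow_sin_le`)
comes from `|H|^{-b} ≤ sec(πb/2) Re H^{-b}` for holomorphic `H` with positive real part, and from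
interpolation between `α = 0` and `α = -2b`. The radial half (`lintegral_pk_radius_le`) comes from a
Möbius change of radius and a weighted arithmetic-geometric mean inequality, which reduce it to one
Beta integral. The product of the two constants is `rfConst`.

Sharpness. At `α = 0` the boundary function `|cot(t/2)|^β` has Poisson integral `sec(πβ/2)
((1+r)/(1-r))^β` on the diameter. Both sides of the inequality are then explicit, and their ratio
tends to `(1/2) sec^p(π/(2p))` as `β ↑ 1/p`. Truncating this function and applying Fatou's lemma,
first in the truncation level and then in `α`, carries the lower bound to small negative `α`
(`eventually_le_of_rieszFejerBound`). -/

namespace AlphaHarmonic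

/-! ### Parametric integrals of smooth functions -/

section Parametric

variable {F : Type*} [NormedAddCommGroup F]

/-- The partial derivative in the first variable of a function of a vector and a real variable. -/
noncomputable def partialFDeriv [NormedSpace ℝ F] (K : ℂ → ℝ → F) (x : ℂ) (t : ℝ) : ℂ →L[ℝ] F :=
  (fderiv ℝ (Function.uncurry K) (x, t)).comp (ContinuousLinearMap.inl ℝ ℂ ℝ)

theorem hasFDerivAt_partialFDeriv [NormedSpace ℝ F] {K : ℂ → ℝ → F} {U : Set ℂ} (hU : IsOpen U)
    (hK : ContDiffOn ℝ 1 (Function.uncurry K) (U ×ˢ univ)) {x : ℂ} (hx : x ∈ U) (t : ℝ) :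
    HasFDerivAt (fun y => K y t) (partialFDeriv K x t) x := by
  have h1 : DifferentiableAt ℝ (Function.uncurry K) (x, t) :=
    (hK.differentiableOn (by norm_num)).differentiableAt
      ((hU.prod isOpen_univ).mem_nhds ⟨hx, mem_univ _⟩)
  exact HasFDerivAt.comp (g := Function.uncurry K) (f := fun y => (y, t)) x h1.hasFDerivAt
    (hasFDerivAt_prodMk_left x t)

theorem contDiffOn_partialFDeriv [NormedSpace ℝ F] {K : ℂ → ℝ → F} {U : Set ℂ} (hU : IsOpen U)
    {m n : WithTop ℕ∞}
    (hK : ContDiffOn ℝ n (Function.uncurry K) (U ×ˢ univ)) (hmn : m + 1 ≤ n) :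
    ContDiffOn ℝ m (Function.uncurry (partialFDeriv K)) (U ×ˢ univ) := by
  have h1 := hK.fderiv_of_isOpen (hU.prod isOpen_univ) hmn
  exact h1.clm_comp contDiffOn_const

theorem exists_bound_of_continuousOn_prod {K : ℂ → ℝ → F} {U : Set ℂ} (hU : IsOpen U)
    (hK : ContinuousOn (Function.uncurry K) (U ×ˢ univ)) {x : ℂ} (hx : x ∈ U) (a b : ℝ) :
    ∃ C : ℝ, ∃ s ∈ 𝓝 x, s ⊆ U ∧ ∀ y ∈ s, ∀ t ∈ uIoc a b, ‖K y t‖ ≤ C := by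
  obtain ⟨ε, hε, hεU⟩ := Metric.nhds_basis_closedBall.mem_iff.1 (hU.mem_nhds hx)
  have hc : IsCompact (Metric.closedBall x ε ×ˢ uIcc a b) :=
    (isCompact_closedBall x ε).prod isCompact_uIcc
  obtain ⟨C, hC⟩ := hc.exists_bound_of_continuousOn
    (hK.mono (prod_mono hεU (subset_univ _)))
  exact ⟨C, _, Metric.closedBall_mem_nhds x hε, hεU, fun y hy t ht =>
    hC (y, t) ⟨hy, uIoc_subset_uIcc ht⟩⟩

theorem aestronglyMeasurable_smul_slice [NormedSpace ℂ F] {K : ℂ → ℝ → F} {U : Set ℂ}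
    (hK : ContinuousOn (Function.uncurry K) (U ×ˢ univ)) {a b : ℝ} {g : ℝ → ℂ}
    (hg : IntervalIntegrable g volume a b) {x : ℂ} (hx : x ∈ U) :
    AEStronglyMeasurable (fun t => g t • K x t) (volume.restrict (uIoc a b)) := by
  have hc : Continuous (fun t => K x t) := by
    have h2 : ContinuousOn (fun t : ℝ => Function.uncurry K (x, t)) univ :=
      hK.comp (by fun_prop) (fun t _ => ⟨hx, mem_univ _⟩)
    simpa [continuousOn_univ, Function.uncurry] using h2
  exact (intervalIntegrable_iff.1 hg).aestronglyMeasurable.smul hc.aestronglyMeasurable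

theorem continuousOn_integral_smul [NormedSpace ℝ F] [NormedSpace ℂ F] {K : ℂ → ℝ → F} {U : Set ℂ}
    (hU : IsOpen U)
    (hK : ContinuousOn (Function.uncurry K) (U ×ˢ univ)) {a b : ℝ} {g : ℝ → ℂ}
    (hg : IntervalIntegrable g volume a b) :
    ContinuousOn (fun x => ∫ t in a..b, g t • K x t) U := by
  intro x hx
  obtain ⟨C, s, hs, hsU, hC⟩ := exists_bound_of_continuousOn_prod hU hK hx a b
  refine ContinuousAt.continuousWithinAt ?_
  refine intervalIntegral.continuousAt_of_dominated_interval (bound := fun t => ‖g t‖ * C)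
    ?_ ?_ ?_ ?_
  · filter_upwards [hs] with y hy using aestronglyMeasurable_smul_slice hK hg (hsU hy)
  · filter_upwards [hs] with y hy
    refine Eventually.of_forall fun t ht => ?_
    rw [norm_smul]
    exact mul_le_mul_of_nonneg_left (hC y hy t ht) (norm_nonneg _)
  · exact hg.norm.mul_const C
  · refine Eventually.of_forall fun t _ => ?_
    have h1 : ContinuousAt (fun y => Function.uncurry K (y, t)) x := by
      have : ContinuousAt (Function.uncurry K) (x, t) :=
        hK.continuousAt ((hU.prod isOpen_univ).mem_nhds ⟨hx, mem_univ _⟩)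
      exact this.comp (f := fun y => (y, t)) (by fun_prop)
    exact h1.const_smul (g t)

/-- Compactness in `t` gives a locally uniform bound on the derivative of `K`, so `‖g t‖` times a
constant dominates and `g` need only be integrable. The target `F` is general so that the lemma also
applies to the derivative of `K`. -/
theorem hasFDerivAt_integral_smul [NormedSpace ℝ F] [NormedSpace ℂ F] [CompleteSpace F]
    [IsScalarTower ℝ ℂ F]
    {K : ℂ → ℝ → F} {U : Set ℂ} (hU : IsOpen U)
    (hK : ContDiffOn ℝ 1 (Function.uncurry K) (U ×ˢ univ)) {a b : ℝ} {g : ℝ → ℂ}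
    (hg : IntervalIntegrable g volume a b) {x : ℂ} (hx : x ∈ U) :
    HasFDerivAt (fun x => ∫ t in a..b, g t • K x t)
      (∫ t in a..b, g t • partialFDeriv K x t) x := by
  have hK' := (contDiffOn_partialFDeriv (m := 0) hU hK (by norm_num)).continuousOn
  obtain ⟨C, s, hs, hsU, hC⟩ := exists_bound_of_continuousOn_prod hU hK' hx a b
  obtain ⟨C₀, s₀, hs₀, -, hC₀⟩ := exists_bound_of_continuousOn_prod hU hK.continuousOn hx a b
  refine intervalIntegral.hasFDerivAt_integral_of_dominated_of_fderiv_le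
    (bound := fun t => ‖g t‖ * C) (F' := fun x t => g t • partialFDeriv K x t) hs ?_ ?_ ?_ ?_ ?_ ?_
  · filter_upwards [hs] with y hy using aestronglyMeasurable_smul_slice hK.continuousOn hg (hsU hy)
  · refine (hg.norm.mul_const C₀).mono_fun
      (aestronglyMeasurable_smul_slice hK.continuousOn hg hx) ?_
    refine (ae_restrict_iff' measurableSet_uIoc).2 (Eventually.of_forall fun t ht => ?_)
    simp only [norm_smul]
    refine (mul_le_mul_of_nonneg_left (hC₀ x (mem_of_mem_nhds hs₀) t ht)
      (norm_nonneg _)).trans (le_abs_self _)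
  · exact aestronglyMeasurable_smul_slice hK' hg hx
  · refine Eventually.of_forall fun t ht y hy => ?_
    rw [norm_smul]
    exact mul_le_mul_of_nonneg_left (hC y hy t ht) (norm_nonneg _)
  · exact hg.norm.mul_const C
  · refine Eventually.of_forall fun t ht y hy => ?_
    exact (hasFDerivAt_partialFDeriv hU hK (hsU hy) t).const_smul (g t)

end Parametric

/-! ### The reduced operator and its invariance under rotations -/

/-- The first-order part of `T_α` is the Euler field: expand `z` in the real basis `1, i`. -/
theorem mul_wirtinger_add_conj_mul_wirtingerBar (u : ℂ → ℂ) (z : ℂ) :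
    z * wirtinger u z + (starRingEnd ℂ) z * wirtingerBar u z = fderiv ℝ u z z := by
  have h : fderiv ℝ u z z = z.re * fderiv ℝ u z 1 + z.im * fderiv ℝ u z Complex.I := by
    conv_lhs => rw [show fderiv ℝ u z z = fderiv ℝ u z (z.re • (1 : ℂ) + z.im • Complex.I) by
      congr 1; simp [Complex.re_add_im]]
    rw [map_add, map_smul, map_smul, Complex.real_smul, Complex.real_smul]
  rw [h, wirtinger, wirtingerBar]
  apply Complex.ext <;> simp <;> ring

/-- The operator `T_α` multiplied by `4 (1 - |z|²)^(α+1)`, in real form. -/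
noncomputable def redOp (α : ℝ) (u : ℂ → ℂ) (z : ℂ) : ℂ :=
  ((1 - ‖z‖ ^ 2 : ℝ) : ℂ) * Laplacian.laplacian u z + 2 * α * fderiv ℝ u z z - α ^ 2 * u z

theorem opT_eq_mul_redOp (α : ℝ) (u : ℂ → ℂ) {z : ℂ} (hz : z ∈ Metric.ball (0 : ℂ) 1) :
    opT α u z = (((1 / 4) * (1 - ‖z‖ ^ 2) ^ (-α - 1) : ℝ) : ℂ) * redOp α u z := by
  have hz' : 0 < 1 - ‖z‖ ^ 2 := by
    have := mem_ball_zero_iff.1 hz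
    nlinarith [norm_nonneg z]
  have h1 : (1 - ‖z‖ ^ 2) ^ (-α) = (1 - ‖z‖ ^ 2) ^ (-α - 1) * (1 - ‖z‖ ^ 2) := by
    rw [← Real.rpow_add_one hz'.ne']; ring_nf
  rw [opT, mul_wirtinger_add_conj_mul_wirtingerBar, redOp, h1]
  push_cast
  ring

theorem opT_eq_zero_iff (α : ℝ) (u : ℂ → ℂ) {z : ℂ} (hz : z ∈ Metric.ball (0 : ℂ) 1) :
    opT α u z = 0 ↔ redOp α u z = 0 := by
  have hz' : 0 < 1 - ‖z‖ ^ 2 := by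
    have := mem_ball_zero_iff.1 hz
    nlinarith [norm_nonneg z]
  rw [opT_eq_mul_redOp α u hz, mul_eq_zero, or_iff_right]
  have := Real.rpow_pos_of_pos hz' (-α - 1)
  norm_cast
  positivity

theorem isAlphaHarmonic_iff (α : ℝ) (u : ℂ → ℂ) :
    IsAlphaHarmonic α u ↔ ContDiffOn ℝ 2 u (Metric.ball 0 1) ∧
      ∀ z ∈ Metric.ball (0 : ℂ) 1, redOp α u z = 0 :=
  and_congr_right fun _ => forall₂_congr fun _ hz => opT_eq_zero_iff α u hz

theorem laplacian_eq_fderiv_fderiv (u : ℂ → ℂ) (z : ℂ) :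
    Laplacian.laplacian u z = fderiv ℝ (fderiv ℝ u) z 1 1
      + fderiv ℝ (fderiv ℝ u) z Complex.I Complex.I := by
  rw [InnerProductSpace.laplacian_eq_iteratedFDeriv_complexPlane]
  simp [iteratedFDeriv_two_apply]

/-- The Laplacian is the trace of the second derivative in any orthonormal basis, so the right side
is evaluated in the image under `L` of the basis used on the left. -/
theorem laplacian_comp_linearIsometryEquiv (L : ℂ ≃ₗᵢ[ℝ] ℂ) (u : ℂ → ℂ) (z : ℂ) :
    Laplacian.laplacian (fun y => u (L y)) z = Laplacian.laplacian u (L z) := by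
  rw [InnerProductSpace.laplacian_eq_iteratedFDeriv_orthonormalBasis _ Complex.orthonormalBasisOneI,
    InnerProductSpace.laplacian_eq_iteratedFDeriv_orthonormalBasis _
      (Complex.orthonormalBasisOneI.map L)]
  refine Finset.sum_congr rfl fun i _ => ?_
  have h := L.toContinuousLinearEquiv.iteratedFDerivWithin_comp_right u uniqueDiffOn_univ
    (x := z) (mem_univ _) 2
  simp only [preimage_univ, iteratedFDerivWithin_univ] at h
  have h2 : (fun y => u (L y)) = u ∘ L.toContinuousLinearEquiv := rfl
  rw [h2, h]
  simp only [ContinuousMultilinearMap.compContinuousLinearMap_apply, OrthonormalBasis.map_apply]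
  congr 1
  ext j
  fin_cases j <;> rfl

theorem redOp_comp_linearIsometryEquiv (α : ℝ) (L : ℂ ≃ₗᵢ[ℝ] ℂ) (u : ℂ → ℂ) (z : ℂ) :
    redOp α (fun y => u (L y)) z = redOp α u (L z) := by
  have h : fderiv ℝ (fun y => u (L y)) z z = fderiv ℝ u (L z) (L z) := by
    have := L.toContinuousLinearEquiv.comp_right_fderiv (f := u) (x := z)
    have h2 : (fun y => u (L y)) = u ∘ L.toContinuousLinearEquiv := rfl
    rw [h2, this]
    rfl
  rw [redOp, redOp, laplacian_comp_linearIsometryEquiv, h, L.norm_map]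

/-- The rotation `z ↦ z e^{-it}` as a linear isometry. -/
noncomputable def rot (t : ℝ) : ℂ ≃ₗᵢ[ℝ] ℂ := rotation (Circle.exp (-t))

theorem rot_apply (t : ℝ) (z : ℂ) : rot t z = z * Complex.exp (-(t * Complex.I)) := by
  rw [rot, rotation_apply, Circle.coe_exp, mul_comm]
  push_cast
  ring_nf

theorem norm_rot (t : ℝ) (z : ℂ) : ‖rot t z‖ = ‖z‖ := (rot t).norm_map z

theorem rot_add (s t : ℝ) (z : ℂ) : rot (s + t) z = rot s (rot t z) := by
  simp only [rot_apply, mul_assoc, ← Complex.exp_add]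
  push_cast
  ring_nf

theorem rot_polar (t r θ : ℝ) : rot t (polar r θ) = polar r (θ - t) := by
  rw [rot_apply, polar, polar, mul_assoc, ← Complex.exp_add]
  push_cast
  ring_nf

theorem contDiff_uncurry_rot {n : WithTop ℕ∞} :
    ContDiff ℝ n (fun p : ℂ × ℝ => rot p.2 p.1) := by
  simp only [rot_apply]
  have h : ContDiff ℝ n (fun p : ℂ × ℝ => ((p.2 : ℝ) : ℂ)) :=
    Complex.ofRealCLM.contDiff.comp contDiff_snd
  exact contDiff_fst.mul ((h.mul contDiff_const).neg.cexp)

/-! ### Weighted rotational averages -/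

/-- The weighted rotational average `∫ g(t) k(z e^{-it}) dt` over a period. -/
noncomputable def rotAvg (k : ℂ → ℂ) (g : ℝ → ℂ) (z : ℂ) : ℂ :=
  ∫ t in (0 : ℝ)..(2 * π), g t * k (rot t z)

theorem contDiffOn_uncurry_rot {k : ℂ → ℂ} {n : WithTop ℕ∞}
    (hk : ContDiffOn ℝ n k (Metric.ball 0 1)) :
    ContDiffOn ℝ n (Function.uncurry fun (z : ℂ) (t : ℝ) => k (rot t z))
      (Metric.ball 0 1 ×ˢ univ) := by
  refine hk.comp contDiff_uncurry_rot.contDiffOn fun p hp => ?_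
  have := hp.1
  rw [mem_ball_zero_iff] at this ⊢
  rwa [norm_rot]

/-- `hasFDerivAt_integral_smul` is applied twice, to `K` and then to its partial derivative. The
conclusions are directional because `redOp` only needs derivatives applied to vectors, and the
continuity in `t` supplies integrability when sums are split. -/
theorem fderiv_fderiv_integral_smul {K : ℂ → ℝ → ℂ} {U : Set ℂ} (hU : IsOpen U)
    (hK : ContDiffOn ℝ 2 (Function.uncurry K) (U ×ˢ univ)) {a b : ℝ} {g : ℝ → ℂ}
    (hg : IntervalIntegrable g volume a b) :
    ContDiffOn ℝ 2 (fun x => ∫ t in a..b, g t • K x t) U ∧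
    ∀ x ∈ U, (∀ v, fderiv ℝ (fun x => ∫ t in a..b, g t • K x t) x v =
        ∫ t in a..b, g t • fderiv ℝ (fun y => K y t) x v) ∧
      (∀ v, Continuous fun t => fderiv ℝ (fun y => K y t) x v) ∧
      (∀ v w, Continuous fun t => fderiv ℝ (fderiv ℝ (fun y => K y t)) x v w) ∧
      (∀ v w, fderiv ℝ (fderiv ℝ (fun x => ∫ t in a..b, g t • K x t)) x v w =
        ∫ t in a..b, g t • fderiv ℝ (fderiv ℝ (fun y => K y t)) x v w) := by
  have hK1 : ContDiffOn ℝ 1 (Function.uncurry K) (U ×ˢ univ) := hK.of_le (by norm_num)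
  have hP : ContDiffOn ℝ 1 (Function.uncurry (partialFDeriv K)) (U ×ˢ univ) :=
    contDiffOn_partialFDeriv hU hK (by norm_num)
  have hPP : ContDiffOn ℝ 0 (Function.uncurry (partialFDeriv (partialFDeriv K))) (U ×ˢ univ) :=
    contDiffOn_partialFDeriv hU hP (by norm_num)
  have d1 : ∀ x ∈ U, HasFDerivAt (fun x => ∫ t in a..b, g t • K x t)
      (∫ t in a..b, g t • partialFDeriv K x t) x := fun x hx =>
    hasFDerivAt_integral_smul hU hK1 hg hx
  have d2 : ∀ x ∈ U, HasFDerivAt (fun x => ∫ t in a..b, g t • partialFDeriv K x t)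
      (∫ t in a..b, g t • partialFDeriv (partialFDeriv K) x t) x := fun x hx =>
    hasFDerivAt_integral_smul hU hP hg hx
  have e1 : ∀ x ∈ U, fderiv ℝ (fun x => ∫ t in a..b, g t • K x t) x
      = ∫ t in a..b, g t • partialFDeriv K x t := fun x hx => (d1 x hx).fderiv
  have e2 : ∀ x ∈ U, fderiv ℝ (fderiv ℝ (fun x => ∫ t in a..b, g t • K x t)) x
      = ∫ t in a..b, g t • partialFDeriv (partialFDeriv K) x t := fun x hx => by
    rw [← (d2 x hx).fderiv]
    exact Filter.EventuallyEq.fderiv_eq (by filter_upwards [hU.mem_nhds hx] with y hy using e1 y hy)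
  have f1 : ∀ x ∈ U, ∀ t, fderiv ℝ (fun y => K y t) x = partialFDeriv K x t := fun x hx t =>
    (hasFDerivAt_partialFDeriv hU hK1 hx t).fderiv
  have f2 : ∀ x ∈ U, ∀ t, fderiv ℝ (fderiv ℝ (fun y => K y t)) x
      = partialFDeriv (partialFDeriv K) x t := fun x hx t => by
    rw [← (hasFDerivAt_partialFDeriv hU hP hx t).fderiv]
    exact Filter.EventuallyEq.fderiv_eq
      (by filter_upwards [hU.mem_nhds hx] with y hy using f1 y hy t)
  have cc : ∀ {G : Type} [NormedAddCommGroup G] (M : ℂ → ℝ → G)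
      (hM : ContinuousOn (Function.uncurry M) (U ×ˢ univ)) (x : ℂ) (hx : x ∈ U),
      Continuous fun t : ℝ => M x t := by
    intro G _ M hM x hx
    have h2 : ContinuousOn (fun t : ℝ => Function.uncurry M (x, t)) univ :=
      hM.comp (by fun_prop) (fun t _ => ⟨hx, mem_univ _⟩)
    simpa [continuousOn_univ, Function.uncurry] using h2
  have ii : ∀ {G : Type} [NormedAddCommGroup G] [NormedSpace ℂ G] (M : ℂ → ℝ → G)
      (hM : ContinuousOn (Function.uncurry M) (U ×ˢ univ)) (x : ℂ) (hx : x ∈ U),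
      IntervalIntegrable (fun t => g t • M x t) volume a b := by
    intro G _ _ M hM x hx
    exact hg.smul_continuousOn (cc M hM x hx).continuousOn
  refine ⟨?_, fun x hx => ⟨fun v => ?_, fun v => ?_, fun v w => ?_, fun v w => ?_⟩⟩
  · have c1 : ContDiffOn ℝ 1 (fun x => ∫ t in a..b, g t • partialFDeriv K x t) U := by
      rw [show (1 : WithTop ℕ∞) = 0 + 1 by norm_num, contDiffOn_succ_iff_fderiv_of_isOpen hU]
      refine ⟨fun x hx => (d2 x hx).differentiableAt.differentiableWithinAt, by simp, ?_⟩
      refine ContDiffOn.congr ?_ fun x hx => (d2 x hx).fderiv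
      rw [contDiffOn_zero]
      exact continuousOn_integral_smul hU hPP.continuousOn hg
    rw [show (2 : WithTop ℕ∞) = 1 + 1 by norm_num, contDiffOn_succ_iff_fderiv_of_isOpen hU]
    exact ⟨fun x hx => (d1 x hx).differentiableAt.differentiableWithinAt, by simp,
      c1.congr e1⟩
  · rw [e1 x hx, ContinuousLinearMap.intervalIntegral_apply (ii _ hP.continuousOn x hx)]
    refine intervalIntegral.integral_congr fun t _ => ?_
    simp [f1 x hx t]
  · simp only [f1 x hx]
    exact (cc _ hP.continuousOn x hx).clm_apply continuous_const
  · simp only [f2 x hx]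
    exact ((cc _ hPP.continuousOn x hx).clm_apply continuous_const).clm_apply continuous_const
  · rw [e2 x hx, ContinuousLinearMap.intervalIntegral_apply (ii _ hPP.continuousOn x hx),
      ContinuousLinearMap.intervalIntegral_apply]
    · refine intervalIntegral.integral_congr fun t _ => ?_
      simp [f2 x hx t]
    · have := ii (fun x t => partialFDeriv (partialFDeriv K) x t v)
        (hPP.continuousOn.clm_apply continuousOn_const) x hx
      simpa using this

/-- `redOp` passes under the integral and commutes with rotations. This serves twice: with `k` the
Poisson kernel it gives Poisson integrals, with `k = u` and an exponential weight it extracts a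
Fourier mode. -/
theorem IsAlphaHarmonic.rotAvg {α : ℝ} {k : ℂ → ℂ} (hk : IsAlphaHarmonic α k) {g : ℝ → ℂ}
    (hg : IntervalIntegrable g volume 0 (2 * π)) : IsAlphaHarmonic α (rotAvg k g) := by
  rw [isAlphaHarmonic_iff] at hk ⊢
  obtain ⟨hk, hk0⟩ := hk
  have hK := contDiffOn_uncurry_rot hk
  obtain ⟨h1, h2⟩ := fderiv_fderiv_integral_smul Metric.isOpen_ball hK hg
  refine ⟨h1, fun z hz => ?_⟩
  obtain ⟨h3, h4, h5, h6⟩ := h2 z hz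
  have ci : ∀ M : ℝ → ℂ, Continuous M →
      IntervalIntegrable (fun t => g t * M t) volume 0 (2 * π) := fun M hM =>
    hg.mul_continuousOn hM.continuousOn
  have hcont : Continuous fun t : ℝ => k (rot t z) := by
    have h7 : ContinuousOn (fun t : ℝ => (Function.uncurry fun z t => k (rot t z)) (z, t)) univ :=
      hK.continuousOn.comp (by fun_prop) (fun t _ => ⟨hz, mem_univ _⟩)
    simpa [continuousOn_univ, Function.uncurry] using h7
  have key : ∀ t, redOp α (fun y => k (rot t y)) z = 0 := fun t => by
    rw [redOp_comp_linearIsometryEquiv]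
    exact hk0 _ (by rw [mem_ball_zero_iff, norm_rot]; exact mem_ball_zero_iff.1 hz)
  have e : AlphaHarmonic.rotAvg k g = fun x => ∫ t in (0 : ℝ)..(2 * π), g t • k (rot t x) := rfl
  have : redOp α (AlphaHarmonic.rotAvg k g) z
      = ∫ t in (0 : ℝ)..(2 * π), g t * redOp α (fun y => k (rot t y)) z := by
    simp only [redOp, laplacian_eq_fderiv_fderiv, mul_sub, mul_add]
    rw [e, h3, h6, h6]
    simp only [smul_eq_mul]
    rw [intervalIntegral.integral_sub, intervalIntegral.integral_add,
      intervalIntegral.integral_add]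
    · simp only [mul_left_comm (g _), intervalIntegral.integral_const_mul]
    · exact ci _ (continuous_const.mul (h5 _ _))
    · exact ci _ (continuous_const.mul (h5 _ _))
    · exact (ci _ (continuous_const.mul (h5 _ _))).add (ci _ (continuous_const.mul (h5 _ _)))
    · exact ci _ (continuous_const.mul (h4 _))
    · exact ((ci _ (continuous_const.mul (h5 _ _))).add
        (ci _ (continuous_const.mul (h5 _ _)))).add (ci _ (continuous_const.mul (h4 _)))
    · exact ci _ (continuous_const.mul hcont)
  rw [this]
  simp [key]

/-! ### Homogeneous `α`-harmonic functions -/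

theorem hasDerivAt_fderiv_comp {F : ℂ → ℂ} {γ γ' : ℝ → ℂ} {t : ℝ} {γ'' : ℂ}
    (hF : ContDiffAt ℝ 2 F (γ t)) (h1 : HasDerivAt γ (γ' t) t) (h2 : HasDerivAt γ' γ'' t) :
    HasDerivAt (fun s => fderiv ℝ F (γ s) (γ' s))
      (fderiv ℝ (fderiv ℝ F) (γ t) (γ' t) (γ' t) + fderiv ℝ F (γ t) γ'') t := by
  have h3 : DifferentiableAt ℝ (fderiv ℝ F) (γ t) :=
    (hF.fderiv_right (m := 1) (by norm_num)).differentiableAt (by norm_num)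
  exact (h3.hasFDerivAt.comp_hasDerivAt t h1).clm_apply h2

theorem hasDerivAt_comp_curve {F : ℂ → ℂ} {γ : ℝ → ℂ} {γ' : ℂ} {t : ℝ}
    (hF : ContDiffAt ℝ 2 F (γ t)) (h1 : HasDerivAt γ γ' t) :
    HasDerivAt (fun s => F (γ s)) (fderiv ℝ F (γ t) γ') t :=
  (hF.differentiableAt (by norm_num)).hasFDerivAt.comp_hasDerivAt t h1

theorem hasDerivAt_rot (t : ℝ) (z : ℂ) :
    HasDerivAt (fun s : ℝ => rot s z) (-Complex.I * rot t z) t := by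
  simp only [rot_apply]
  have h : HasDerivAt (fun s : ℝ => -((s : ℂ) * Complex.I)) (-(1 * Complex.I)) t :=
    ((hasDerivAt_id t).ofReal_comp.mul_const Complex.I).neg
  refine (h.cexp.const_mul z).congr_deriv ?_
  ring

/-- The radial differential equation satisfied by a homogeneous `α`-harmonic function. -/
theorem radial_ode {α : ℝ} {w : ℂ → ℂ} (hw : IsAlphaHarmonic α w) {n : ℝ}
    (hn : ∀ z ∈ Metric.ball (0 : ℂ) 1, ∀ t : ℝ,
      w (rot t z) = Complex.exp (-(n * t * Complex.I)) * w z)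
    {r : ℝ} (hr : r ∈ Ioo (0 : ℝ) 1) :
    fderiv ℝ (fderiv ℝ w) r 1 1 =
      (-(1 / r) - 2 * α * r / (1 - r ^ 2)) • fderiv ℝ w r 1
        + (n ^ 2 / r ^ 2 + α ^ 2 / (1 - r ^ 2)) • w r := by
  rw [isAlphaHarmonic_iff] at hw
  obtain ⟨hC, h0⟩ := hw
  have hrb : (r : ℂ) ∈ Metric.ball (0 : ℂ) 1 := by
    rw [mem_ball_zero_iff, Complex.norm_real, Real.norm_of_nonneg hr.1.le]; exact hr.2
  have hCt : ∀ t : ℝ, ContDiffAt ℝ 2 w (rot t r) := fun t =>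
    hC.contDiffAt (Metric.isOpen_ball.mem_nhds
      (by rw [mem_ball_zero_iff, norm_rot]; exact mem_ball_zero_iff.1 hrb))
  have hrot0 : rot 0 (r : ℂ) = r := by simp [rot_apply]
  have d1 : ∀ t : ℝ, HasDerivAt (fun t : ℝ => w (rot t r))
      (fderiv ℝ w (rot t r) (-Complex.I * rot t r)) t := fun t =>
    hasDerivAt_comp_curve (hCt t) (hasDerivAt_rot t r)
  have d1' : ∀ t : ℝ, HasDerivAt (fun t : ℝ => w (rot t r))
      (-(n * Complex.I) * Complex.exp (-(n * t * Complex.I)) * w r) t := fun t => by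
    have h : HasDerivAt (fun s : ℝ => -((n : ℂ) * (s : ℂ) * Complex.I)) (-(n * 1 * Complex.I)) t :=
      (((hasDerivAt_id t).ofReal_comp.const_mul (n : ℂ)).mul_const Complex.I).neg
    simp only [hn _ hrb]
    refine (h.cexp.mul_const (w r)).congr_deriv ?_
    ring
  have e1 : (fun t : ℝ => fderiv ℝ w (rot t r) (-Complex.I * rot t r))
      = fun t : ℝ => -(n * Complex.I) * Complex.exp (-(n * t * Complex.I)) * w r :=
    funext fun t => (d1 t).unique (d1' t)
  have d2 := hasDerivAt_fderiv_comp (F := w) (γ := fun t : ℝ => rot t r)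
    (γ' := fun t : ℝ => -Complex.I * rot t r) (t := 0) (hCt 0) (hasDerivAt_rot 0 r)
    ((hasDerivAt_rot 0 r).const_mul (-Complex.I))
  have d2' : HasDerivAt (fun t : ℝ => -(n * Complex.I) * Complex.exp (-(n * t * Complex.I)) * w r)
      (-(n : ℂ) ^ 2 * w r) 0 := by
    have h : HasDerivAt (fun s : ℝ => -((n : ℂ) * (s : ℂ) * Complex.I)) (-(n * 1 * Complex.I)) 0 :=
      (((hasDerivAt_id (0 : ℝ)).ofReal_comp.const_mul (n : ℂ)).mul_const Complex.I).neg
    refine ((h.cexp.const_mul (-(n * Complex.I))).mul_const (w r)).congr_deriv ?_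
    simp
    linear_combination (n : ℂ) ^ 2 * w r * Complex.I_sq
  -- Comparing the two computations of the second angular derivative at `t = 0` expresses the second
  -- derivative in the direction `i` through the radial data: the Laplacian in polar coordinates.
  rw [e1] at d2
  have e2 := d2.unique d2'
  simp only [hrot0] at e2
  have e3 : -Complex.I * (-Complex.I * (r : ℂ)) = (-r : ℝ) • (1 : ℂ) := by
    simp; linear_combination (r : ℂ) * Complex.I_sq
  have e4 : -Complex.I * (r : ℂ) = (-r : ℝ) • Complex.I := by simp; ring
  rw [e3, e4] at e2
  simp only [map_smul, smul_apply] at e2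
  simp only [Complex.real_smul] at e2
  have h0r := h0 _ hrb
  rw [redOp, laplacian_eq_fderiv_fderiv, Complex.norm_real, Real.norm_of_nonneg hr.1.le] at h0r
  have e5 : fderiv ℝ w (r : ℂ) (r : ℂ) = r * fderiv ℝ w (r : ℂ) 1 := by
    conv_lhs => rw [show fderiv ℝ w (r : ℂ) (r : ℂ) =
      fderiv ℝ w (r : ℂ) ((r : ℝ) • (1 : ℂ)) by simp]
    rw [map_smul, Complex.real_smul]
  rw [e5] at h0r
  have hr0 : (r : ℂ) ≠ 0 := by exact_mod_cast hr.1.ne'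
  have hr1 : (1 - (r : ℂ) ^ 2) ≠ 0 := by
    have : (1 - r ^ 2 : ℝ) ≠ 0 := by nlinarith [hr.1, hr.2]
    exact_mod_cast this
  simp only [Complex.real_smul]
  push_cast at h0r e2 ⊢
  generalize fderiv ℝ (fderiv ℝ w) r 1 1 = A at *
  generalize fderiv ℝ (fderiv ℝ w) r Complex.I Complex.I = B at *
  generalize fderiv ℝ w r 1 = D at *
  generalize w r = W at *
  have hB : B = (r * D - n ^ 2 * W) / r ^ 2 := by
    field_simp
    linear_combination e2
  rw [hB] at h0r
  field_simp at h0r ⊢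
  linear_combination h0r

/-- A maximum principle for a single Fourier mode. The factor `r (1 - r²)^(-α)` integrates the
first-order term of the radial equation, so `E = r (1 - r²)^(-α) ⟨w, w'⟩` has nonnegative
derivative; it vanishes at `0`, hence `⟨w, w'⟩ ≥ 0`. -/
theorem norm_sq_monotoneOn_of_homogeneous {α : ℝ} {w : ℂ → ℂ} (hw : IsAlphaHarmonic α w) {n : ℝ}
    (hn : ∀ z ∈ Metric.ball (0 : ℂ) 1, ∀ t : ℝ,
      w (rot t z) = Complex.exp (-(n * t * Complex.I)) * w z) :
    MonotoneOn (fun r : ℝ => ‖w r‖ ^ 2) (Ico 0 1) := by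
  have hC := hw.1
  have hb : ∀ {r : ℝ}, r ∈ Ico (0 : ℝ) 1 → (r : ℂ) ∈ Metric.ball (0 : ℂ) 1 := fun {r} hr => by
    rw [mem_ball_zero_iff, Complex.norm_real, Real.norm_of_nonneg hr.1]; exact hr.2
  have hCr : ∀ {r : ℝ}, r ∈ Ico (0 : ℝ) 1 → ContDiffAt ℝ 2 w (r : ℂ) := fun hr =>
    hC.contDiffAt (Metric.isOpen_ball.mem_nhds (hb hr))
  have da : ∀ {r : ℝ}, r ∈ Ico (0 : ℝ) 1 →
      HasDerivAt (fun r : ℝ => w r) (fderiv ℝ w r 1) r := fun {r} hr =>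
    hasDerivAt_comp_curve (γ := fun r : ℝ => (r : ℂ)) (hCr hr) (hasDerivAt_id r).ofReal_comp
  have db : ∀ {r : ℝ}, r ∈ Ico (0 : ℝ) 1 →
      HasDerivAt (fun r : ℝ => fderiv ℝ w r 1) (fderiv ℝ (fderiv ℝ w) r 1 1) r := fun {r} hr => by
    have := hasDerivAt_fderiv_comp (γ := fun r : ℝ => (r : ℂ)) (γ' := fun _ => 1) (hCr hr)
      (hasDerivAt_id r).ofReal_comp (hasDerivAt_const r (1 : ℂ))
    simpa using this
  set E : ℝ → ℝ := fun r => r * (1 - r ^ 2) ^ (-α) * inner ℝ (w r) (fderiv ℝ w r 1) with hE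
  have hpos : ∀ {r : ℝ}, r ∈ Ico (0 : ℝ) 1 → 0 < 1 - r ^ 2 := fun hr => by nlinarith [hr.1, hr.2]
  have dE : ∀ {r : ℝ}, r ∈ Ico (0 : ℝ) 1 → HasDerivAt E
      ((1 * (1 - r ^ 2) ^ (-α) + r * (-(2 * r) * (-α) * (1 - r ^ 2) ^ (-α - 1)))
          * inner ℝ (w r) (fderiv ℝ w r 1)
        + r * (1 - r ^ 2) ^ (-α) * (inner ℝ (w r) (fderiv ℝ (fderiv ℝ w) r 1 1)
          + inner ℝ (fderiv ℝ w r 1) (fderiv ℝ w r 1))) r := fun {r} hr => by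
    have h1 : HasDerivAt (fun r : ℝ => 1 - r ^ 2) (-(2 * r)) r := by
      simpa using (hasDerivAt_pow 2 r).const_sub 1
    exact ((hasDerivAt_id r).mul (h1.rpow_const (Or.inl (hpos hr).ne'))).mul
      ((da hr).inner ℝ (db hr))
  have E_mono : MonotoneOn E (Ico 0 1) := by
    refine monotoneOn_of_deriv_nonneg (convex_Ico 0 1)
      (fun r hr => (dE hr).continuousAt.continuousWithinAt)
      (fun r hr => (dE (interior_subset hr)).differentiableAt.differentiableWithinAt) ?_
    intro r hr
    rw [interior_Ico] at hr
    have hr' : r ∈ Ico (0 : ℝ) 1 := Ioo_subset_Ico_self hr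
    rw [(dE hr').deriv, radial_ode hw hn hr, inner_add_right, inner_smul_right, inner_smul_right,
      real_inner_self_eq_norm_sq, real_inner_self_eq_norm_sq, Real.rpow_sub_one (hpos hr').ne']
    have hp := hpos hr'
    have hX := Real.rpow_pos_of_pos hp (-α)
    have hr0 := hr.1
    -- All terms in `⟨w, w'⟩` cancel; what remains is a sum of squares with nonnegative
    -- coefficients.
    have : ((1 * (1 - r ^ 2) ^ (-α) + r * (-(2 * r) * (-α) * ((1 - r ^ 2) ^ (-α) / (1 - r ^ 2))))
          * inner ℝ (w r) (fderiv ℝ w r 1)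
        + r * (1 - r ^ 2) ^ (-α) * ((-(1 / r) - 2 * α * r / (1 - r ^ 2))
          * inner ℝ (w r) (fderiv ℝ w r 1) + (n ^ 2 / r ^ 2 + α ^ 2 / (1 - r ^ 2)) * ‖w r‖ ^ 2
          + ‖fderiv ℝ w r 1‖ ^ 2))
        = r * (1 - r ^ 2) ^ (-α) * ((n ^ 2 / r ^ 2 + α ^ 2 / (1 - r ^ 2)) * ‖w r‖ ^ 2
          + ‖fderiv ℝ w r 1‖ ^ 2) := by
      field_simp
      ring
    rw [this]
    positivity
  refine monotoneOn_of_deriv_nonneg (convex_Ico 0 1)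
    (fun r hr => (da hr).norm_sq.continuousAt.continuousWithinAt)
    (fun r hr => (da (interior_subset hr)).norm_sq.differentiableAt.differentiableWithinAt) ?_
  intro r hr
  rw [interior_Ico] at hr
  have hr' : r ∈ Ico (0 : ℝ) 1 := Ioo_subset_Ico_self hr
  rw [(da hr').norm_sq.deriv]
  have h1 : 0 ≤ E r := by
    have := E_mono (left_mem_Ico.2 one_pos) hr' hr.1.le
    simpa [hE] using this
  have h2 : 0 < r * (1 - r ^ 2) ^ (-α) := mul_pos hr.1 (Real.rpow_pos_of_pos (hpos hr') _)
  have h3 := nonneg_of_mul_nonneg_right h1 h2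
  positivity

/-! ### The Poisson kernel -/

/-- The Poisson kernel `c_α (1 - |z|²)^(α+1) / |1 - z|^(α+2)`. -/
noncomputable def pk (α : ℝ) (z : ℂ) : ℝ :=
  cConst α * ((1 - ‖z‖ ^ 2) ^ (α + 1) * (‖1 - z‖ ^ 2) ^ (-(α + 2) / 2))

/-- Reduces first and second directional derivatives to one-variable calculus on a line; this is how
the kernel is differentiated. -/
theorem fderiv_fderiv_eq_of_line {F : ℂ → ℂ} {z v c : ℂ} {h : ℝ → ℂ} (hF : ContDiffAt ℝ 2 F z)
    (h1 : ∀ᶠ t : ℝ in 𝓝 0, HasDerivAt (fun t : ℝ => F (z + t * v)) (h t) t)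
    (h2 : HasDerivAt h c 0) : fderiv ℝ F z v = h 0 ∧ fderiv ℝ (fderiv ℝ F) z v v = c := by
  have hγ : ∀ t : ℝ, HasDerivAt (fun t : ℝ => z + t * v) v t := fun t => by
    simpa using ((hasDerivAt_id t).ofReal_comp.mul_const v).const_add z
  have hz0 : z + ((0 : ℝ) : ℂ) * v = z := by simp
  have hcont : Tendsto (fun t : ℝ => z + (t : ℂ) * v) (𝓝 0) (𝓝 z) := by
    have := (hγ 0).continuousAt.tendsto
    rwa [hz0] at this
  have hev : ∀ᶠ t : ℝ in 𝓝 0, ContDiffAt ℝ 2 F (z + t * v) :=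
    hcont.eventually (hF.eventually (by norm_num))
  have e : h =ᶠ[𝓝 0] fun t : ℝ => fderiv ℝ F (z + t * v) v := by
    filter_upwards [h1, hev] with t ht1 ht2
    exact ht1.unique (hasDerivAt_comp_curve (γ := fun t : ℝ => z + t * v) ht2 (hγ t))
  refine ⟨by rw [e.self_of_nhds]; simp, ?_⟩
  have d := hasDerivAt_fderiv_comp (F := F) (γ := fun t : ℝ => z + t * v) (γ' := fun _ => v)
    (t := 0) (by rwa [hz0]) (hγ 0) (hasDerivAt_const 0 v)
  have := d.unique (h2.congr_of_eventuallyEq e.symm)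
  simpa [hz0] using this

theorem contDiffOn_pk {n : WithTop ℕ∞} (α : ℝ) : ContDiffOn ℝ n (pk α) (Metric.ball 0 1) := by
  have h1 : ∀ z ∈ Metric.ball (0 : ℂ) 1, 1 - ‖z‖ ^ 2 ≠ 0 := fun z hz => by
    have := mem_ball_zero_iff.1 hz
    nlinarith [norm_nonneg z]
  have h2 : ∀ z ∈ Metric.ball (0 : ℂ) 1, ‖1 - z‖ ^ 2 ≠ 0 := fun z hz => by
    have h3 : (1 : ℂ) - z ≠ 0 := fun h => by
      have : z = 1 := (sub_eq_zero.1 h).symm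
      simp [this] at hz
    positivity
  refine contDiffOn_const.mul (ContDiffOn.mul ?_ ?_)
  · exact ContDiffOn.rpow_const_of_ne
      (contDiffOn_const.sub (contDiff_norm_sq ℝ).contDiffOn) h1
  · exact ContDiffOn.rpow_const_of_ne
      ((contDiff_norm_sq ℝ).comp_contDiffOn (contDiffOn_const.sub contDiffOn_id)) h2

/-- On each line through `z`, both `1 - |z|²` and `|1 - z|²` are quadratic polynomials in the
parameter, so the kernel is a product of powers of quadratics and logarithmic differentiation gives
its derivatives. The directions `1`, `i` and `z` suffice, and the equation becomes a rational
identity in the two coordinates. -/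
theorem redOp_pk (α : ℝ) {z : ℂ} (hz : z ∈ Metric.ball (0 : ℂ) 1) :
    redOp α (fun z => (pk α z : ℂ)) z = 0 := by
  have hC : ContDiffAt ℝ 2 (fun z => (pk α z : ℂ)) z :=
    (Complex.ofRealCLM.contDiff.comp_contDiffOn (contDiffOn_pk α)).contDiffAt
      (Metric.isOpen_ball.mem_nhds hz)
  set ρ : ℂ → ℝ := fun z => 1 - ‖z‖ ^ 2 with hρ
  set q : ℂ → ℝ := fun z => ‖1 - z‖ ^ 2 with hq
  have hρpos : 0 < ρ z := by
    have := mem_ball_zero_iff.1 hz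
    simp only [hρ]
    nlinarith [norm_nonneg z]
  have hqpos : 0 < q z := by
    have h3 : (1 : ℂ) - z ≠ 0 := fun h => by
      have : z = 1 := (sub_eq_zero.1 h).symm
      simp [this] at hz
    positivity
  have hρe : ∀ v : ℂ, ∀ t : ℝ, ρ (z + t * v) = ρ z - 2 * (z.re * v.re + z.im * v.im) * t
      - (v.re ^ 2 + v.im ^ 2) * t ^ 2 := fun v t => by
    simp only [hρ, Complex.sq_norm, Complex.normSq_apply]
    simp
    ring
  have hqe : ∀ v : ℂ, ∀ t : ℝ, q (z + t * v) = q z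
      - 2 * ((1 - z.re) * v.re - z.im * v.im) * t
      + (v.re ^ 2 + v.im ^ 2) * t ^ 2 := fun v t => by
    simp only [hq, Complex.sq_norm, Complex.normSq_apply]
    simp
    ring
  have quad : ∀ a b c t : ℝ, HasDerivAt (fun t : ℝ => a + b * t + c * t ^ 2)
      (b + 2 * c * t) t := fun a b c t => by
    refine (((hasDerivAt_id t).const_mul b).const_add a |>.add
      ((hasDerivAt_pow 2 t).const_mul c)).congr_deriv ?_
    simp
    ring
  have key : ∀ v : ℂ, fderiv ℝ (fun z => (pk α z : ℂ)) z v
        = ((pk α z * ((α + 1) * (-2 * (z.re * v.re + z.im * v.im)) / ρ z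
          + (-(α + 2) / 2) * (-2 * ((1 - z.re) * v.re - z.im * v.im)) / q z) : ℝ) : ℂ) ∧
      fderiv ℝ (fderiv ℝ (fun z => (pk α z : ℂ))) z v v
        = ((pk α z * (((α + 1) * (-2 * (z.re * v.re + z.im * v.im)) / ρ z
          + (-(α + 2) / 2) * (-2 * ((1 - z.re) * v.re - z.im * v.im)) / q z) ^ 2
          + (α + 1) * (-2 * (v.re ^ 2 + v.im ^ 2) / ρ z
            - (-2 * (z.re * v.re + z.im * v.im)) ^ 2 / ρ z ^ 2)
          + (-(α + 2) / 2) * (2 * (v.re ^ 2 + v.im ^ 2) / q z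
            - (-2 * ((1 - z.re) * v.re - z.im * v.im)) ^ 2 / q z ^ 2)) : ℝ) : ℂ) := by
    intro v
    set m := v.re ^ 2 + v.im ^ 2
    set a := -2 * (z.re * v.re + z.im * v.im) with ha
    set b := -2 * ((1 - z.re) * v.re - z.im * v.im) with hb
    set A := α + 1
    set B := -(α + 2) / 2
    set R : ℝ → ℝ := fun t => ρ z + a * t + (-m) * t ^ 2 with hR
    set Q : ℝ → ℝ := fun t => q z + b * t + m * t ^ 2 with hQ
    have dR : ∀ t, HasDerivAt R (a + 2 * (-m) * t) t := fun t => quad _ _ _ t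
    have dQ : ∀ t, HasDerivAt Q (b + 2 * m * t) t := fun t => quad _ _ _ t
    have R0 : R 0 = ρ z := by simp [hR]
    have Q0 : Q 0 = q z := by simp [hQ]
    have epk : ∀ t : ℝ, pk α (z + t * v) = cConst α * (R t ^ A * Q t ^ B) := fun t => by
      have e1 : R t = 1 - ‖z + t * v‖ ^ 2 := by
        have := hρe v t; simp only [hρ] at this; rw [this]; simp only [hR, hρ, ha]; ring
      have e2 : Q t = ‖1 - (z + t * v)‖ ^ 2 := by
        have := hqe v t; simp only [hq] at this; rw [this]; simp only [hQ, hq, hb]; ring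
      rw [e1, e2, pk]
    have Rpos : ∀ᶠ t in 𝓝 (0 : ℝ), 0 < R t :=
      (dR 0).continuousAt.eventually (lt_mem_nhds (by rw [R0]; exact hρpos))
    have Qpos : ∀ᶠ t in 𝓝 (0 : ℝ), 0 < Q t :=
      (dQ 0).continuousAt.eventually (lt_mem_nhds (by rw [Q0]; exact hqpos))
    have d1 : ∀ t, 0 < R t → 0 < Q t → HasDerivAt (fun t : ℝ => pk α (z + t * v))
        (pk α (z + t * v) * (A * ((a + 2 * (-m) * t) / R t) + B * ((b + 2 * m * t) / Q t))) t := by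
      intro t hRt hQt
      simp only [epk]
      refine ((((dR t).rpow_const (p := A) (Or.inl hRt.ne')).mul
        ((dQ t).rpow_const (p := B) (Or.inl hQt.ne'))).const_mul (cConst α)).congr_deriv ?_
      rw [Real.rpow_sub_one hRt.ne', Real.rpow_sub_one hQt.ne']
      field_simp
    have d2 : HasDerivAt (fun t : ℝ => pk α (z + t * v) *
        (A * ((a + 2 * (-m) * t) / R t) + B * ((b + 2 * m * t) / Q t)))
        (pk α z * ((A * a / ρ z + B * b / q z) ^ 2 + A * (-2 * m / ρ z - a ^ 2 / ρ z ^ 2)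
          + B * (2 * m / q z - b ^ 2 / q z ^ 2))) 0 := by
      have lin : ∀ b c : ℝ, HasDerivAt (fun t : ℝ => b + c * t) c 0 := fun b c => by
        simpa using ((hasDerivAt_id (0 : ℝ)).const_mul c).const_add b
      have h1 := (lin a (2 * (-m))).div (dR 0) (by rw [R0]; exact hρpos.ne')
      have h2 := (lin b (2 * m)).div (dQ 0) (by rw [Q0]; exact hqpos.ne')
      refine ((d1 0 (by rw [R0]; exact hρpos) (by rw [Q0]; exact hqpos)).mul
        ((h1.const_mul A).add (h2.const_mul B))).congr_deriv ?_
      simp only [Pi.add_apply, Pi.div_apply, R0, Q0]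
      simp only [mul_zero, add_zero, Complex.ofReal_zero, zero_mul]
      field_simp
      ring
    have := fderiv_fderiv_eq_of_line (F := fun z => (pk α z : ℂ)) (v := v) hC
      (h := fun t => ((pk α (z + t * v) *
        (A * ((a + 2 * (-m) * t) / R t) + B * ((b + 2 * m * t) / Q t)) : ℝ) : ℂ))
      (by filter_upwards [Rpos, Qpos] with t h1 h2 using (d1 t h1 h2).ofReal_comp)
      d2.ofReal_comp
    refine ⟨?_, this.2⟩
    rw [this.1, R0, Q0]
    simp only [mul_zero, add_zero, Complex.ofReal_zero, zero_mul, mul_div_assoc]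
  rw [redOp, laplacian_eq_fderiv_fderiv, (key 1).2, (key Complex.I).2, (key z).1]
  have e1 : 1 - ‖z‖ ^ 2 = ρ z := rfl
  have e2 : ρ z = 1 - z.re ^ 2 - z.im ^ 2 := by
    simp only [hρ, Complex.sq_norm, Complex.normSq_apply]; ring
  have e3 : q z = (1 - z.re) ^ 2 + z.im ^ 2 := by
    simp only [hq, Complex.sq_norm, Complex.normSq_apply]; simp; ring
  rw [e1]
  simp only [Complex.one_re, Complex.one_im, Complex.I_re, Complex.I_im]
  generalize pk α z = P
  have h1 : ((ρ z : ℝ) : ℂ) ≠ 0 := by exact_mod_cast hρpos.ne'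
  have h2 : ((q z : ℝ) : ℂ) ≠ 0 := by exact_mod_cast hqpos.ne'
  rw [e2] at h1 ⊢
  rw [e3] at h2 ⊢
  generalize z.re = x at *
  generalize z.im = y at *
  push_cast at h1 h2 ⊢
  field_simp
  ring

theorem isAlphaHarmonic_pk (α : ℝ) : IsAlphaHarmonic α (fun z => (pk α z : ℂ)) :=
  (isAlphaHarmonic_iff _ _).2
    ⟨Complex.ofRealCLM.contDiff.comp_contDiffOn (contDiffOn_pk α), fun _ hz => redOp_pk α hz⟩

/-! ### Beta integrals -/

theorem lintegral_Ioo_beta {a b : ℝ} (ha : 0 < a) (hb : 0 < b) :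
    ∫⁻ x in Ioo (0 : ℝ) 1, ENNReal.ofReal (x ^ (a - 1) * (1 - x) ^ (b - 1))
      = ENNReal.ofReal (ProbabilityTheory.beta a b) := by
  have hB := ProbabilityTheory.beta_pos ha hb
  have h := ProbabilityTheory.lintegral_betaPDF_eq_one ha hb
  rw [ProbabilityTheory.lintegral_betaPDF] at h
  simp only [mul_assoc] at h
  simp_rw [ENNReal.ofReal_mul (one_div_nonneg.2 hB.le)] at h
  rw [lintegral_const_mul' _ _ ENNReal.ofReal_ne_top] at h
  have h2 : ENNReal.ofReal (ProbabilityTheory.beta a b) *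
      ENNReal.ofReal (1 / ProbabilityTheory.beta a b) = 1 := by
    rw [← ENNReal.ofReal_mul hB.le, mul_one_div_cancel hB.ne', ENNReal.ofReal_one]
  calc _ = ENNReal.ofReal (ProbabilityTheory.beta a b) *
      (ENNReal.ofReal (1 / ProbabilityTheory.beta a b) *
        ∫⁻ x in Ioo (0 : ℝ) 1, ENNReal.ofReal (x ^ (a - 1) * (1 - x) ^ (b - 1))) := by
        rw [← mul_assoc, h2, one_mul]
    _ = _ := by rw [h, mul_one]

theorem lintegral_Ioi_beta {a b : ℝ} (ha : 0 < a) (hb : 0 < b) :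
    ∫⁻ t in Ioi (0 : ℝ), ENNReal.ofReal (t ^ (a - 1) * (1 + t) ^ (-(a + b)))
      = ENNReal.ofReal (ProbabilityTheory.beta a b) := by
  have himg : (fun t : ℝ => t / (1 + t)) '' Ioi 0 = Ioo 0 1 := by
    ext x
    constructor
    · rintro ⟨t, ht, rfl⟩
      have ht : 0 < t := ht
      exact ⟨by positivity, by rw [div_lt_one (by positivity)]; linarith⟩
    · rintro ⟨h0, h1⟩
      refine ⟨x / (1 - x), div_pos h0 (by linarith), ?_⟩
      have : 1 - x ≠ 0 := by linarith
      field_simp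
      ring
  have hinj : InjOn (fun t : ℝ => t / (1 + t)) (Ioi 0) := by
    intro s hs t ht h
    have hs : 0 < s := hs
    have ht : 0 < t := ht
    simp only at h
    rw [div_eq_div_iff (by positivity) (by positivity)] at h
    linarith
  have hder : ∀ t ∈ Ioi (0 : ℝ), HasDerivWithinAt (fun t : ℝ => t / (1 + t))
      (1 / (1 + t) ^ 2) (Ioi 0) t := by
    intro t ht
    have ht : 0 < t := ht
    refine ((hasDerivAt_id t).div ((hasDerivAt_id t).const_add 1)
      (by simp; positivity)).hasDerivWithinAt.congr_deriv ?_
    simp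
  rw [← lintegral_Ioo_beta ha hb, ← himg,
    lintegral_image_eq_lintegral_abs_deriv_mul measurableSet_Ioi hder hinj]
  refine setLIntegral_congr_fun measurableSet_Ioi fun t ht => ?_
  have ht : 0 < t := ht
  have h1 : 0 < 1 + t := by positivity
  rw [← ENNReal.ofReal_mul (abs_nonneg _), abs_of_pos (by positivity)]
  congr 1
  rw [show 1 - t / (1 + t) = 1 / (1 + t) by field_simp; ring, Real.div_rpow ht.le h1.le,
    Real.div_rpow one_pos.le h1.le, Real.one_rpow]
  have e : (1 + t) ^ (-(a + b)) = ((1 + t) ^ (a - 1) * (1 + t) ^ (b - 1) * (1 + t) ^ 2)⁻¹ := by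
    rw [Real.rpow_neg h1.le, ← Real.rpow_natCast (1 + t) 2, ← Real.rpow_add h1,
      ← Real.rpow_add h1]
    congr 2
    push_cast
    ring
  rw [e]
  field_simp

/-- Substitute `t = v²` in the Beta integral over the half-line. Kernel integrals over circles and
over radii are compared with this form. -/
theorem lintegral_Ioi_rpow_mul_one_add_sq_rpow {a c : ℝ} (ha : 0 < a) (hc : a / 2 < c) :
    ∫⁻ v in Ioi (0 : ℝ), ENNReal.ofReal (v ^ (a - 1) * (1 + v ^ 2) ^ (-c))
      = ENNReal.ofReal (1 / 2 * ProbabilityTheory.beta (a / 2) (c - a / 2)) := by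
  have himg : (fun t : ℝ => t ^ 2) '' Ioi 0 = Ioi 0 := by
    ext x
    constructor
    · rintro ⟨t, ht, rfl⟩
      have ht : 0 < t := ht
      exact pow_pos ht 2
    · intro h0
      exact ⟨√x, Real.sqrt_pos.2 h0, Real.sq_sqrt (le_of_lt h0)⟩
  have hinj : InjOn (fun t : ℝ => t ^ 2) (Ioi 0) := by
    intro s hs t ht h
    exact (pow_left_inj₀ (le_of_lt hs) (le_of_lt ht) two_ne_zero).1 h
  have hder : ∀ t ∈ Ioi (0 : ℝ), HasDerivWithinAt (fun t : ℝ => t ^ 2) (2 * t) (Ioi 0) t := by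
    intro t _
    simpa using (hasDerivAt_pow 2 t).hasDerivWithinAt
  have h := lintegral_Ioi_beta (half_pos ha) (sub_pos.2 hc)
  rw [← himg, lintegral_image_eq_lintegral_abs_deriv_mul measurableSet_Ioi hder hinj] at h
  rw [ENNReal.ofReal_mul (by norm_num), ← h, ← lintegral_const_mul' _ _ ENNReal.ofReal_ne_top]
  refine setLIntegral_congr_fun measurableSet_Ioi fun v hv => ?_
  have hv : 0 < v := hv
  rw [← ENNReal.ofReal_mul (abs_nonneg _), abs_of_pos (by positivity),
    ← ENNReal.ofReal_mul (by norm_num)]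
  congr 1
  rw [← Real.rpow_natCast v 2, ← Real.rpow_mul hv.le]
  have e : v ^ (a - 1) = v * v ^ (((2 : ℕ) : ℝ) * (a / 2 - 1)) := by
    nth_rewrite 2 [← Real.rpow_one v]
    rw [← Real.rpow_add hv]
    congr 1
    push_cast
    ring
  rw [e]
  ring_nf

/-! ### The kernel on circles -/

theorem norm_polar (r θ : ℝ) : ‖polar r θ‖ = |r| := by
  rw [polar, norm_mul, Complex.norm_exp_ofReal_mul_I, mul_one, Complex.norm_real, Real.norm_eq_abs]

theorem norm_sq_one_sub_polar (r θ : ℝ) :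
    ‖1 - polar r θ‖ ^ 2 = 1 - 2 * r * Real.cos θ + r ^ 2 := by
  rw [polar, Complex.exp_mul_I, ← Complex.ofReal_cos, ← Complex.ofReal_sin, Complex.sq_norm,
    Complex.normSq_apply]
  simp
  rw [Complex.cos_ofReal_re, Complex.sin_ofReal_re]
  linear_combination r ^ 2 * Real.sin_sq_add_cos_sq θ

theorem pk_polar (α r θ : ℝ) : pk α (polar r θ) =
    cConst α * ((1 - r ^ 2) ^ (α + 1) * (1 - 2 * r * Real.cos θ + r ^ 2) ^ (-(α + 2) / 2)) := by
  rw [pk, norm_polar, norm_sq_one_sub_polar, sq_abs]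

theorem cConst_pos {α : ℝ} (hα : -1 < α) : 0 < cConst α :=
  div_pos (pow_pos (Real.Gamma_pos_of_pos (by linarith)) 2) (Real.Gamma_pos_of_pos (by linarith))

theorem one_sub_two_mul_cos_pos {r : ℝ} (hr : |r| < 1) (θ : ℝ) :
    0 < 1 - 2 * r * Real.cos θ + r ^ 2 := by
  have h1 := abs_lt.1 hr
  have : r ^ 2 < 1 := by nlinarith
  nlinarith [Real.sin_sq_add_cos_sq θ, sq_nonneg (r - Real.cos θ), sq_nonneg (1 - r * Real.cos θ),
    Real.cos_sq_le_one θ, sq_nonneg (r * Real.cos θ), sq_nonneg (Real.cos θ),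
    mul_nonneg (sq_nonneg r) (sub_nonneg.2 (Real.cos_sq_le_one θ))]

theorem pk_polar_pos {α : ℝ} (hα : -1 < α) {r : ℝ} (hr : |r| < 1) (θ : ℝ) :
    0 < pk α (polar r θ) := by
  rw [pk_polar]
  have h1 := abs_lt.1 hr
  have h2 : 0 < 1 - r ^ 2 := by nlinarith
  exact mul_pos (cConst_pos hα) (mul_pos (Real.rpow_pos_of_pos h2 _)
    (Real.rpow_pos_of_pos (one_sub_two_mul_cos_pos hr θ) _))

/-- With `t = (1+r)/(1-r)` and `v = t tan(θ/2)`, the kernel becomes a fixed density in `v` times a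
factor to the power `α/2`, which is trivial at `α = 0` and tends to `1` as `r → 1`. This is the
half-plane picture of the disk. -/
theorem lintegral_pk_polar_mul_eq (α : ℝ) {t : ℝ} (ht : 0 < t) (G : ℝ → ℝ≥0∞) :
    ∫⁻ θ in Ioo 0 π, ENNReal.ofReal (pk α (polar ((t - 1) / (t + 1)) θ)) * G θ =
      ∫⁻ v in Ioi 0, ENNReal.ofReal (cConst α * 2 ^ (α + 1) *
        (((t ^ 2 + v ^ 2) / (t + 1) ^ 2) ^ (α / 2) * (1 + v ^ 2) ^ (-(α + 2) / 2))) *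
        G (2 * arctan (v / t)) := by
  have himg : (fun v : ℝ => 2 * arctan (v / t)) '' Ioi 0 = Ioo 0 π := by
    ext θ
    constructor
    · rintro ⟨v, hv, rfl⟩
      have h1 := Real.arctan_lt_pi_div_two (v / t)
      have h2 := Real.arctan_pos.2 (div_pos hv ht)
      exact ⟨by positivity, by linarith⟩
    · rintro ⟨h0, h1⟩
      refine ⟨t * Real.tan (θ / 2),
        mul_pos ht (Real.tan_pos_of_pos_of_lt_pi_div_two (by linarith) (by linarith)), ?_⟩
      simp only
      rw [mul_div_cancel_left₀ _ ht.ne', Real.arctan_tan (by linarith) (by linarith)]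
      ring
  have hinj : InjOn (fun v : ℝ => 2 * arctan (v / t)) (Ioi 0) := by
    intro s _ v _ h
    have := Real.arctan_injective (mul_left_cancel₀ two_ne_zero h)
    rwa [div_left_inj' ht.ne'] at this
  have hder : ∀ v ∈ Ioi (0 : ℝ), HasDerivWithinAt (fun v : ℝ => 2 * arctan (v / t))
      (2 * t / (t ^ 2 + v ^ 2)) (Ioi 0) v := by
    intro v _
    refine ((((hasDerivAt_id v).div_const t).arctan).const_mul 2).hasDerivWithinAt.congr_deriv ?_
    simp
    field_simp
  rw [← himg, lintegral_image_eq_lintegral_abs_deriv_mul measurableSet_Ioi hder hinj]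
  refine setLIntegral_congr_fun measurableSet_Ioi fun v hv => ?_
  have hv : 0 < v := hv
  rw [← mul_assoc, ← ENNReal.ofReal_mul (abs_nonneg _), abs_of_pos (by positivity)]
  congr 2
  set A := 4 * t / (t + 1) ^ 2 with hA
  set X := (t ^ 2 + v ^ 2) / (t + 1) ^ 2 with hX
  set Y := 1 + v ^ 2 with hY
  have hA0 : 0 < A := by positivity
  have hX0 : 0 < X := by positivity
  have hY0 : 0 < Y := by positivity
  have e1 : 1 - ((t - 1) / (t + 1)) ^ 2 = A := by rw [hA]; field_simp; ring
  have e2 : 1 - 2 * ((t - 1) / (t + 1)) * Real.cos (2 * arctan (v / t)) +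
      ((t - 1) / (t + 1)) ^ 2 = (A / 2) ^ 2 * Y / X := by
    rw [Real.cos_two_mul, Real.cos_sq_arctan, hA, hX, hY]
    field_simp
    ring
  have e3 : ((A / 2) ^ 2 * Y / X) ^ (-(α + 2) / 2) =
      A ^ (-(α + 2)) * 2 ^ (α + 2) * Y ^ (-(α + 2) / 2) * (X ^ (α / 2) * X) := by
    rw [Real.div_rpow (by positivity) hX0.le, Real.mul_rpow (by positivity) hY0.le,
      ← Real.rpow_natCast (A / 2) 2, ← Real.rpow_mul (by positivity),
      Real.div_rpow hA0.le two_pos.le, ← Real.rpow_add_one hX0.ne',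
      show α / 2 + 1 = -(-(α + 2) / 2) by ring, Real.rpow_neg hX0.le,
      show ((2 : ℕ) : ℝ) * (-(α + 2) / 2) = -(α + 2) by push_cast; ring,
      Real.rpow_neg two_pos.le (α + 2)]
    field_simp
  have e4 : A ^ (α + 1) * A ^ (-(α + 2)) = A⁻¹ := by
    rw [← Real.rpow_add hA0, ← Real.rpow_neg_one]; ring_nf
  have e5 : (2 : ℝ) ^ (α + 2) = 2 * 2 ^ (α + 1) := by
    rw [show α + 2 = α + 1 + 1 by ring, Real.rpow_add_one two_ne_zero]; ring
  have e6 : 2 * t / (t ^ 2 + v ^ 2) * (A⁻¹ * X * 2) = 1 := by rw [hA, hX]; field_simp; norm_num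
  rw [pk_polar, e1, e2, e3, e5]
  calc 2 * t / (t ^ 2 + v ^ 2) * (cConst α * (A ^ (α + 1) * (A ^ (-(α + 2)) * (2 * 2 ^ (α + 1)) *
        Y ^ (-(α + 2) / 2) * (X ^ (α / 2) * X))))
      = (2 * t / (t ^ 2 + v ^ 2) * ((A ^ (α + 1) * A ^ (-(α + 2))) * X * 2)) *
        (cConst α * 2 ^ (α + 1) * (X ^ (α / 2) * Y ^ (-(α + 2) / 2))) := by ring
    _ = _ := by rw [e4, e6, one_mul]

/-! ### Normalisation of the kernel -/

/-- Legendre's duplication formula. The constant `c_α` is the one that gives the limiting density in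
`v` mass `π` on the half-line. -/
theorem cConst_mul_beta_half {α : ℝ} (hα : -1 < α) :
    cConst α * 2 ^ (α + 1) *
      (1 / 2 * ProbabilityTheory.beta (1 / 2) ((α + 2) / 2 - 1 / 2)) = π := by
  have h1 := Real.Gamma_mul_Gamma_add_half ((α + 1) / 2)
  rw [show (α + 1) / 2 + 1 / 2 = α / 2 + 1 by ring, show 2 * ((α + 1) / 2) = 1 + α by ring,
    show 1 - (1 + α) = -α by ring] at h1
  have g1 := Real.Gamma_pos_of_pos (show 0 < 1 + α by linarith)
  have g2 := Real.Gamma_pos_of_pos (show 0 < α / 2 + 1 by linarith)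
  have hp := Real.rpow_pos_of_pos two_pos α
  rw [ProbabilityTheory.beta, cConst, Real.Gamma_one_half_eq,
    show (α + 2) / 2 - 1 / 2 = (α + 1) / 2 by ring,
    show 1 / 2 + (α + 1) / 2 = α / 2 + 1 by ring, Real.rpow_add_one two_ne_zero]
  rw [Real.rpow_neg two_pos.le] at h1
  have h2 : Real.Gamma ((α + 1) / 2) * Real.Gamma (α / 2 + 1) * 2 ^ α
      = Real.Gamma (1 + α) * √π := by
    rw [h1]; field_simp
  have h3 : √π * √π = π := Real.mul_self_sqrt Real.pi_pos.le
  generalize Real.Gamma ((α + 1) / 2) = G1 at *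
  generalize Real.Gamma (α / 2 + 1) = G2 at *
  field_simp
  linear_combination √π * h2 + Real.Gamma (1 + α) * h3

/-- For `t ≥ 1`, that is `r ≥ 0`, the base is at least `1/4`, and the exponent `α/2` is not
positive. This bound is the dominating factor as `r → 1`. -/
theorem rpow_div_le_of_one_le {α : ℝ} (h0 : α ≤ 0) {t : ℝ} (ht : 1 ≤ t) (v : ℝ) :
    ((t ^ 2 + v ^ 2) / (t + 1) ^ 2) ^ (α / 2) ≤ (1 / 4) ^ (α / 2) := by
  refine Real.rpow_le_rpow_of_nonpos (by norm_num) ?_ (by linarith)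
  rw [div_le_div_iff₀ (by norm_num) (by positivity)]
  nlinarith [sq_nonneg v]

theorem lintegral_pk_polar_Ioo_le {α : ℝ} (hα : -1 < α) (h0 : α ≤ 0) {t : ℝ} (ht : 1 ≤ t) :
    ∫⁻ θ in Ioo 0 π, ENNReal.ofReal (pk α (polar ((t - 1) / (t + 1)) θ))
      ≤ ENNReal.ofReal ((1 / 4) ^ (α / 2) * π) := by
  have h := lintegral_pk_polar_mul_eq α (one_pos.trans_le ht) 1
  simp only [Pi.one_apply, mul_one] at h
  have hb := lintegral_Ioi_rpow_mul_one_add_sq_rpow (a := 1) (c := (α + 2) / 2) one_pos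
    (by linarith)
  have hc := cConst_pos hα
  rw [h, ← cConst_mul_beta_half hα, ← mul_assoc, ENNReal.ofReal_mul (by positivity), ← hb,
    ← lintegral_const_mul' _ _ ENNReal.ofReal_ne_top]
  refine lintegral_mono fun v => ?_
  rw [← ENNReal.ofReal_mul (by positivity)]
  refine ENNReal.ofReal_le_ofReal ?_
  rw [sub_self, Real.rpow_zero, one_mul, ← neg_div]
  calc _ ≤ cConst α * 2 ^ (α + 1) * ((1 / 4) ^ (α / 2) * (1 + v ^ 2) ^ (-(α + 2) / 2)) := by
        exact mul_le_mul_of_nonneg_left (mul_le_mul_of_nonneg_right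
          (rpow_div_le_of_one_le h0 ht v) (by positivity)) (by positivity)
    _ = _ := by ring

theorem tendsto_lintegral_pk_polar_Ioo {α : ℝ} (hα : -1 < α) (h0 : α ≤ 0) :
    Tendsto (fun t : ℝ => ∫⁻ θ in Ioo 0 π, ENNReal.ofReal (pk α (polar ((t - 1) / (t + 1)) θ)))
      atTop (𝓝 (ENNReal.ofReal π)) := by
  have hb := lintegral_Ioi_rpow_mul_one_add_sq_rpow (a := 1) (c := (α + 2) / 2) one_pos
    (by linarith)
  have hc := cConst_pos hα
  have e : ∀ᶠ t : ℝ in atTop,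
      ∫⁻ v in Ioi 0, ENNReal.ofReal (cConst α * 2 ^ (α + 1) *
        (((t ^ 2 + v ^ 2) / (t + 1) ^ 2) ^ (α / 2) * (1 + v ^ 2) ^ (-(α + 2) / 2))) =
      ∫⁻ θ in Ioo 0 π, ENNReal.ofReal (pk α (polar ((t - 1) / (t + 1)) θ)) := by
    filter_upwards [eventually_gt_atTop 0] with t ht
    have h := lintegral_pk_polar_mul_eq α ht 1
    simpa only [Pi.one_apply, mul_one] using h.symm
  refine Tendsto.congr' e ?_
  rw [← cConst_mul_beta_half hα, ENNReal.ofReal_mul (by positivity), ← hb,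
    ← lintegral_const_mul' _ _ ENNReal.ofReal_ne_top]
  refine tendsto_lintegral_filter_of_dominated_convergence
    (fun v => ENNReal.ofReal ((1 / 4) ^ (α / 2)) * (ENNReal.ofReal (cConst α * 2 ^ (α + 1)) *
      ENNReal.ofReal (v ^ ((1 : ℝ) - 1) * (1 + v ^ 2) ^ (-((α + 2) / 2))))) ?_ ?_ ?_ ?_
  · exact Eventually.of_forall fun t => by fun_prop
  · filter_upwards [eventually_ge_atTop 1] with t ht
    refine Eventually.of_forall fun v => ?_
    rw [← ENNReal.ofReal_mul (by positivity), ← ENNReal.ofReal_mul (by positivity)]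
    refine ENNReal.ofReal_le_ofReal ?_
    rw [sub_self, Real.rpow_zero, one_mul, ← neg_div]
    calc _ ≤ cConst α * 2 ^ (α + 1) * ((1 / 4) ^ (α / 2) * (1 + v ^ 2) ^ (-(α + 2) / 2)) := by
          exact mul_le_mul_of_nonneg_left (mul_le_mul_of_nonneg_right
            (rpow_div_le_of_one_le h0 ht v) (by positivity)) (by positivity)
      _ = _ := by ring
  · rw [lintegral_const_mul' _ _ ENNReal.ofReal_ne_top,
      lintegral_const_mul' _ _ ENNReal.ofReal_ne_top, hb]
    exact ENNReal.mul_ne_top ENNReal.ofReal_ne_top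
      (ENNReal.mul_ne_top ENNReal.ofReal_ne_top ENNReal.ofReal_ne_top)
  · refine Eventually.of_forall fun v => ?_
    rw [← ENNReal.ofReal_mul (by positivity), sub_self, Real.rpow_zero, ← neg_div]
    refine (ENNReal.continuous_ofReal.tendsto _).comp ?_
    refine Tendsto.const_mul _ (Tendsto.mul_const _ ?_)
    have h1 : Tendsto (fun t : ℝ => (t ^ 2 + v ^ 2) / (t + 1) ^ 2) atTop (𝓝 1) := by
      have h2 : Tendsto (fun t : ℝ => t⁻¹) atTop (𝓝 0) := tendsto_inv_atTop_zero
      have h3 : Tendsto (fun t : ℝ => (1 + v ^ 2 * t⁻¹ ^ 2) / (1 + t⁻¹) ^ 2) atTop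
          (𝓝 ((1 + v ^ 2 * 0 ^ 2) / (1 + 0) ^ 2)) :=
        ((h2.pow 2).const_mul _ |>.const_add 1).div ((h2.const_add 1).pow 2) (by norm_num)
      have h4 : ((1 : ℝ) + v ^ 2 * 0 ^ 2) / (1 + 0) ^ 2 = 1 := by norm_num
      rw [h4] at h3
      refine h3.congr' ?_
      filter_upwards [eventually_gt_atTop 0] with t ht
      field_simp
    have := h1.rpow_const (p := α / 2) (Or.inl one_ne_zero)
    rwa [Real.one_rpow] at this

theorem continuous_pk_polar {α r : ℝ} (hr : |r| < 1) : Continuous fun θ => pk α (polar r θ) := by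
  simp only [pk_polar]
  refine continuous_const.mul (continuous_const.mul (Continuous.rpow_const (by fun_prop)
    fun θ => Or.inl (one_sub_two_mul_cos_pos hr θ).ne'))

theorem lintegral_pk_polar_Ioo_eq {α : ℝ} (hα : -1 < α) {r : ℝ} (hr : |r| < 1) :
    ∫⁻ θ in Ioo 0 π, ENNReal.ofReal (pk α (polar r θ))
      = ENNReal.ofReal (∫ θ in (0 : ℝ)..π, pk α (polar r θ)) := by
  rw [intervalIntegral.integral_of_le Real.pi_pos.le, integral_Ioc_eq_integral_Ioo,
    ofReal_integral_eq_lintegral_ofReal]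
  · exact ((continuous_pk_polar hr).integrableOn_Icc (a := 0) (b := π)).mono_set
      Ioo_subset_Icc_self
  · exact Eventually.of_forall fun θ => (pk_polar_pos hα hr θ).le

theorem radius_substitution {r : ℝ} (hr : r < 1) :
    ((1 + r) / (1 - r) - 1) / ((1 + r) / (1 - r) + 1) = r := by
  have : 1 - r ≠ 0 := by linarith
  field_simp
  ring

theorem integral_pk_polar_le {α : ℝ} (hα : -1 < α) (h0 : α ≤ 0) {r : ℝ} (hr : r ∈ Ico (0 : ℝ) 1) :
    ∫ θ in (0 : ℝ)..π, pk α (polar r θ) ≤ (1 / 4) ^ (α / 2) * π := by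
  have hr' : |r| < 1 := by rw [abs_of_nonneg hr.1]; exact hr.2
  have h := lintegral_pk_polar_Ioo_le hα h0 (t := (1 + r) / (1 - r))
    (by rw [le_div_iff₀ (by linarith [hr.2])]; linarith [hr.1])
  rw [radius_substitution hr.2, lintegral_pk_polar_Ioo_eq hα hr',
    ENNReal.ofReal_le_ofReal_iff (by positivity)] at h
  exact h

theorem tendsto_one_add_div_one_sub : Tendsto (fun r : ℝ => (1 + r) / (1 - r)) (𝓝[<] 1) atTop := by
  have h1 : Tendsto (fun r : ℝ => 1 + r) (𝓝[<] 1) (𝓝 (1 + 1)) :=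
    (Continuous.tendsto (by fun_prop) 1).mono_left nhdsWithin_le_nhds
  have h2 : Tendsto (fun r : ℝ => 1 - r) (𝓝[<] 1) (𝓝[>] 0) := by
    refine tendsto_nhdsWithin_iff.2 ⟨?_, ?_⟩
    · have : Tendsto (fun r : ℝ => 1 - r) (𝓝[<] 1) (𝓝 (1 - 1)) :=
        (Continuous.tendsto (by fun_prop) 1).mono_left nhdsWithin_le_nhds
      simpa using this
    · filter_upwards [self_mem_nhdsWithin] with r hr
      have : r < 1 := hr
      exact sub_pos.2 this
  simpa only [div_eq_mul_inv, Function.comp] using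
    h1.pos_mul_atTop (by norm_num) (tendsto_inv_nhdsGT_zero.comp h2)

theorem tendsto_integral_pk_polar {α : ℝ} (hα : -1 < α) (h0 : α ≤ 0) :
    Tendsto (fun r : ℝ => ∫ θ in (0 : ℝ)..π, pk α (polar r θ)) (𝓝[<] 1) (𝓝 π) := by
  have h := (tendsto_lintegral_pk_polar_Ioo hα h0).comp tendsto_one_add_div_one_sub
  have h2 := (ENNReal.tendsto_toReal ENNReal.ofReal_ne_top).comp h
  rw [ENNReal.toReal_ofReal Real.pi_pos.le] at h2
  refine h2.congr' ?_
  filter_upwards [Ioo_mem_nhdsLT (show (0 : ℝ) < 1 by norm_num)] with r hr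
  have hr' : |r| < 1 := by rw [abs_of_nonneg hr.1.le]; exact hr.2
  simp only [Function.comp]
  rw [radius_substitution hr.2, lintegral_pk_polar_Ioo_eq hα hr', ENNReal.toReal_ofReal]
  exact intervalIntegral.integral_nonneg Real.pi_pos.le fun θ _ => (pk_polar_pos hα hr' θ).le

/-! ### Approximate identities made of decreasing kernels -/

/-- Integration by parts moves the estimate from `g` to its primitive. Monotonicity of `k` is what
makes control of the primitive enough, so no maximal function and no Lebesgue points of `|g|` are
needed. -/
theorem abs_integral_mul_le_of_antitone {k k' g : ℝ → ℝ} {b η ε M : ℝ} (hη : 0 < η) (hηb : η ≤ b)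
    (hk : ∀ x, HasDerivAt k (k' x) x) (hk' : Continuous k') (hneg : ∀ x ∈ Icc 0 b, k' x ≤ 0)
    (hpos : ∀ x ∈ Icc 0 b, 0 ≤ k x) (hg : IntervalIntegrable g volume 0 b)
    (hε : 0 ≤ ε) (hΦ : ∀ x ∈ Icc 0 η, |∫ y in (0 : ℝ)..x, g y| ≤ ε * x)
    (hM : ∀ x ∈ Icc 0 b, |∫ y in (0 : ℝ)..x, g y| ≤ M) :
    |∫ x in (0 : ℝ)..b, k x * g x| ≤ M * k b + ε * (∫ x in (0 : ℝ)..b, k x) + M * k η := by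
  have hb : 0 < b := hη.trans_le hηb
  have hM0 : 0 ≤ M := (abs_nonneg _).trans (hM 0 ⟨le_rfl, hb.le⟩)
  set Φ : ℝ → ℝ := fun x => ∫ y in (0 : ℝ)..x, g y with hΦdef
  have hkc : Continuous k := continuous_iff_continuousAt.2 fun x => (hk x).continuousAt
  have hderiv : deriv k = k' := funext fun x => (hk x).deriv
  have hkAC : AbsolutelyContinuousOnInterval k 0 b := by
    refine ContDiffOn.absolutelyContinuousOnInterval (ContDiff.contDiffOn ?_)
    rw [contDiff_one_iff_deriv, hderiv]
    exact ⟨fun x => (hk x).differentiableAt, hk'⟩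
  have hΦAC : AbsolutelyContinuousOnInterval Φ 0 b :=
    hg.absolutelyContinuousOnInterval_intervalIntegral (by simp)
  have hΦc : ContinuousOn Φ (Icc 0 b) := by
    have := hΦAC.continuousOn
    rwa [uIcc_of_le hb.le] at this
  have ibp := hkAC.integral_mul_deriv_eq_deriv_mul hΦAC
  have e1 : ∫ x in (0 : ℝ)..b, k x * g x = ∫ x in (0 : ℝ)..b, k x * deriv Φ x := by
    refine intervalIntegral.integral_congr_ae ?_
    filter_upwards [hg.ae_hasDerivAt_integral] with x hx hxm
    rw [(hx (uIoc_subset_uIcc hxm) 0 (by simp)).deriv]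
  have hΦ0 : Φ 0 = 0 := by simp [hΦdef]
  have e2 : ∫ x in (0 : ℝ)..b, k x * g x = k b * Φ b - ∫ x in (0 : ℝ)..b, k' x * Φ x := by
    rw [e1, ibp, hderiv, hΦ0]; ring
  have ii : ∀ c d, c ∈ Icc 0 b → d ∈ Icc 0 b → c ≤ d →
      IntervalIntegrable (fun x => k' x * Φ x) volume c d := fun c d hc hd hcd =>
    (hk'.continuousOn.mul (hΦc.mono (by
      rw [uIcc_of_le hcd]; exact Icc_subset_Icc hc.1 hd.2))).intervalIntegrable
  have m0 : (0 : ℝ) ∈ Icc 0 b := ⟨le_rfl, hb.le⟩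
  have mη : η ∈ Icc 0 b := ⟨hη.le, hηb⟩
  have mb : b ∈ Icc 0 b := ⟨hb.le, le_rfl⟩
  have e3 : ∫ x in (0 : ℝ)..b, k' x * Φ x
      = (∫ x in (0 : ℝ)..η, k' x * Φ x) + ∫ x in η..b, k' x * Φ x :=
    (intervalIntegral.integral_add_adjacent_intervals (ii _ _ m0 mη hη.le)
      (ii _ _ mη mb hηb)).symm
  -- Near zero the primitive is at most `ε x`, and a second integration by parts turns `∫ -x k'`
  -- into at most `∫ k`.
  have b1 : |∫ x in (0 : ℝ)..η, k' x * Φ x| ≤ ε * ∫ x in (0 : ℝ)..b, k x := by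
    have h1 : |∫ x in (0 : ℝ)..η, k' x * Φ x| ≤ ∫ x in (0 : ℝ)..η, ε * (-(x * k' x)) := by
      rw [← Real.norm_eq_abs]
      refine intervalIntegral.norm_integral_le_of_norm_le hη.le ?_
        (by apply Continuous.intervalIntegrable; fun_prop)
      refine Eventually.of_forall fun x hx => ?_
      have hx' : x ∈ Icc 0 b := ⟨hx.1.le, hx.2.trans hηb⟩
      rw [norm_mul, Real.norm_eq_abs, Real.norm_eq_abs, abs_of_nonpos (hneg x hx')]
      have := mul_le_mul_of_nonneg_left (hΦ x ⟨hx.1.le, hx.2⟩) (neg_nonneg.2 (hneg x hx'))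
      linarith
    have h2 : ∫ x in (0 : ℝ)..η, x * k' x = η * k η - ∫ x in (0 : ℝ)..η, k x := by
      have := intervalIntegral.integral_mul_deriv_eq_deriv_mul (a := 0) (b := η)
        (u := fun x => x) (u' := fun _ => 1) (v := k) (v' := k')
        (fun x _ => hasDerivAt_id x) (fun x _ => hk x) (by simp) (hk'.intervalIntegrable _ _)
      simpa using this
    have h3 : ∫ x in (0 : ℝ)..η, k x ≤ ∫ x in (0 : ℝ)..b, k x := by
      rw [← intervalIntegral.integral_add_adjacent_intervals (hkc.intervalIntegrable 0 η)
        (hkc.intervalIntegrable η b)]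
      have := intervalIntegral.integral_nonneg hηb (μ := volume) (f := k)
        fun x hx => hpos x ⟨hη.le.trans hx.1, hx.2⟩
      linarith
    rw [intervalIntegral.integral_const_mul, intervalIntegral.integral_neg, h2] at h1
    refine h1.trans (mul_le_mul_of_nonneg_left ?_ hε)
    have := mul_nonneg hη.le (hpos η mη)
    linarith
  -- Away from zero only the total variation of `k` matters, and it is small once `k η` is.
  have b2 : |∫ x in η..b, k' x * Φ x| ≤ M * (k η - k b) := by
    have h1 : |∫ x in η..b, k' x * Φ x| ≤ ∫ x in η..b, M * (-k' x) := by
      rw [← Real.norm_eq_abs]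
      refine intervalIntegral.norm_integral_le_of_norm_le hηb ?_
        (by apply Continuous.intervalIntegrable; fun_prop)
      refine Eventually.of_forall fun x hx => ?_
      have hx' : x ∈ Icc 0 b := ⟨hη.le.trans hx.1.le, hx.2⟩
      rw [norm_mul, Real.norm_eq_abs, Real.norm_eq_abs, abs_of_nonpos (hneg x hx')]
      have := mul_le_mul_of_nonneg_left (hM x hx') (neg_nonneg.2 (hneg x hx'))
      linarith
    rw [intervalIntegral.integral_const_mul, intervalIntegral.integral_neg,
      intervalIntegral.integral_eq_sub_of_hasDerivAt (fun x _ => hk x)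
        (hk'.intervalIntegrable _ _)] at h1
    linarith
  have b3 : |k b * Φ b| ≤ M * k b := by
    rw [abs_mul, abs_of_nonneg (hpos b mb), mul_comm]
    exact mul_le_mul_of_nonneg_right (hM b mb) (hpos b mb)
  rw [e2, e3]
  have := mul_nonneg hM0 (hpos b mb)
  calc _ ≤ |k b * Φ b| + |(∫ x in (0 : ℝ)..η, k' x * Φ x) + ∫ x in η..b, k' x * Φ x| := abs_sub _ _
    _ ≤ |k b * Φ b| + (|∫ x in (0 : ℝ)..η, k' x * Φ x| + |∫ x in η..b, k' x * Φ x|) := by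
        gcongr; exact abs_add_le _ _
    _ ≤ _ := by linarith

/-- Apply the preceding estimate to `g - c`, whose primitive is `o(x)` at zero; the constant `c`
contributes `A c`. -/
theorem tendsto_integral_mul_of_antitone {ι : Type*} {l : Filter ι} {k k' : ι → ℝ → ℝ} {g : ℝ → ℝ}
    {b A c : ℝ} (hb : 0 < b)
    (hk : ∀ᶠ i in l, (∀ x, HasDerivAt (k i) (k' i x) x) ∧ Continuous (k' i) ∧
      (∀ x ∈ Icc 0 b, k' i x ≤ 0) ∧ ∀ x ∈ Icc 0 b, 0 ≤ k i x)
    (hA : Tendsto (fun i => ∫ x in (0 : ℝ)..b, k i x) l (𝓝 A))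
    (hzero : ∀ x ∈ Ioc 0 b, Tendsto (fun i => k i x) l (𝓝 0))
    (hg : IntervalIntegrable g volume 0 b)
    (hc : Tendsto (fun x => (∫ y in (0 : ℝ)..x, g y) / x) (𝓝[>] 0) (𝓝 c)) :
    Tendsto (fun i => ∫ x in (0 : ℝ)..b, k i x * g x) l (𝓝 (A * c)) := by
  have hg1 : IntervalIntegrable (fun x => g x - c) volume 0 b :=
    hg.sub intervalIntegrable_const
  have hΦ : ∀ x ∈ Icc 0 b, ∫ y in (0 : ℝ)..x, (g y - c) = (∫ y in (0 : ℝ)..x, g y) - c * x := by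
    intro x hx
    rw [intervalIntegral.integral_sub (hg.mono_set ?_) intervalIntegrable_const]
    · simp [mul_comm]
    · rw [uIcc_of_le hx.1, uIcc_of_le hb.le]
      exact Icc_subset_Icc le_rfl hx.2
  obtain ⟨M, hM⟩ : ∃ M, ∀ x ∈ Icc 0 b, |∫ y in (0 : ℝ)..x, (g y - c)| ≤ M := by
    have h1 : ContinuousOn (fun x => ∫ y in (0 : ℝ)..x, (g y - c)) (Icc 0 b) := by
      have := (hg1.absolutelyContinuousOnInterval_intervalIntegral (c := 0)
        (by simp)).continuousOn
      rwa [uIcc_of_le hb.le] at this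
    obtain ⟨M, hM⟩ := isCompact_Icc.exists_bound_of_continuousOn h1
    exact ⟨M, fun x hx => hM x hx⟩
  have hM0 : 0 ≤ M := (abs_nonneg _).trans (hM 0 ⟨le_rfl, hb.le⟩)
  have main : Tendsto (fun i => ∫ x in (0 : ℝ)..b, k i x * (g x - c)) l (𝓝 0) := by
    rw [Metric.tendsto_nhds]
    intro δ hδ
    -- Chosen so that `ε |A| < δ`; the added `1` covers `A = 0`.
    set ε := δ / (2 * (|A| + 1)) with hε
    have hεpos : 0 < ε := by positivity
    have hsmall : ∀ᶠ x in 𝓝[>] (0 : ℝ), |(∫ y in (0 : ℝ)..x, g y) / x - c| ≤ ε := by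
      have := Metric.tendsto_nhds.1 hc ε hεpos
      filter_upwards [this] with x hx
      rw [Real.dist_eq] at hx
      exact hx.le
    obtain ⟨η₀, hη₀, hη₀s⟩ := mem_nhdsGT_iff_exists_Ioc_subset.1 hsmall
    have hη₀ : 0 < η₀ := hη₀
    set η := min η₀ b with hηdef
    have hη : 0 < η := lt_min hη₀ hb
    have hηb : η ≤ b := min_le_right _ _
    have hΦε : ∀ x ∈ Icc 0 η, |∫ y in (0 : ℝ)..x, (g y - c)| ≤ ε * x := by
      intro x hx
      rcases hx.1.eq_or_lt with h | h
      · simp [← h]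
      · have h2 : |(∫ y in (0 : ℝ)..x, g y) / x - c| ≤ ε := hη₀s ⟨h, hx.2.trans (min_le_left _ _)⟩
        rw [hΦ x ⟨hx.1, hx.2.trans hηb⟩]
        have h3 : (∫ y in (0 : ℝ)..x, g y) - c * x = ((∫ y in (0 : ℝ)..x, g y) / x - c) * x := by
          field_simp
        rw [h3, abs_mul, abs_of_pos h]
        exact mul_le_mul_of_nonneg_right h2 h.le
    have hlim : Tendsto (fun i => M * k i b + ε * (∫ x in (0 : ℝ)..b, k i x) + M * k i η) l
        (𝓝 (M * 0 + ε * A + M * 0)) :=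
      (((hzero b ⟨hb, le_rfl⟩).const_mul M).add (hA.const_mul ε)).add
        ((hzero η ⟨hη, hηb⟩).const_mul M)
    have hlt : M * 0 + ε * A + M * 0 < δ := by
      have h1 : ε * A ≤ ε * |A| := mul_le_mul_of_nonneg_left (le_abs_self A) hεpos.le
      have h2 : ε * |A| < δ := by
        rw [hε, div_mul_eq_mul_div, div_lt_iff₀ (by positivity)]
        nlinarith [abs_nonneg A]
      linarith
    filter_upwards [hk, hlim.eventually (gt_mem_nhds hlt)] with i hi hi2
    rw [Real.dist_eq, sub_zero]
    exact (abs_integral_mul_le_of_antitone hη hηb hi.1 hi.2.1 hi.2.2.1 hi.2.2.2 hg1 hεpos.le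
      hΦε hM).trans_lt hi2
  have h2 := main.add (hA.mul_const c)
  rw [zero_add] at h2
  refine h2.congr' ?_
  filter_upwards [hk] with i hi
  have hkc : Continuous (k i) := continuous_iff_continuousAt.2 fun x => (hi.1 x).continuousAt
  rw [← intervalIntegral.integral_mul_const, ← intervalIntegral.integral_add]
  · refine intervalIntegral.integral_congr fun x _ => ?_
    ring
  · exact hg1.continuousOn_mul hkc.continuousOn
  · exact (hkc.mul continuous_const).intervalIntegrable _ _

/-! ### Poisson integrals and their radial limits -/

/-- The Poisson integral `(1/2π) ∫_0^{2π} P_α(z e^{-it}) f(t) dt`. -/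
noncomputable def pInt (α : ℝ) (f : ℝ → ℂ) : ℂ → ℂ :=
  rotAvg (fun z => (pk α z : ℂ)) (fun t => (2 * π : ℂ)⁻¹ * f t)

theorem pInt_polar (α : ℝ) (f : ℝ → ℂ) (r θ : ℝ) :
    pInt α f (polar r θ)
      = (2 * π : ℂ)⁻¹ * ∫ t in (0 : ℝ)..(2 * π), (pk α (polar r (θ - t)) : ℂ) * f t := by
  rw [pInt, rotAvg, ← intervalIntegral.integral_const_mul]
  refine intervalIntegral.integral_congr fun t _ => ?_
  simp only [rot_polar]
  ring

theorem isAlphaHarmonic_pInt (α : ℝ) {f : ℝ → ℂ} (hf : IntervalIntegrable f volume 0 (2 * π)) :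
    IsAlphaHarmonic α (pInt α f) :=
  (isAlphaHarmonic_pk α).rotAvg (hf.const_mul _)

theorem pk_polar_periodic (α r : ℝ) : Function.Periodic (fun θ => pk α (polar r θ)) (2 * π) := by
  intro θ
  simp only [pk_polar, Real.cos_add_two_pi]

theorem pk_polar_neg (α r θ : ℝ) : pk α (polar r (-θ)) = pk α (polar r θ) := by
  simp only [pk_polar, Real.cos_neg]

theorem hasDerivAt_pk_polar {α r : ℝ} (hr : |r| < 1) (x : ℝ) :
    HasDerivAt (fun θ => pk α (polar r θ)) (cConst α * ((1 - r ^ 2) ^ (α + 1) *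
      (2 * r * Real.sin x * (-(α + 2) / 2) *
        (1 - 2 * r * Real.cos x + r ^ 2) ^ (-(α + 2) / 2 - 1)))) x := by
  simp only [pk_polar]
  have h : HasDerivAt (fun x => 1 - 2 * r * Real.cos x + r ^ 2) (2 * r * Real.sin x) x := by
    refine ((((Real.hasDerivAt_cos x).const_mul (2 * r)).const_sub 1).add_const
      (r ^ 2)).congr_deriv ?_
    ring
  exact ((h.rpow_const (Or.inl (one_sub_two_mul_cos_pos hr x).ne')).const_mul _).const_mul _

theorem tendsto_pk_polar_zero {α : ℝ} (hα : -1 < α) {x : ℝ} (hx : x ∈ Ioc 0 π) :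
    Tendsto (fun r : ℝ => pk α (polar r x)) (𝓝[<] 1) (𝓝 0) := by
  simp only [pk_polar]
  have h1 : Tendsto (fun r : ℝ => (1 - r ^ 2) ^ (α + 1)) (𝓝 1) (𝓝 0) := by
    have h : Tendsto (fun r : ℝ => 1 - r ^ 2) (𝓝 1) (𝓝 (1 - 1 ^ 2)) :=
      Continuous.tendsto (by fun_prop) 1
    have := h.rpow_const (p := α + 1) (Or.inr (by linarith))
    simpa [Real.zero_rpow (show α + 1 ≠ 0 by linarith)] using this
  have h2 : Tendsto (fun r : ℝ => (1 - 2 * r * Real.cos x + r ^ 2) ^ (-(α + 2) / 2)) (𝓝 1)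
      (𝓝 ((1 - 2 * 1 * Real.cos x + 1 ^ 2) ^ (-(α + 2) / 2))) := by
    have h : Tendsto (fun r : ℝ => 1 - 2 * r * Real.cos x + r ^ 2) (𝓝 1)
        (𝓝 (1 - 2 * 1 * Real.cos x + 1 ^ 2)) := Continuous.tendsto (by fun_prop) 1
    refine h.rpow_const (Or.inl ?_)
    have : Real.cos x < Real.cos 0 :=
      Real.cos_lt_cos_of_nonneg_of_le_pi le_rfl hx.2 hx.1
    rw [Real.cos_zero] at this
    linarith
  have := ((h1.mul h2).const_mul (cConst α)).mono_left (nhdsWithin_le_nhds (s := Iio 1))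
  simpa using this

theorem locallyIntegrable_of_periodic {E : Type*} [NormedAddCommGroup E] {g : ℝ → E}
    (hp : Function.Periodic g (2 * π)) (hg : IntervalIntegrable g volume 0 (2 * π)) :
    LocallyIntegrable g := by
  intro x
  have h := hp.intervalIntegrable₀ Real.two_pi_pos.ne' hg (x - 1) (x + 1)
  rw [intervalIntegrable_iff_integrableOn_Ioo_of_le (by linarith)] at h
  exact ⟨Ioo (x - 1) (x + 1), Ioo_mem_nhds (by linarith) (by linarith), h⟩

/-- Splitting the period at `θ` puts the peak of the kernel at the endpoint `0` of two integrals
over `[0, π]`, where it is monotone. -/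
theorem integral_kernel_fold {k g : ℝ → ℝ} (hkc : Continuous k)
    (hkp : Function.Periodic k (2 * π)) (hke : ∀ x, k (-x) = k x)
    (hp : Function.Periodic g (2 * π)) (hg : IntervalIntegrable g volume 0 (2 * π)) (θ : ℝ) :
    ∫ t in (0 : ℝ)..(2 * π), k (θ - t) * g t
      = (∫ x in (0 : ℝ)..π, k x * g (θ + x)) + ∫ x in (0 : ℝ)..π, k x * g (θ - x) := by
  have gi : ∀ a b, IntervalIntegrable g volume a b := fun a b =>
    hp.intervalIntegrable₀ Real.two_pi_pos.ne' hg a b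
  have hper : Function.Periodic (fun t => k (θ - t) * g t) (2 * π) := by
    intro t
    have : k (θ - (t + 2 * π)) = k (θ - t) := by
      rw [← hkp (θ - (t + 2 * π))]; congr 1; ring
    simp only [this, hp t]
  have ii : ∀ a b, IntervalIntegrable (fun t => k (θ - t) * g t) volume a b := fun a b =>
    (gi a b).continuousOn_mul (by fun_prop)
  have e1 : ∫ t in (0 : ℝ)..(2 * π), k (θ - t) * g t
      = ∫ t in (θ - π)..(θ + π), k (θ - t) * g t := by
    have := hper.intervalIntegral_add_eq 0 (θ - π)
    rw [zero_add, show θ - π + 2 * π = θ + π by ring] at this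
    exact this
  rw [e1, ← intervalIntegral.integral_add_adjacent_intervals (ii (θ - π) θ) (ii θ (θ + π)),
    add_comm]
  congr 1
  · have := intervalIntegral.integral_comp_add_left (a := 0) (b := π)
      (fun t => k (θ - t) * g t) θ
    rw [add_zero] at this
    rw [← this]
    refine intervalIntegral.integral_congr fun x _ => ?_
    simp [hke]
  · have := intervalIntegral.integral_comp_sub_left (a := 0) (b := π)
      (fun t => k (θ - t) * g t) θ
    rw [sub_zero] at this
    rw [← this]
    refine intervalIntegral.integral_congr fun x _ => ?_
    simp

/-- After folding, the one-sided derivatives of the primitive at `θ` are the limits required on the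
two half-periods, each of which receives kernel mass `π` in the limit. -/
theorem tendsto_poisson_of_hasDerivAt {α : ℝ} (hα : -1 < α) (h0 : α ≤ 0) {g : ℝ → ℝ}
    (hp : Function.Periodic g (2 * π)) (hg : IntervalIntegrable g volume 0 (2 * π)) {θ : ℝ}
    (hθ : HasDerivAt (fun x => ∫ t in (0 : ℝ)..x, g t) (g θ) θ) :
    Tendsto (fun r : ℝ => ∫ t in (0 : ℝ)..(2 * π), pk α (polar r (θ - t)) * g t) (𝓝[<] 1)
      (𝓝 (2 * π * g θ)) := by
  have gi : ∀ a b, IntervalIntegrable g volume a b := fun a b =>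
    hp.intervalIntegrable₀ Real.two_pi_pos.ne' hg a b
  have hev : ∀ᶠ r : ℝ in 𝓝[<] 1, r ∈ Ioo (0 : ℝ) 1 := Ioo_mem_nhdsLT (by norm_num)
  have hker : ∀ᶠ r : ℝ in 𝓝[<] 1, (∀ x, HasDerivAt (fun θ => pk α (polar r θ))
      (cConst α * ((1 - r ^ 2) ^ (α + 1) * (2 * r * Real.sin x * (-(α + 2) / 2) *
        (1 - 2 * r * Real.cos x + r ^ 2) ^ (-(α + 2) / 2 - 1)))) x) ∧
      Continuous (fun x => cConst α * ((1 - r ^ 2) ^ (α + 1) *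
        (2 * r * Real.sin x * (-(α + 2) / 2) *
          (1 - 2 * r * Real.cos x + r ^ 2) ^ (-(α + 2) / 2 - 1)))) ∧
      (∀ x ∈ Icc 0 π, cConst α * ((1 - r ^ 2) ^ (α + 1) *
        (2 * r * Real.sin x * (-(α + 2) / 2) *
          (1 - 2 * r * Real.cos x + r ^ 2) ^ (-(α + 2) / 2 - 1))) ≤ 0) ∧
      ∀ x ∈ Icc 0 π, 0 ≤ pk α (polar r x) := by
    filter_upwards [hev] with r hr
    have hr' : |r| < 1 := by rw [abs_of_pos hr.1]; exact hr.2
    refine ⟨hasDerivAt_pk_polar hr', ?_, fun x hx => ?_, fun x _ => (pk_polar_pos hα hr' x).le⟩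
    · refine continuous_const.mul (continuous_const.mul (Continuous.mul (by fun_prop) ?_))
      exact Continuous.rpow_const (by fun_prop)
        fun x => Or.inl (one_sub_two_mul_cos_pos hr' x).ne'
    · have h1 : 0 < 1 - r ^ 2 := by nlinarith [hr.1, hr.2]
      have h2 := Real.sin_nonneg_of_nonneg_of_le_pi hx.1 hx.2
      have h3 := Real.rpow_nonneg (one_sub_two_mul_cos_pos hr' x).le (-(α + 2) / 2 - 1)
      have h4 := Real.rpow_nonneg h1.le (α + 1)
      have h5 := cConst_pos hα
      have h6 := hr.1
      have h7 : 0 ≤ cConst α * ((1 - r ^ 2) ^ (α + 1) * (2 * r * Real.sin x * ((α + 2) / 2) *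
          (1 - 2 * r * Real.cos x + r ^ 2) ^ (-(α + 2) / 2 - 1))) := by
        have : 0 < (α + 2) / 2 := by linarith
        positivity
      linarith
  have hA := tendsto_integral_pk_polar hα h0
  have hz := fun x hx => tendsto_pk_polar_zero hα (x := x) hx
  have l1 := tendsto_integral_mul_of_antitone (g := fun x => g (θ + x)) (c := g θ) Real.pi_pos hker
    hA hz (by simpa using (gi (θ + 0) (θ + π)).comp_add_left (c := θ)) ?_
  · have l2 := tendsto_integral_mul_of_antitone (g := fun x => g (θ - x)) (c := g θ) Real.pi_pos
      hker hA hz (by simpa using (gi (θ - 0) (θ - π)).comp_sub_left (c := θ)) ?_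
    · have h3 := l1.add l2
      rw [show π * g θ + π * g θ = 2 * π * g θ by ring] at h3
      refine h3.congr' ?_
      filter_upwards [hev] with r hr
      have hr' : |r| < 1 := by rw [abs_of_pos hr.1]; exact hr.2
      exact (integral_kernel_fold (continuous_pk_polar hr') (pk_polar_periodic α r)
        (pk_polar_neg α r) hp hg θ).symm
    · have h4 := hθ.tendsto_slope_zero_left
      have h5 : Tendsto (fun x : ℝ => -x) (𝓝[>] 0) (𝓝[<] 0) := by
        simpa using tendsto_neg_nhdsGT (a := (0 : ℝ))
      refine (h4.comp h5).congr fun x => ?_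
      simp only [Function.comp, smul_eq_mul]
      rw [intervalIntegral.integral_comp_sub_left, sub_zero,
        intervalIntegral.integral_interval_sub_left (gi _ _) (gi _ _),
        ← sub_eq_add_neg, intervalIntegral.integral_symm (θ - x) θ, inv_neg]
      ring
  · refine hθ.tendsto_slope_zero_right.congr fun x => ?_
    rw [intervalIntegral.integral_comp_add_left, add_zero,
      intervalIntegral.integral_interval_sub_left (gi _ _) (gi _ _), smul_eq_mul]
    ring

/-- **Fatou's theorem**: a Poisson integral has its density as radial limit almost everywhere. -/
theorem ae_tendsto_pInt {α : ℝ} (hα : -1 < α) (h0 : α ≤ 0) {f : ℝ → ℂ}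
    (hp : Function.Periodic f (2 * π)) (hf : IntervalIntegrable f volume 0 (2 * π)) :
    ∀ᵐ θ : ℝ, Tendsto (fun r : ℝ => pInt α f (polar r θ)) (𝓝[<] 1) (𝓝 (f θ)) := by
  have hre : IntervalIntegrable (fun t => (f t).re) volume 0 (2 * π) := ⟨hf.1.re, hf.2.re⟩
  have him : IntervalIntegrable (fun t => (f t).im) volume 0 (2 * π) := ⟨hf.1.im, hf.2.im⟩
  have pre : Function.Periodic (fun t => (f t).re) (2 * π) := fun t => by simp only [hp t]
  have pim : Function.Periodic (fun t => (f t).im) (2 * π) := fun t => by simp only [hp t]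
  filter_upwards [LocallyIntegrable.ae_hasDerivAt_integral (locallyIntegrable_of_periodic pre hre),
    LocallyIntegrable.ae_hasDerivAt_integral (locallyIntegrable_of_periodic pim him)] with θ h1 h2
  have t1 := tendsto_poisson_of_hasDerivAt hα h0 pre hre (h1 0)
  have t2 := tendsto_poisson_of_hasDerivAt hα h0 pim him (h2 0)
  have c1 := (Complex.continuous_ofReal.tendsto _).comp t1
  have c2 := (Complex.continuous_ofReal.tendsto _).comp t2
  have c3 := (c1.add (c2.mul_const Complex.I)).const_mul (2 * π : ℂ)⁻¹
  have hπ : (π : ℂ) ≠ 0 := by exact_mod_cast Real.pi_pos.ne'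
  have e : (2 * π : ℂ)⁻¹ * (((2 * π * (f θ).re : ℝ) : ℂ) + ((2 * π * (f θ).im : ℝ) : ℂ) * Complex.I)
      = f θ := by
    conv_rhs => rw [← Complex.re_add_im (f θ)]
    push_cast
    field_simp
  rw [e] at c3
  refine c3.congr' ?_
  filter_upwards [Ioo_mem_nhdsLT (show (0 : ℝ) < 1 by norm_num)] with r hr
  have hr' : |r| < 1 := by rw [abs_of_pos hr.1]; exact hr.2
  have hk : Continuous fun t => pk α (polar r (θ - t)) :=
    (continuous_pk_polar hr').comp (continuous_const.sub continuous_id)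
  rw [pInt_polar]
  congr 1
  simp only [Function.comp]
  rw [← intervalIntegral.integral_ofReal, ← intervalIntegral.integral_ofReal,
    ← intervalIntegral.integral_mul_const, ← intervalIntegral.integral_add]
  · refine intervalIntegral.integral_congr fun t _ => ?_
    conv_rhs => rw [← Complex.re_add_im (f t)]
    push_cast
    ring
  · have := hre.continuousOn_mul hk.continuousOn
    exact ⟨this.1.ofReal, this.2.ofReal⟩
  · have := him.continuousOn_mul hk.continuousOn
    exact IntervalIntegrable.mul_const ⟨this.1.ofReal, this.2.ofReal⟩ _

/-! ### Weak limits of equi-integrable families -/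

/-- An ultrafilter gives limits for all measurable sets at once, which replaces a diagonal
extraction. -/
theorem exists_tendsto_ultrafilter_of_bounded {ι : Type*} {l : Ultrafilter ι} {c : ι → ℝ} {C : ℝ}
    (hc : ∀ i, |c i| ≤ C) : ∃ a, Tendsto c l (𝓝 a) := by
  have hmem : ((l.map c : Ultrafilter ℝ) : Filter ℝ) ≤ 𝓟 (Icc (-C) C) := by
    rw [le_principal_iff]
    exact Filter.Eventually.of_forall (f := (l : Filter ι)) fun i => abs_le.1 (hc i)
  obtain ⟨a, -, ha⟩ := (isCompact_Icc (a := -C) (b := C)).ultrafilter_le_nhds (l.map c) hmem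
  exact ⟨a, ha⟩

section WeakLimit

variable {X ι : Type*} [MeasurableSpace X] {μ : Measure X} {l : Ultrafilter ι}
  {v : ι → X → ℝ} {M s : ℝ}

/-- The limits `L E` of the integrals over `E` are finitely additive and inherit the bound `M
μ(E)^s`. That bound makes `L` countably additive and absolutely continuous, so Radon–Nikodym
provides the density. -/
theorem exists_setIntegral_limit [IsFiniteMeasure μ] (hs : 0 < s) (hv : ∀ i, Integrable (v i) μ)
    (hω : ∀ i E, MeasurableSet E → |∫ x in E, v i x ∂μ| ≤ M * μ.real E ^ s) :
    ∃ f : X → ℝ, Integrable f μ ∧ ∀ E, MeasurableSet E →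
      Tendsto (fun i => ∫ x in E, v i x ∂μ) l (𝓝 (∫ x in E, f x ∂μ)) := by
  classical
  have hex : ∀ E : Set X, ∃ a, MeasurableSet E → Tendsto (fun i => ∫ x in E, v i x ∂μ) l (𝓝 a) := by
    intro E
    by_cases hE : MeasurableSet E
    · obtain ⟨a, ha⟩ := exists_tendsto_ultrafilter_of_bounded (l := l) fun i => hω i E hE
      exact ⟨a, fun _ => ha⟩
    · exact ⟨0, fun h => absurd h hE⟩
  choose L hL using hex
  have hLb : ∀ E, MeasurableSet E → |L E| ≤ M * μ.real E ^ s := fun E hE =>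
    le_of_tendsto (hL E hE).abs (Eventually.of_forall fun i => hω i E hE)
  have hLnull : ∀ E, MeasurableSet E → μ E = 0 → L E = 0 := by
    intro E hE h0
    have := hLb E hE
    rw [measureReal_def, h0, ENNReal.toReal_zero, Real.zero_rpow hs.ne', mul_zero] at this
    exact abs_nonpos_iff.1 this
  have hLadd : ∀ A B, MeasurableSet A → MeasurableSet B → Disjoint A B →
      L (A ∪ B) = L A + L B := by
    intro A B hA hB hAB
    refine tendsto_nhds_unique (hL _ (hA.union hB)) (((hL A hA).add (hL B hB)).congr fun i => ?_)
    exact (setIntegral_union hAB hB (hv i).integrableOn (hv i).integrableOn).symm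
  have hLsum : ∀ (F : ℕ → Set X), (∀ i, MeasurableSet (F i)) →
      Pairwise (Function.onFun Disjoint F) →
      HasSum (fun i => L (F i)) (L (⋃ i, F i)) := by
    intro F hF hd
    have hfin : ∀ t : Finset ℕ, L (⋃ i ∈ t, F i) = ∑ i ∈ t, L (F i) := by
      intro t
      induction t using Finset.induction_on with
      | empty => simp [hLnull ∅ MeasurableSet.empty measure_empty]
      | insert a t ha ih =>
        rw [Finset.set_biUnion_insert, Finset.sum_insert ha, ← ih]
        refine hLadd _ _ (hF a) (Finset.measurableSet_biUnion t fun i _ => hF i) ?_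
        rw [Set.disjoint_iUnion₂_right]
        intro i hi
        exact hd fun h => ha (h ▸ hi)
    have hU : MeasurableSet (⋃ i, F i) := MeasurableSet.iUnion hF
    -- The error of a finite partial sum is `L` of the leftover set, whose measure tends to zero.
    have hrest : ∀ t : Finset ℕ, L (⋃ i, F i) - ∑ i ∈ t, L (F i)
        = L ((⋃ i, F i) \ ⋃ i ∈ t, F i) := by
      intro t
      have ht : MeasurableSet (⋃ i ∈ t, F i) := Finset.measurableSet_biUnion t fun i _ => hF i
      have hsub : (⋃ i ∈ t, F i) ⊆ ⋃ i, F i := iUnion₂_subset fun i _ => subset_iUnion F i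
      have := hLadd _ _ ht (hU.diff ht) disjoint_sdiff_right
      rw [union_sdiff_cancel hsub] at this
      rw [this, hfin]
      ring
    have hmeas : HasSum (fun i => μ.real (F i)) (μ.real (⋃ i, F i)) := by
      have h1 : μ (⋃ i, F i) = ∑' i, μ (F i) := measure_iUnion hd hF
      have h2 : ∑' i, μ (F i) ≠ ∞ := by rw [← h1]; exact measure_ne_top _ _
      have h3 := (ENNReal.summable_toReal h2).hasSum
      rwa [← ENNReal.tsum_toReal_eq (fun i => measure_ne_top _ _), ← h1] at h3
    have hm2 : ∀ t : Finset ℕ, μ.real ((⋃ i, F i) \ ⋃ i ∈ t, F i)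
        = μ.real (⋃ i, F i) - ∑ i ∈ t, μ.real (F i) := by
      intro t
      have ht : MeasurableSet (⋃ i ∈ t, F i) := Finset.measurableSet_biUnion t fun i _ => hF i
      have hsub : (⋃ i ∈ t, F i) ⊆ ⋃ i, F i := iUnion₂_subset fun i _ => subset_iUnion F i
      rw [measureReal_sdiff hsub ht, measureReal_biUnion_finset (fun i _ j _ h => hd h)
        (fun i _ => hF i)]
    have hzero : Tendsto (fun t : Finset ℕ => M * μ.real ((⋃ i, F i) \ ⋃ i ∈ t, F i) ^ s) atTop
        (𝓝 0) := by
      have h1 : Tendsto (fun t : Finset ℕ => μ.real ((⋃ i, F i) \ ⋃ i ∈ t, F i)) atTop (𝓝 0) := by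
        simp only [hm2]
        have : Tendsto (fun t : Finset ℕ => ∑ i ∈ t, μ.real (F i)) atTop
          (𝓝 (μ.real (⋃ i, F i))) := hmeas
        simpa using this.const_sub (μ.real (⋃ i, F i))
      have := (h1.rpow_const (p := s) (Or.inr hs.le)).const_mul M
      rwa [Real.zero_rpow hs.ne', mul_zero] at this
    have hlim : Tendsto (fun t : Finset ℕ => L (⋃ i, F i) - ∑ i ∈ t, L (F i)) atTop (𝓝 0) := by
      refine squeeze_zero_norm (fun t => ?_) hzero
      rw [hrest, Real.norm_eq_abs]
      exact hLb _ (hU.diff (Finset.measurableSet_biUnion t fun i _ => hF i))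
    have := hlim.const_sub (L (⋃ i, F i))
    simpa [HasSum] using this
  -- A vector measure must vanish on non-measurable sets, hence the default value `0`.
  let S : SignedMeasure X :=
    { measureOf' := fun E => if MeasurableSet E then L E else 0
      empty' := by simp [hLnull ∅ MeasurableSet.empty measure_empty]
      not_measurable' := fun E hE => by simp [hE]
      m_iUnion' := fun F hF hd => by
        simp only [hF, MeasurableSet.iUnion hF, if_true]
        exact hLsum F hF hd }
  have hS : ∀ E, MeasurableSet E → S E = L E := fun E hE => if_pos hE
  have hac : S ≪ᵥ μ.toENNRealVectorMeasure := by
    refine VectorMeasure.AbsolutelyContinuous.mk fun E hE h0 => ?_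
    rw [hS E hE]
    rw [Measure.toENNRealVectorMeasure_apply_measurable hE] at h0
    exact hLnull E hE h0
  refine ⟨S.rnDeriv μ, SignedMeasure.integrable_rnDeriv S μ, fun E hE => ?_⟩
  have h1 := SignedMeasure.withDensityᵥ_rnDeriv_eq S μ hac
  have h2 := withDensityᵥ_apply (SignedMeasure.integrable_rnDeriv S μ) hE
  rw [h1, hS E hE] at h2
  rw [← h2]
  exact hL E hE

/-- Convergence on sets gives convergence against simple functions; a bounded `g` is a uniform limit
of these, and the uniform `L¹` bound controls the error. -/
theorem tendsto_integral_mul_of_setIntegral (hv : ∀ i, Integrable (v i) μ) {f : X → ℝ}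
    (hf : Integrable f μ) (hM : ∀ i, ∫ x, |v i x| ∂μ ≤ M)
    (hlim : ∀ E, MeasurableSet E → Tendsto (fun i => ∫ x in E, v i x ∂μ) l (𝓝 (∫ x in E, f x ∂μ)))
    {g : X → ℝ} (hg : Measurable g) {C : ℝ} (hC : ∀ x, |g x| ≤ C) :
    Tendsto (fun i => ∫ x, g x * v i x ∂μ) l (𝓝 (∫ x, g x * f x ∂μ)) := by
  have hsimple : ∀ h : SimpleFunc X ℝ,
      Tendsto (fun i => ∫ x, h x * v i x ∂μ) l (𝓝 (∫ x, h x * f x ∂μ)) := by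
    intro h
    induction h using SimpleFunc.induction with
    | @const c E hE =>
      have e : ∀ w : X → ℝ, ∫ x, (SimpleFunc.piecewise _ hE (SimpleFunc.const X c)
          (SimpleFunc.const X 0)) x * w x ∂μ = c * ∫ x in E, w x ∂μ := by
        intro w
        rw [← integral_indicator hE, ← integral_const_mul]
        refine integral_congr_ae (Eventually.of_forall fun x => ?_)
        simp [indicator, Set.piecewise]
      simp only [e]
      exact (hlim _ hE).const_mul c
    | @add h₁ h₂ hdis ih₁ ih₂ =>
      have bd : ∀ h : SimpleFunc X ℝ, ∀ w : X → ℝ, Integrable w μ →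
          Integrable (fun x => h x * w x) μ := by
        intro h w hw
        obtain ⟨K, hK⟩ := h.exists_forall_norm_le
        exact hw.bdd_mul h.aestronglyMeasurable (Eventually.of_forall hK)
      have e : ∀ w : X → ℝ, Integrable w μ → ∫ x, (h₁ + h₂) x * w x ∂μ
          = (∫ x, h₁ x * w x ∂μ) + ∫ x, h₂ x * w x ∂μ := by
        intro w hw
        rw [← integral_add (bd h₁ w hw) (bd h₂ w hw)]
        refine integral_congr_ae (Eventually.of_forall fun x => ?_)
        simp [add_mul]
      rw [e f hf]
      simp only [fun i => e (v i) (hv i)]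
      exact ih₁.add ih₂
  have happrox : ∀ n : ℕ, 0 < n → ∃ h : SimpleFunc X ℝ, ∀ x, |g x - h x| ≤ 1 / n := by
    intro n hn
    have hn' : (0 : ℝ) < n := by exact_mod_cast hn
    -- Rounding `g` down to the grid of step `1/n`; boundedness of `g` makes the range finite.
    refine ⟨⟨fun x => (⌊n * g x⌋ : ℝ) / n, fun c => ?_, ?_⟩, fun x => ?_⟩
    · exact (show Measurable fun x => (⌊n * g x⌋ : ℝ) / n by fun_prop) (measurableSet_singleton c)
    · refine ((Set.finite_Icc (⌊-(n * C)⌋ : ℤ) ⌊n * C⌋).image fun m : ℤ => (m : ℝ) / n).subset ?_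
      rintro _ ⟨x, rfl⟩
      have := abs_le.1 (hC x)
      refine ⟨⌊n * g x⌋, ⟨Int.floor_le_floor ?_, Int.floor_le_floor ?_⟩, rfl⟩ <;> nlinarith
    · have h1 := Int.floor_le (n * g x)
      have h2 := Int.lt_floor_add_one (n * g x)
      change |g x - (⌊n * g x⌋ : ℝ) / n| ≤ 1 / n
      rw [show g x - (⌊n * g x⌋ : ℝ) / n = (n * g x - ⌊n * g x⌋) / n by field_simp, abs_div,
        abs_of_pos hn', abs_of_nonneg (by linarith)]
      gcongr
      linarith
  have hdiff : ∀ (h : SimpleFunc X ℝ) (n : ℕ), (∀ x, |g x - h x| ≤ 1 / n) → ∀ w : X → ℝ,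
      Integrable w μ → |(∫ x, g x * w x ∂μ) - ∫ x, h x * w x ∂μ| ≤ 1 / n * ∫ x, |w x| ∂μ := by
    intro h n hh w hw
    obtain ⟨K, hK⟩ := h.exists_forall_norm_le
    rw [← integral_sub (hw.bdd_mul hg.aestronglyMeasurable (Eventually.of_forall hC))
      (hw.bdd_mul h.aestronglyMeasurable (Eventually.of_forall hK)), ← integral_const_mul,
      ← Real.norm_eq_abs]
    refine norm_integral_le_of_norm_le (hw.abs.const_mul _) (Eventually.of_forall fun x => ?_)
    rw [← sub_mul, norm_mul]
    exact mul_le_mul_of_nonneg_right (hh x) (norm_nonneg _)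
  rw [Metric.tendsto_nhds]
  intro ε hε
  set K := |M| + (∫ x, |f x| ∂μ) + 1 with hK
  have hfn : 0 ≤ ∫ x, |f x| ∂μ := integral_nonneg fun x => abs_nonneg _
  have hKpos : 0 < K := by positivity
  obtain ⟨n, hn⟩ := exists_nat_gt (2 * K / ε)
  have hn0 : (0 : ℝ) < n := lt_trans (by positivity) hn
  obtain ⟨h, hh⟩ := happrox n (by exact_mod_cast hn0)
  have hn2 : 1 / (n : ℝ) * K < ε / 2 := by
    rw [div_lt_iff₀ hε] at hn
    rw [one_div_mul_eq_div, div_lt_iff₀ hn0]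
    linarith
  have h3 := Metric.tendsto_nhds.1 (hsimple h) (ε / 2) (by positivity)
  filter_upwards [h3] with i hi
  rw [Real.dist_eq] at hi ⊢
  have a1 := hdiff h n hh (v i) (hv i)
  have a2 := hdiff h n hh f hf
  have a3 : 1 / (n : ℝ) * ∫ x, |v i x| ∂μ + 1 / (n : ℝ) * ∫ x, |f x| ∂μ ≤ 1 / (n : ℝ) * K := by
    rw [← mul_add]
    refine mul_le_mul_of_nonneg_left ?_ (by positivity)
    have := hM i
    have := le_abs_self M
    linarith
  rw [abs_le] at a1 a2
  rw [abs_lt] at hi ⊢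
  constructor <;> linarith [a1.1, a1.2, a2.1, a2.2, hi.1, hi.2]

end WeakLimit

/-! ### Bounded means -/

theorem polar_mem_ball {r : ℝ} (hr : |r| < 1) (θ : ℝ) : polar r θ ∈ Metric.ball (0 : ℂ) 1 := by
  rwa [mem_ball_zero_iff, norm_polar]

theorem continuous_polar (r : ℝ) : Continuous (polar r) := by
  unfold polar
  fun_prop

theorem polar_periodic (r : ℝ) : Function.Periodic (polar r) (2 * π) := by
  intro θ
  simp only [polar]
  congr 1
  push_cast
  rw [add_mul, Complex.exp_add, Complex.exp_two_pi_mul_I, mul_one]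

theorem IsAlphaHarmonic.continuous_polar {α : ℝ} {u : ℂ → ℂ} (hu : IsAlphaHarmonic α u) {r : ℝ}
    (hr : |r| < 1) : Continuous fun θ => u (polar r θ) :=
  hu.1.continuousOn.comp_continuous (AlphaHarmonic.continuous_polar r) fun θ => polar_mem_ball hr θ

theorem MemHardy.exists_integral_le {α p : ℝ} (hp : 1 < p) {u : ℂ → ℂ} (hu : MemHardy α p u) :
    ∃ K, 0 ≤ K ∧ ∀ r ∈ Ico (0 : ℝ) 1, ∫ θ in (0 : ℝ)..(2 * π), ‖u (polar r θ)‖ ^ p ≤ K := by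
  obtain ⟨-, M, hM⟩ := hu
  have nn : ∀ r, 0 ≤ ∫ θ in (0 : ℝ)..(2 * π), ‖u (polar r θ)‖ ^ p := fun r =>
    intervalIntegral.integral_nonneg Real.two_pi_pos.le fun θ _ =>
      Real.rpow_nonneg (norm_nonneg _) _
  have hM0 : 0 ≤ M := le_trans (Real.rpow_nonneg (mul_nonneg (by positivity) (nn 0)) _)
    (hM 0 (by simp))
  refine ⟨2 * π * M ^ p, by positivity, fun r hr => ?_⟩
  have h := hM r hr
  rw [integralMean, one_div p, Real.rpow_inv_le_iff_of_pos (mul_nonneg (by positivity) (nn r)) hM0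
    (by linarith)] at h
  rw [one_div, inv_mul_le_iff₀ Real.two_pi_pos] at h
  exact h

/-- Hölder against the constant `1` on `E`. The positive power of the measure is the
equi-integrability that weak compactness needs, and it is where `p > 1` enters. -/
theorem abs_setIntegral_le_of_integral_rpow_le {p q K : ℝ} (hpq : p.HolderConjugate q)
    {w : ℝ → ℂ} (hw : Continuous w) (hK : ∫ θ in (0 : ℝ)..(2 * π), ‖w θ‖ ^ p ≤ K) (E : Set ℝ) :
    ∫ θ in E, ‖w θ‖ ∂(volume.restrict (Ioc 0 (2 * π)))
      ≤ K ^ (1 / p) * (volume.restrict (Ioc 0 (2 * π))).real E ^ (1 / q) := by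
  set μ := volume.restrict (Ioc 0 (2 * π))
  have hmem : MemLp (fun θ => ‖w θ‖) (ENNReal.ofReal p) (μ.restrict E) := by
    obtain ⟨C, hC⟩ := isCompact_Icc (a := 0) (b := 2 * π) |>.exists_bound_of_continuousOn
      hw.continuousOn
    have h1 : MemLp (fun θ => ‖w θ‖) (ENNReal.ofReal p) μ := by
      refine MemLp.of_bound (hw.norm.aestronglyMeasurable) C ?_
      refine (ae_restrict_iff' measurableSet_Ioc).2 (Eventually.of_forall fun θ hθ => ?_)
      rw [norm_norm]
      exact hC θ ⟨hθ.1.le, hθ.2⟩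
    exact h1.restrict E
  have h := integral_mul_le_Lp_mul_Lq_of_nonneg (μ := μ.restrict E) hpq
    (f := fun θ => ‖w θ‖) (g := fun _ => 1) (Eventually.of_forall fun _ => norm_nonneg _)
    (Eventually.of_forall fun _ => zero_le_one) hmem (memLp_const 1)
  simp only [mul_one, Real.one_rpow, integral_const, smul_eq_mul, measureReal_restrict_apply_univ]
    at h
  refine h.trans ?_
  have hnn : ∀ ν : Measure ℝ, 0 ≤ ∫ θ, ‖w θ‖ ^ p ∂ν := fun ν =>
    integral_nonneg fun θ => Real.rpow_nonneg (norm_nonneg _) _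
  refine mul_le_mul_of_nonneg_right (Real.rpow_le_rpow (hnn _) ?_
    (one_div_nonneg.2 hpq.nonneg)) (Real.rpow_nonneg measureReal_nonneg _)
  refine le_trans ?_ hK
  rw [intervalIntegral.integral_of_le Real.two_pi_pos.le]
  refine setIntegral_le_integral ?_ (Eventually.of_forall fun θ =>
    Real.rpow_nonneg (norm_nonneg _) _)
  exact ((hw.norm.rpow_const fun θ => Or.inr hpq.nonneg).integrableOn_Icc
    (a := 0) (b := 2 * π)).mono_set Ioc_subset_Icc_self

/-- Only the pairings with exponentials are recorded, since the identification of `u` works mode by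
mode. -/
theorem exists_weak_limit {α p : ℝ} (hp : 1 < p) {u : ℂ → ℂ} (hu : MemHardy α p u) {ρ : ℕ → ℝ}
    (hρ : ∀ n, ρ n ∈ Ico (0 : ℝ) 1) :
    ∃ f : ℝ → ℂ, IntervalIntegrable f volume 0 (2 * π) ∧ ∀ n : ℤ,
      Tendsto (fun j => ∫ θ in (0 : ℝ)..(2 * π),
          Complex.exp (-(n * θ * Complex.I)) * u (polar (ρ j) θ)) (hyperfilter ℕ)
        (𝓝 (∫ θ in (0 : ℝ)..(2 * π), Complex.exp (-(n * θ * Complex.I)) * f θ)) := by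
  obtain ⟨K, hK0, hK⟩ := hu.exists_integral_le hp
  have hpq : p.HolderConjugate (Real.conjExponent p) := Real.HolderConjugate.conjExponent hp
  set q := Real.conjExponent p
  set μ := volume.restrict (Ioc 0 (2 * π)) with hμ
  have hc : ∀ j, Continuous fun θ => u (polar (ρ j) θ) := fun j =>
    hu.1.continuous_polar (by rw [abs_of_nonneg (hρ j).1]; exact (hρ j).2)
  have hint : ∀ j, Integrable (fun θ => u (polar (ρ j) θ)) μ := fun j =>
    ((hc j).integrableOn_Icc (a := 0) (b := 2 * π)).mono_set Ioc_subset_Icc_self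
  have hs : 0 < 1 / q := one_div_pos.2 hpq.symm.pos
  have hb : ∀ j E, ∫ θ in E, ‖u (polar (ρ j) θ)‖ ∂μ
      ≤ K ^ (1 / p) * μ.real E ^ (1 / q) := fun j E =>
    abs_setIntegral_le_of_integral_rpow_le hpq (hc j) (hK _ (hρ j)) E
  have hL1 : ∀ j, ∫ θ, ‖u (polar (ρ j) θ)‖ ∂μ ≤ K ^ (1 / p) * μ.real univ ^ (1 / q) := fun j => by
    have := hb j univ
    rwa [Measure.restrict_univ] at this
  -- The compactness argument is real-valued, so it is run for `T = re` and `T = im` and reassembled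
  -- with cosines and sines.
  have part : ∀ T : ℂ → ℝ, (∀ z, |T z| ≤ ‖z‖) → (∀ w : ℝ → ℂ, Integrable w μ →
      Integrable (fun θ => T (w θ)) μ) →
      ∃ f : ℝ → ℝ, Integrable f μ ∧ ∀ g : ℝ → ℝ, Measurable g → (∀ x, |g x| ≤ 1) →
        Tendsto (fun j => ∫ θ, g θ * T (u (polar (ρ j) θ)) ∂μ) (hyperfilter ℕ)
          (𝓝 (∫ θ, g θ * f θ ∂μ)) := by
    intro T hT hTi
    have hTb : ∀ j E, ∫ θ in E, |T (u (polar (ρ j) θ))| ∂μ ≤ ∫ θ in E, ‖u (polar (ρ j) θ)‖ ∂μ :=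
      fun j E => integral_mono (hTi _ (hint j)).abs.restrict (hint j).norm.restrict fun θ => hT _
    obtain ⟨f, hf, hlim⟩ := exists_setIntegral_limit (l := hyperfilter ℕ) (μ := μ) hs
      (v := fun j θ => T (u (polar (ρ j) θ))) (M := K ^ (1 / p)) (fun j => hTi _ (hint j))
      fun j E _ => (abs_integral_le_integral_abs).trans ((hTb j E).trans (hb j E))
    refine ⟨f, hf, fun g hg hg1 => ?_⟩
    refine tendsto_integral_mul_of_setIntegral (fun j => hTi _ (hint j)) hf
      (M := K ^ (1 / p) * μ.real univ ^ (1 / q)) (fun j => ?_) hlim hg hg1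
    have := hTb j univ
    simp only [Measure.restrict_univ] at this
    exact this.trans (hL1 j)
  obtain ⟨f₁, hf₁, h1⟩ := part Complex.re Complex.abs_re_le_norm fun w hw => hw.re
  obtain ⟨f₂, hf₂, h2⟩ := part Complex.im Complex.abs_im_le_norm fun w hw => hw.im
  have hfi : Integrable (fun θ => (f₁ θ : ℂ) + f₂ θ * Complex.I) μ :=
    hf₁.ofReal.add (hf₂.ofReal.mul_const _)
  refine ⟨fun θ => f₁ θ + f₂ θ * Complex.I, ?_, fun n => ?_⟩
  · rw [intervalIntegrable_iff_integrableOn_Ioc_of_le Real.two_pi_pos.le]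
    exact hfi
  · have expand : ∀ a b : ℝ → ℝ, Integrable a μ → Integrable b μ →
        ∫ θ in (0 : ℝ)..(2 * π), Complex.exp (-(n * θ * Complex.I)) * (a θ + b θ * Complex.I)
        = (((∫ θ, Real.cos (n * θ) * a θ ∂μ) + ∫ θ, Real.sin (n * θ) * b θ ∂μ : ℝ) : ℂ)
          + (((∫ θ, Real.cos (n * θ) * b θ ∂μ) - ∫ θ, Real.sin (n * θ) * a θ ∂μ : ℝ) : ℂ)
            * Complex.I := by
      intro a b ha hb
      have mc : ∀ w : ℝ → ℝ, Integrable w μ → Integrable (fun θ => Real.cos (n * θ) * w θ) μ :=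
        fun w hw => hw.bdd_mul (c := 1) (by fun_prop) (Eventually.of_forall fun θ => by
          simpa using Real.abs_cos_le_one _)
      have ms : ∀ w : ℝ → ℝ, Integrable w μ → Integrable (fun θ => Real.sin (n * θ) * w θ) μ :=
        fun w hw => hw.bdd_mul (c := 1) (by fun_prop) (Eventually.of_forall fun θ => by
          simpa using Real.abs_sin_le_one _)
      rw [← integral_add (mc a ha) (ms b hb), ← integral_sub (mc b hb) (ms a ha),
        ← integral_complex_ofReal, ← integral_complex_ofReal, ← integral_mul_const,
        ← integral_add,
        intervalIntegral.integral_of_le Real.two_pi_pos.le]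
      · refine integral_congr_ae (Eventually.of_forall fun θ => ?_)
        have : Complex.exp (-(n * θ * Complex.I)) =
            Complex.cos (n * θ) - Complex.sin (n * θ) * Complex.I := by
          rw [← neg_mul, Complex.exp_mul_I, Complex.cos_neg, Complex.sin_neg]; ring
        simp only [this]
        push_cast
        linear_combination -(Complex.sin (n * θ) * b θ) * Complex.I_sq
      · exact ((mc a ha).add (ms b hb)).ofReal
      · exact ((mc b hb).sub (ms a ha)).ofReal.mul_const _
    have e1 := expand f₁ f₂ hf₁ hf₂
    have e2 : ∀ j, _ := fun j => expand _ _ (hint j).re (hint j).im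
    simp only [RCLike.re_eq_complex_re, RCLike.im_eq_complex_im, Complex.re_add_im] at e2
    have bc : ∀ x : ℝ, |Real.cos (n * x)| ≤ 1 := fun x => Real.abs_cos_le_one _
    have bs : ∀ x : ℝ, |Real.sin (n * x)| ≤ 1 := fun x => Real.abs_sin_le_one _
    have mc : Measurable fun x : ℝ => Real.cos (n * x) := by fun_prop
    have ms : Measurable fun x : ℝ => Real.sin (n * x) := by fun_prop
    simp only [e1, e2]
    exact ((Complex.continuous_ofReal.tendsto _).comp ((h1 _ mc bc).add (h2 _ ms bs))).add
      (((Complex.continuous_ofReal.tendsto _).comp ((h2 _ mc bc).sub (h1 _ ms bs))).mul_const _)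

/-! ### Representation by Poisson integrals -/

theorem IsAlphaHarmonic.sub_const_mul {α : ℝ} {u v : ℂ → ℂ} (hu : IsAlphaHarmonic α u)
    (hv : IsAlphaHarmonic α v) (c : ℂ) : IsAlphaHarmonic α (fun z => u z - c * v z) := by
  rw [isAlphaHarmonic_iff] at *
  refine ⟨hu.1.sub (contDiffOn_const.mul hv.1), fun z hz => ?_⟩
  have hu' : ContDiffAt ℝ 2 u z := hu.1.contDiffAt (Metric.isOpen_ball.mem_nhds hz)
  have hv' : ContDiffAt ℝ 2 v z := hv.1.contDiffAt (Metric.isOpen_ball.mem_nhds hz)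
  have hcv : ContDiffAt ℝ 2 (c • v) z := contDiffAt_const.smul hv'
  have e : (fun z => u z - c * v z) = u - c • v := by ext z; simp
  have h1 := hu.2 z hz
  have h2 := hv.2 z hz
  have l2 : Laplacian.laplacian (c • v) z = c * Laplacian.laplacian v z := by
    have hl := ContDiffAt.laplacian_CLM_comp_left (l := (c • ContinuousLinearMap.id ℝ ℂ)) hv'
    have e2 : (⇑(c • ContinuousLinearMap.id ℝ ℂ) ∘ v) = c • v := by ext; simp
    rw [e2] at hl
    simpa using hl
  have d1 : fderiv ℝ (u - c • v) z z = fderiv ℝ u z z - c * fderiv ℝ v z z := by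
    rw [fderiv_sub (hu'.differentiableAt (by norm_num)) (hcv.differentiableAt (by norm_num)),
      fderiv_const_smul (hv'.differentiableAt (by norm_num))]
    simp
  rw [e]
  unfold redOp at *
  rw [hu'.laplacian_sub hcv, l2, d1]
  simp only [Pi.sub_apply, Pi.smul_apply, smul_eq_mul]
  linear_combination h1 - c * h2

theorem exp_int_periodic (n : ℤ) :
    Function.Periodic (fun t : ℝ => Complex.exp (n * t * Complex.I)) (2 * π) := by
  intro t
  have : (n : ℂ) * ((t + 2 * π : ℝ) : ℂ) * Complex.I
      = n * t * Complex.I + n * (2 * π * Complex.I) := by push_cast; ring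
  simp only [this, Complex.exp_add, Complex.exp_int_mul_two_pi_mul_I, mul_one]

theorem rot_periodic (z : ℂ) : Function.Periodic (fun t => rot t z) (2 * π) := by
  intro t
  simp only [rot_apply]
  congr 1
  have : -(((t + 2 * π : ℝ) : ℂ) * Complex.I)
      = -(t * Complex.I) + ((-1 : ℤ) : ℂ) * (2 * π * Complex.I) := by push_cast; ring
  rw [this, Complex.exp_add, Complex.exp_int_mul_two_pi_mul_I, mul_one]

theorem rotAvg_exp_rot (k : ℂ → ℂ) (n : ℤ) (s : ℝ) (z : ℂ) :
    rotAvg k (fun t => Complex.exp (n * t * Complex.I)) (rot s z)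
      = Complex.exp (-(n * s * Complex.I))
        * rotAvg k (fun t => Complex.exp (n * t * Complex.I)) z := by
  simp only [rotAvg]
  set F : ℝ → ℂ := fun t => Complex.exp (n * t * Complex.I) * k (rot t z) with hF
  have hFp : Function.Periodic F (2 * π) := by
    intro t
    have h1 := exp_int_periodic n t
    have h2 := rot_periodic z t
    simp only [hF]
    simp only at h1 h2
    rw [h1, h2]
  have e : (fun t : ℝ => Complex.exp (n * t * Complex.I) * k (rot t (rot s z)))
      = fun t => Complex.exp (-(n * s * Complex.I)) * F (t + s) := by
    ext t
    simp only [hF]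
    rw [← rot_add, ← mul_assoc, ← Complex.exp_add]
    congr 2
    push_cast; ring
  rw [e, intervalIntegral.integral_const_mul, intervalIntegral.integral_comp_add_right]
  congr 1
  have := hFp.intervalIntegral_add_eq s 0
  rw [zero_add, add_comm s] at *
  simpa using this

theorem polar_zero_right (r : ℝ) : polar r 0 = r := by simp [polar]

theorem rotAvg_exp_ofReal {k : ℂ → ℂ} (n : ℤ) (r : ℝ) :
    rotAvg k (fun t => Complex.exp (n * t * Complex.I)) r
      = ∫ θ in (0 : ℝ)..(2 * π), Complex.exp (-(n * θ * Complex.I)) * k (polar r θ) := by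
  simp only [rotAvg]
  set G : ℝ → ℂ := fun θ => Complex.exp (-(n * θ * Complex.I)) * k (polar r θ) with hG
  have hGp : Function.Periodic G (2 * π) := by
    intro t
    have h1 := exp_int_periodic (-n) t
    have h2 := polar_periodic r t
    simp only [hG]
    push_cast at h1 h2 ⊢
    rw [h2, ← neg_mul, ← neg_mul, ← neg_mul, ← neg_mul, h1]
  have e : (fun t : ℝ => Complex.exp (n * t * Complex.I) * k (rot t r)) = fun t => G (0 - t) := by
    ext t
    simp only [hG]
    rw [← polar_zero_right r, rot_polar]
    congr 2
    push_cast; ring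
  rw [e, intervalIntegral.integral_comp_sub_left]
  have := hGp.intervalIntegral_add_eq (-(2 * π)) 0
  simpa using this

/-- Vanishing coefficients are summable, so the Fourier series converges pointwise to `d`, and all
its terms are zero. -/
theorem eq_zero_of_fourier_eq_zero {d : ℝ → ℂ} (hd : Continuous d)
    (hp : Function.Periodic d (2 * π))
    (h0 : ∀ n : ℤ, ∫ θ in (0 : ℝ)..(2 * π), Complex.exp (-(n * θ * Complex.I)) * d θ = 0)
    (θ : ℝ) : d θ = 0 := by
  have : Fact (0 < 2 * π) := ⟨Real.two_pi_pos⟩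
  let D : C(AddCircle (2 * π), ℂ) := ⟨hp.lift, continuous_coinduced_dom.2 hd⟩
  have hD : ∀ x : ℝ, D (x : AddCircle (2 * π)) = d x := fun x => rfl
  have hc : fourierCoeff (D : AddCircle (2 * π) → ℂ) = 0 := by
    ext n
    rw [fourierCoeff_eq_intervalIntegral _ n 0]
    have e : ∀ x : ℝ, fourier (-n) (x : AddCircle (2 * π)) • D (x : AddCircle (2 * π))
        = Complex.exp (-(n * x * Complex.I)) * d x := by
      intro x
      rw [fourier_coe_apply, hD, smul_eq_mul]
      congr 2
      have : (π : ℂ) ≠ 0 := by exact_mod_cast Real.pi_ne_zero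
      push_cast
      field_simp
    simp only [e, zero_add, h0, smul_zero, Pi.zero_apply]
  have hs : Summable (fourierCoeff (D : AddCircle (2 * π) → ℂ)) := by
    rw [hc]; exact summable_zero
  have := has_pointwise_sum_fourier_series_of_summable hs (θ : AddCircle (2 * π))
  simp only [hc, Pi.zero_apply, zero_smul] at this
  rw [← hD θ]
  exact this.unique hasSum_zero

theorem continuous_exp_int (n : ℤ) : Continuous fun t : ℝ => Complex.exp (n * t * Complex.I) := by
  fun_prop

theorem pInt_exp (α : ℝ) (n : ℤ) (z : ℂ) :
    pInt α (fun t => Complex.exp (n * t * Complex.I)) z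
      = (2 * π : ℂ)⁻¹ * rotAvg (fun z => (pk α z : ℂ))
        (fun t => Complex.exp (n * t * Complex.I)) z := by
  simp only [pInt, rotAvg, mul_assoc, intervalIntegral.integral_const_mul]

/-- The Poisson integral of `e^{int}` at `r e^{iθ}` is `e^{inθ}` times its value at `r`, so the
almost everywhere radial limit at a single angle decides the limit at `θ = 0`. -/
theorem tendsto_pInt_exp {α : ℝ} (hα : -1 < α) (h0 : α ≤ 0) (n : ℤ) :
    Tendsto (fun r : ℝ => pInt α (fun t => Complex.exp (n * t * Complex.I)) r) (𝓝[<] 1) (𝓝 1) := by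
  obtain ⟨θ, hθ⟩ := (ae_tendsto_pInt hα h0 (exp_int_periodic n)
    ((continuous_exp_int n).intervalIntegrable _ _)).exists
  have e : ∀ r : ℝ, pInt α (fun t => Complex.exp (n * t * Complex.I)) (polar r θ)
      = Complex.exp (n * θ * Complex.I) * pInt α (fun t => Complex.exp (n * t * Complex.I)) r := by
    intro r
    have h1 : polar r θ = rot (-θ) r := by
      rw [← polar_zero_right r, rot_polar]; congr 1; ring
    rw [h1, pInt_exp, pInt_exp, rotAvg_exp_rot, mul_left_comm]
    congr 2
    push_cast; ring
  simp only [e] at hθ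
  have h2 := hθ.const_mul (Complex.exp (n * θ * Complex.I))⁻¹
  simpa [Complex.exp_ne_zero] using h2

/-- The convolution theorem on a circle: Fubini and translation by `t` within a period. -/
theorem fourier_pInt {α : ℝ} {f : ℝ → ℂ} (hf : IntervalIntegrable f volume 0 (2 * π)) {r : ℝ}
    (hr : |r| < 1) (n : ℤ) :
    ∫ θ in (0 : ℝ)..(2 * π), Complex.exp (-(n * θ * Complex.I)) * pInt α f (polar r θ)
      = (∫ t in (0 : ℝ)..(2 * π), Complex.exp (-(n * t * Complex.I)) * f t)
        * pInt α (fun t => Complex.exp (n * t * Complex.I)) r := by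
  set μ := volume.restrict (Ioc 0 (2 * π)) with hμ
  have hcont : Continuous fun x : ℝ × ℝ => (2 * π : ℂ)⁻¹ * (Complex.exp (-(n * x.1 * Complex.I))
      * (pk α (polar r (x.1 - x.2)) : ℂ)) := by
    have := (continuous_pk_polar (α := α) hr).comp (continuous_fst.sub continuous_snd : Continuous
      fun x : ℝ × ℝ => x.1 - x.2)
    have h2 := Complex.continuous_ofReal.comp this
    refine continuous_const.mul (Continuous.mul (by fun_prop) h2)
  obtain ⟨C, hC⟩ := (isCompact_Icc (a := (0 : ℝ)) (b := 2 * π)).prod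
    (isCompact_Icc (a := (0 : ℝ)) (b := 2 * π)) |>.exists_bound_of_continuousOn hcont.continuousOn
  have hfi : Integrable f μ := (intervalIntegrable_iff_integrableOn_Ioc_of_le
    Real.two_pi_pos.le).1 hf
  have hint : Integrable (fun x : ℝ × ℝ => ((2 * π : ℂ)⁻¹ * (Complex.exp (-(n * x.1 * Complex.I))
      * (pk α (polar r (x.1 - x.2)) : ℂ))) * f x.2) (μ.prod μ) := by
    refine (hfi.comp_snd μ).bdd_mul (c := C) hcont.aestronglyMeasurable ?_
    rw [hμ, Measure.prod_restrict]
    refine (ae_restrict_iff' (measurableSet_Ioc.prod measurableSet_Ioc)).2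
      (Eventually.of_forall fun x hx => hC x ⟨⟨hx.1.1.le, hx.1.2⟩, ⟨hx.2.1.le, hx.2.2⟩⟩)
  have key : ∀ t : ℝ, ∫ θ in (0 : ℝ)..(2 * π), (2 * π : ℂ)⁻¹
      * (Complex.exp (-(n * θ * Complex.I)) * (pk α (polar r (θ - t)) : ℂ)) * f t
      = (Complex.exp (-(n * t * Complex.I)) * f t)
        * pInt α (fun t => Complex.exp (n * t * Complex.I)) r := by
    intro t
    set G : ℝ → ℂ := fun θ => Complex.exp (-(n * θ * Complex.I)) * (pk α (polar r θ) : ℂ) with hG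
    have hGp : Function.Periodic G (2 * π) := by
      intro t
      have h1 := exp_int_periodic (-n) t
      have h2 := polar_periodic r t
      simp only [hG]
      push_cast at h1 h2 ⊢
      rw [h2, ← neg_mul, ← neg_mul, ← neg_mul, ← neg_mul, h1]
    have e : (fun θ : ℝ => (2 * π : ℂ)⁻¹
      * (Complex.exp (-(n * θ * Complex.I)) * (pk α (polar r (θ - t)) : ℂ)) * f t)
      = fun θ => ((2 * π : ℂ)⁻¹ * Complex.exp (-(n * t * Complex.I)) * f t) * G (θ - t) := by
      ext θ
      simp only [hG]
      have : Complex.exp (-(n * θ * Complex.I)) = Complex.exp (-(n * t * Complex.I))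
          * Complex.exp (-(n * (θ - t : ℝ) * Complex.I)) := by
        rw [← Complex.exp_add]; congr 1; push_cast; ring
      rw [this]; ring
    rw [e, intervalIntegral.integral_const_mul, intervalIntegral.integral_comp_sub_right]
    have h3 := hGp.intervalIntegral_add_eq (0 - t) 0
    have h4 : 0 - t + 2 * π = 2 * π - t := by ring
    rw [h4, zero_add] at h3
    rw [h3, pInt_exp, rotAvg_exp_ofReal]
    ring
  have hswap := integral_integral_swap (f := fun θ t : ℝ => ((2 * π : ℂ)⁻¹
    * (Complex.exp (-(n * θ * Complex.I))
      * (pk α (polar r (θ - t)) : ℂ))) * f t) hint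
  calc ∫ θ in (0 : ℝ)..(2 * π), Complex.exp (-(n * θ * Complex.I)) * pInt α f (polar r θ)
      = ∫ θ in (0 : ℝ)..(2 * π), ∫ t in (0 : ℝ)..(2 * π), (2 * π : ℂ)⁻¹
      * (Complex.exp (-(n * θ * Complex.I)) * (pk α (polar r (θ - t)) : ℂ)) * f t := by
        congr 1
        ext θ
        rw [pInt_polar, ← intervalIntegral.integral_const_mul,
          ← intervalIntegral.integral_const_mul]
        congr 1
        ext t
        ring
    _ = ∫ t in (0 : ℝ)..(2 * π), ∫ θ in (0 : ℝ)..(2 * π), (2 * π : ℂ)⁻¹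
      * (Complex.exp (-(n * θ * Complex.I)) * (pk α (polar r (θ - t)) : ℂ)) * f t := by
        simpa only [intervalIntegral.integral_of_le Real.two_pi_pos.le] using hswap
    _ = _ := by
        simp only [key, intervalIntegral.integral_mul_const]

/-- For `-1 < α ≤ 0`, every element of the Hardy space is the Poisson integral of an integrable
function. -/
theorem exists_pInt_eq {α p : ℝ} (hα : -1 < α) (h0 : α ≤ 0) (hp : 1 < p) {u : ℂ → ℂ}
    (hu : MemHardy α p u) : ∃ f : ℝ → ℂ, Function.Periodic f (2 * π) ∧
      IntervalIntegrable f volume 0 (2 * π) ∧ ∀ z ∈ Metric.ball (0 : ℂ) 1, u z = pInt α f z := by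
  set ρ : ℕ → ℝ := fun j => 1 - 1 / ((j : ℝ) + 1) with hρd
  have hρ : ∀ j, ρ j ∈ Ico (0 : ℝ) 1 := by
    intro j
    have h1 : (0 : ℝ) < 1 / ((j : ℝ) + 1) := by positivity
    have h2 : 1 / ((j : ℝ) + 1) ≤ 1 := by
      rw [div_le_one (by positivity)]; linarith [Nat.cast_nonneg (α := ℝ) j]
    constructor <;> simp only [hρd] <;> linarith
  have hρ1 : Tendsto ρ (hyperfilter ℕ) (𝓝[<] 1) := by
    refine tendsto_nhdsWithin_iff.2 ⟨?_, Eventually.of_forall fun j => (hρ j).2⟩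
    have := (tendsto_one_div_add_atTop_nhds_zero_nat (𝕜 := ℝ)).const_sub 1
    rw [sub_zero] at this
    exact this.mono_left Nat.hyperfilter_le_atTop
  obtain ⟨f₀, hf₀, hlim⟩ := exists_weak_limit hp hu hρ
  -- The periodic extension from `(0, 2π]`, the set over which the interval integrals run, so no
  -- integral changes.
  set f : ℝ → ℂ := fun θ => f₀ (toIocMod Real.two_pi_pos 0 θ) with hfd
  have hfp : Function.Periodic f (2 * π) := fun θ => by
    simp only [hfd]; rw [toIocMod_add_right]
  have hfeq : ∀ θ ∈ Ioc (0 : ℝ) (2 * π), f θ = f₀ θ := fun θ hθ => by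
    simp only [hfd]; rw [(toIocMod_eq_self Real.two_pi_pos).2 (by simpa using hθ)]
  have hf : IntervalIntegrable f volume 0 (2 * π) := by
    refine hf₀.congr ?_
    intro θ hθ
    rw [uIoc_of_le Real.two_pi_pos.le] at hθ
    exact (hfeq θ hθ).symm
  refine ⟨f, hfp, hf, ?_⟩
  have hpI := isAlphaHarmonic_pInt α hf
  have main : ∀ (n : ℤ) (r : ℝ), r ∈ Ico (0 : ℝ) 1 →
      ∫ θ in (0 : ℝ)..(2 * π), Complex.exp (-(n * θ * Complex.I)) * u (polar r θ)
      = (∫ t in (0 : ℝ)..(2 * π), Complex.exp (-(n * t * Complex.I)) * f t)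
        * pInt α (fun t => Complex.exp (n * t * Complex.I)) r := by
    intro n r hr
    set c := ∫ t in (0 : ℝ)..(2 * π), Complex.exp (-(n * t * Complex.I)) * f t with hc
    have hc' : c = ∫ t in (0 : ℝ)..(2 * π), Complex.exp (-(n * t * Complex.I)) * f₀ t := by
      rw [hc]
      refine intervalIntegral.integral_congr_ae (Eventually.of_forall fun t ht => ?_)
      rw [uIoc_of_le Real.two_pi_pos.le] at ht
      rw [hfeq t ht]
    -- The `n`-th mode of `u` minus the mode predicted by `f`. It is α-harmonic and homogeneous, and
    -- it tends to zero along `ρ`; monotonicity of its modulus then forces it to vanish at every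
    -- radius.
    set w : ℂ → ℂ := fun z => rotAvg u (fun t => Complex.exp (n * t * Complex.I)) z
      - c * pInt α (fun t => Complex.exp (n * t * Complex.I)) z with hw
    have hwα : IsAlphaHarmonic α w :=
      (hu.1.rotAvg ((continuous_exp_int n).intervalIntegrable _ _)).sub_const_mul
        (isAlphaHarmonic_pInt α ((continuous_exp_int n).intervalIntegrable _ _)) c
    have hmono := norm_sq_monotoneOn_of_homogeneous hwα (n := n) (by
      intro z _ t
      simp only [hw]
      rw [rotAvg_exp_rot, pInt_exp, pInt_exp, rotAvg_exp_rot]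
      push_cast
      ring)
    have hwlim : Tendsto (fun j => ‖w (ρ j)‖ ^ 2) (hyperfilter ℕ) (𝓝 0) := by
      have h1 := hlim n
      have h2 := ((tendsto_pInt_exp hα h0 n).comp hρ1).const_mul c
      rw [← hc'] at h1
      have h3 := ((h1.sub h2).norm).pow 2
      simp only [mul_one, sub_self, norm_zero, ne_eq, OfNat.ofNat_ne_zero, not_false_eq_true,
        zero_pow] at h3
      refine h3.congr fun j => ?_
      simp only [hw, rotAvg_exp_ofReal, Function.comp_apply]
    have hw0 : ‖w r‖ ^ 2 ≤ 0 := by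
      refine ge_of_tendsto hwlim ?_
      have : ∀ᶠ x in 𝓝[<] (1 : ℝ), x ∈ Ioo r 1 := Ioo_mem_nhdsLT hr.2
      filter_upwards [hρ1.eventually this] with j hj
      exact hmono hr (hρ j) hj.1.le
    have hw1 : w r = 0 := by
      have := le_antisymm hw0 (sq_nonneg _)
      simpa using this
    simp only [hw, rotAvg_exp_ofReal] at hw1
    exact sub_eq_zero.1 hw1
  intro z hz
  rw [mem_ball_zero_iff] at hz
  have hr : |‖z‖| < 1 := by rwa [abs_norm]
  have hzp : polar ‖z‖ z.arg = z := by
    rw [polar]; exact Complex.norm_mul_exp_arg_mul_I z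
  have hzero := eq_zero_of_fourier_eq_zero
    (d := fun θ => u (polar ‖z‖ θ) - pInt α f (polar ‖z‖ θ))
    ((hu.1.continuous_polar hr).sub (hpI.continuous_polar hr))
    (fun θ => by
      have := polar_periodic ‖z‖ θ
      simp only [this]) (fun n => by
      simp only [mul_sub]
      rw [intervalIntegral.integral_sub, main n ‖z‖ ⟨norm_nonneg _, hz⟩, fourier_pInt hf hr n,
        sub_self]
      · exact (Continuous.mul (by fun_prop) (hu.1.continuous_polar hr)).intervalIntegrable _ _
      · exact (Continuous.mul (by fun_prop) (hpI.continuous_polar hr)).intervalIntegrable _ _)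
    z.arg
  rw [hzp] at hzero
  exact sub_eq_zero.1 hzero

/-! ### Boundary values -/

theorem setLIntegral_Ioc_of_periodic {F : ℝ → ℝ≥0∞} (hF : Function.Periodic F (2 * π)) (a b : ℝ) :
    ∫⁻ t in Ioc a (a + 2 * π), F t = ∫⁻ t in Ioc b (b + 2 * π), F t := by
  refine (isAddFundamentalDomain_Ioc Real.two_pi_pos a).setLIntegral_eq
    (isAddFundamentalDomain_Ioc Real.two_pi_pos b) F ?_
  rintro ⟨g, hg⟩ x
  obtain ⟨n, rfl⟩ := AddSubgroup.mem_zmultiples_iff.1 hg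
  have := (hF.zsmul n) x
  rw [AddSubgroup.mk_vadd, vadd_eq_add, add_comm]
  exact this

theorem setLIntegral_comp_sub_left_of_periodic {F : ℝ → ℝ≥0∞} (hF : Function.Periodic F (2 * π))
    (s : ℝ) : ∫⁻ t in Ioc 0 (2 * π), F (s - t) = ∫⁻ t in Ioc 0 (2 * π), F t := by
  have h1 := (Measure.measurePreserving_sub_left volume s).setLIntegral_comp_emb
    (Homeomorph.subLeft s).measurableEmbedding F (Ioc 0 (2 * π))
  have h2 : (fun t => s - t) '' Ioc 0 (2 * π) = Ico (s - 2 * π) s := by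
    simp
  rw [h2, restrict_Ico_eq_restrict_Ioc] at h1
  have h3 := setLIntegral_Ioc_of_periodic hF (s - 2 * π) 0
  rw [sub_add_cancel, zero_add] at h3
  rw [← h3, ← h1]

theorem MemHardy.exists_boundary {α p : ℝ} (hα : -1 < α) (h0 : α ≤ 0) (hp : 1 < p) {u : ℂ → ℂ}
    (hu : MemHardy α p u) : ∃ f : ℝ → ℂ, Function.Periodic f (2 * π) ∧
      IntervalIntegrable f volume 0 (2 * π) ∧ (∀ z ∈ Metric.ball (0 : ℂ) 1, u z = pInt α f z) ∧
      ∀ᵐ θ : ℝ, Tendsto (fun r : ℝ => u (polar r θ)) (𝓝[<] 1) (𝓝 (f θ)) := by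
  obtain ⟨f, hfp, hf, he⟩ := exists_pInt_eq hα h0 hp hu
  refine ⟨f, hfp, hf, he, ?_⟩
  filter_upwards [ae_tendsto_pInt hα h0 hfp hf] with θ hθ
  refine hθ.congr' ?_
  filter_upwards [Ioo_mem_nhdsLT (show (0 : ℝ) < 1 by norm_num)] with r hr
  exact (he _ (polar_mem_ball (abs_lt.2 ⟨by linarith [hr.1], hr.2⟩) θ)).symm

theorem radialLimit_eq {u : ℂ → ℂ} {θ : ℝ} {a : ℂ}
    (h : Tendsto (fun r : ℝ => u (polar r θ)) (𝓝[<] 1) (𝓝 a)) : radialLimit u θ = a :=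
  h.limUnder_eq

/-- Fatou's lemma along a sequence of radii, using the bound on the means. -/
theorem MemHardy.lintegral_rpow_lt_top {α p : ℝ} (hp : 1 < p) {u : ℂ → ℂ} (hu : MemHardy α p u)
    {f : ℝ → ℂ} (hf : ∀ᵐ θ : ℝ, Tendsto (fun r : ℝ => u (polar r θ)) (𝓝[<] 1) (𝓝 (f θ))) :
    ∫⁻ θ in Ioc 0 (2 * π), ‖f θ‖ₑ ^ p < ∞ := by
  obtain ⟨K, -, hK⟩ := hu.exists_integral_le hp
  obtain ⟨ρ, -, hρ, hρt⟩ := exists_seq_strictMono_tendsto' (show (0 : ℝ) < 1 by norm_num)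
  have hρ1 : Tendsto ρ atTop (𝓝[<] 1) :=
    tendsto_nhdsWithin_iff.2 ⟨hρt, Eventually.of_forall fun j => (hρ j).2⟩
  have habs : ∀ j, |ρ j| < 1 := fun j => abs_lt.2 ⟨by linarith [(hρ j).1], (hρ j).2⟩
  have hc : ∀ j, Continuous fun θ => u (polar (ρ j) θ) := fun j => hu.1.continuous_polar (habs j)
  have hb : ∀ j, ∫⁻ θ in Ioc 0 (2 * π), ‖u (polar (ρ j) θ)‖ₑ ^ p ≤ ENNReal.ofReal K := by
    intro j
    have hcp : Continuous fun θ => ‖u (polar (ρ j) θ)‖ ^ p :=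
      (hc j).norm.rpow_const fun _ => Or.inr (by linarith)
    have h1 := hK (ρ j) ⟨(hρ j).1.le, (hρ j).2⟩
    rw [intervalIntegral.integral_of_le Real.two_pi_pos.le] at h1
    refine le_trans (le_of_eq ?_) (ENNReal.ofReal_le_ofReal h1)
    rw [ofReal_integral_eq_lintegral_ofReal]
    · refine lintegral_congr fun θ => ?_
      rw [← ENNReal.ofReal_rpow_of_nonneg (norm_nonneg _) (by linarith), ofReal_norm]
    · exact (hcp.integrableOn_Icc).mono_set Ioc_subset_Icc_self
    · exact Eventually.of_forall fun _ => Real.rpow_nonneg (norm_nonneg _) _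
  have hlim : ∀ᵐ θ ∂(volume.restrict (Ioc 0 (2 * π))),
      liminf (fun j => ‖u (polar (ρ j) θ)‖ₑ ^ p) atTop = ‖f θ‖ₑ ^ p := by
    filter_upwards [ae_restrict_of_ae hf] with θ hθ
    have h2 : Continuous fun x : ℝ≥0∞ => x ^ p := ENNReal.continuous_rpow_const
    exact Tendsto.liminf_eq ((h2.tendsto _).comp ((hθ.comp hρ1).enorm))
  rw [← lintegral_congr_ae hlim]
  have hm : ∀ j, AEMeasurable (fun θ => ‖u (polar (ρ j) θ)‖ₑ ^ p)
      (volume.restrict (Ioc 0 (2 * π))) := fun j =>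
    ((hc j).measurable.enorm.pow_const p).aemeasurable
  exact ((lintegral_liminf_le' hm).trans ((liminf_le_liminf (Eventually.of_forall hb)).trans_eq
    (liminf_const _))).trans_lt ENNReal.ofReal_lt_top

theorem MemHardy.memLp_boundary {α p : ℝ} (hp : 1 < p) {u : ℂ → ℂ}
    (hu : MemHardy α p u) {f : ℝ → ℂ} (hfi : IntervalIntegrable f volume 0 (2 * π))
    (hf : ∀ᵐ θ : ℝ, Tendsto (fun r : ℝ => u (polar r θ)) (𝓝[<] 1) (𝓝 (f θ))) :
    MemLp f (ENNReal.ofReal p) (volume.restrict (Ioc 0 (2 * π))) := by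
  refine ⟨((intervalIntegrable_iff_integrableOn_Ioc_of_le Real.two_pi_pos.le).1
    hfi).aestronglyMeasurable, ?_⟩
  rw [eLpNorm_lt_top_iff_lintegral_rpow_enorm_lt_top (by simp; linarith) ENNReal.ofReal_ne_top,
    ENNReal.toReal_ofReal (by linarith)]
  exact hu.lintegral_rpow_lt_top hp hf

/-! ### The angular test inequality -/

theorem sec_pos {b : ℝ} (hb0 : 0 ≤ b) (hb1 : b < 1) : 0 < sec (π * b / 2) := by
  rw [sec, one_div, inv_pos]
  apply Real.cos_pos_of_mem_Ioo
  constructor <;> nlinarith [Real.pi_pos]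

/-- In the right half-plane the argument of `z^{-b}` stays within `πb/2` of zero, so its real part
is at least `cos(πb/2)` times its modulus. This is the source of the secant in the constant. -/
theorem norm_rpow_neg_le_sec_mul_re {b : ℝ} (hb0 : 0 ≤ b) (hb1 : b < 1) {z : ℂ} (hz : 0 < z.re) :
    ‖z‖ ^ (-b) ≤ sec (π * b / 2) * (z ^ (-b : ℂ)).re := by
  have hz0 : z ≠ 0 := fun h => by simp [h] at hz
  have harg : |z.arg| < π / 2 := by
    rw [Complex.abs_arg_lt_pi_div_two_iff]; exact Or.inl hz
  have hcos : Real.cos (π * b / 2) ≤ Real.cos (z.arg * -b) := by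
    rw [← Real.cos_abs (z.arg * -b), abs_mul, abs_neg, abs_of_nonneg hb0]
    apply Real.cos_le_cos_of_nonneg_of_le_pi (by positivity)
    · nlinarith [Real.pi_pos]
    · nlinarith [abs_nonneg z.arg]
  have h1 : (z ^ (-b : ℂ)).re = ‖z‖ ^ (-b) * Real.cos (z.arg * -b) := by
    have := Complex.cpow_ofReal_re z (-b)
    rwa [Complex.ofReal_neg] at this
  have hpos : 0 < Real.cos (π * b / 2) := by
    have := sec_pos hb0 hb1
    rwa [sec, one_div, inv_pos] at this
  rw [h1, sec, one_div, inv_mul_eq_div, le_div_iff₀ hpos]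
  exact mul_le_mul_of_nonneg_left hcos (Real.rpow_nonneg (norm_nonneg _) _)

theorem cConst_zero : cConst 0 = 1 := by simp [cConst]

theorem poissonKernel_eq_pk (r θ : ℝ) :
    poissonKernel 0 (r : ℂ) (polar 1 θ) = pk 0 (polar r θ) := by
  rw [poissonKernel_def, pk_polar, cConst_zero, ← norm_sq_one_sub_polar]
  have h1 : ‖polar 1 θ - (r : ℂ)‖ = ‖1 - polar r θ‖ := by
    have e : polar 1 θ - r = polar 1 θ * (1 - polar r (-θ)) := by
      have : Complex.exp (θ * Complex.I) * Complex.exp (-(θ * Complex.I)) = 1 := by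
        rw [← Complex.exp_add]; simp
      simp only [polar]
      push_cast
      rw [neg_mul]
      linear_combination (r : ℂ) * this
    rw [e, norm_mul, norm_polar, abs_one, one_mul]
    have := norm_sq_one_sub_polar r (-θ)
    rw [Real.cos_neg, ← norm_sq_one_sub_polar] at this
    exact (sq_eq_sq₀ (norm_nonneg _) (norm_nonneg _)).1 this
  simp only [sub_zero, norm_polar, Complex.norm_real, Real.norm_eq_abs, h1, abs_one, sq_abs]
  rw [zero_add, Real.rpow_one, zero_add, neg_div, div_self two_ne_zero, Real.rpow_neg_one]
  ring

/-- Replace `|H|^{-b}` by `sec(πb/2) Re H^{-b}`, which the classical Poisson formula evaluates at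
`r`, and bound the real part there by the modulus. -/
theorem lintegral_poisson_rpow_neg_le {b : ℝ} (hb0 : 0 ≤ b) (hb1 : b < 1) {H : ℂ → ℂ}
    (hc : ContinuousOn H (Metric.closedBall 0 1)) (hd : DifferentiableOn ℂ H (Metric.ball 0 1))
    (hre : ∀ z ∈ Metric.ball (0 : ℂ) 1, 0 < (H z).re) {r : ℝ} (hr : |r| < 1) :
    ∫⁻ θ in Ioc 0 (2 * π), ENNReal.ofReal (pk 0 (polar r θ)) * ‖H (polar 1 θ)‖ₑ ^ (-b)
      ≤ ENNReal.ofReal (2 * π * sec (π * b / 2) * ‖H r‖ ^ (-b)) := by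
  obtain ⟨ρ, -, hρ, hρt⟩ := exists_seq_strictMono_tendsto' (show (0 : ℝ) < 1 by norm_num)
  have hmap : ∀ j, ∀ z ∈ Metric.closedBall (0 : ℂ) 1, (ρ j : ℂ) * z ∈ Metric.ball (0 : ℂ) 1 := by
    intro j z hz
    rw [mem_closedBall_zero_iff] at hz
    rw [mem_ball_zero_iff, norm_mul, Complex.norm_real, Real.norm_eq_abs, abs_of_pos (hρ j).1]
    nlinarith [(hρ j).1, (hρ j).2, norm_nonneg z]
  have hsec := sec_pos hb0 hb1
  -- `H` may vanish on the unit circle, so the argument is run for the dilates `H(ρ_j z)`, and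
  -- Fatou's lemma removes the dilation.
  set F : ℕ → ℂ → ℂ := fun j z => H (ρ j * z) ^ (-b : ℂ) with hF
  have hslit : ∀ j, ∀ z ∈ Metric.closedBall (0 : ℂ) 1, H (ρ j * z) ∈ Complex.slitPlane :=
    fun j z hz => Or.inl (hre _ (hmap j z hz))
  have hFc : ∀ j, ContinuousOn (F j) (Metric.closedBall 0 1) := fun j => by
    refine ContinuousOn.cpow_const ?_ (hslit j)
    exact hc.comp (by fun_prop) fun z hz => Metric.ball_subset_closedBall (hmap j z hz)
  have hFd : ∀ j, DifferentiableOn ℂ (F j) (Metric.ball 0 1) := fun j => by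
    refine DifferentiableOn.cpow_const ?_ fun z hz => hslit j z (Metric.ball_subset_closedBall hz)
    exact hd.comp (by fun_prop) fun z hz => hmap j z (Metric.ball_subset_closedBall hz)
  have hcirc : ∀ θ : ℝ, polar 1 θ ∈ Metric.closedBall (0 : ℂ) 1 := fun θ => by
    rw [mem_closedBall_zero_iff, norm_polar, abs_one]
  have hrb : (r : ℂ) ∈ Metric.ball (0 : ℂ) 1 := by
    rwa [mem_ball_zero_iff, Complex.norm_real, Real.norm_eq_abs]
  have hP : ∀ j, ∫ θ in (0 : ℝ)..(2 * π), pk 0 (polar r θ) * (F j (polar 1 θ)).re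
      = 2 * π * (F j r).re := by
    intro j
    have h := DiffContOnCl.circleAverage_poissonKernel_smul (f := F j) (R := 1) (c := 0)
      ⟨hFd j, by rw [closure_ball _ one_ne_zero]; exact hFc j⟩ hrb
    rw [circleAverage_def] at h
    have e : ∀ θ : ℝ, circleMap 0 1 θ = polar 1 θ := fun θ => by simp [circleMap, polar]
    simp only [Pi.smul_apply', e, poissonKernel_eq_pk] at h
    have hi : IntervalIntegrable (fun θ => pk 0 (polar r θ) • F j (polar 1 θ)) volume
        0 (2 * π) := by
      refine Continuous.intervalIntegrable ?_ _ _
      exact (continuous_pk_polar hr).smul ((hFc j).comp_continuous (continuous_polar 1) hcirc)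
    have h2 := congrArg Complex.re h
    rw [Complex.smul_re, smul_eq_mul] at h2
    rw [← h2, ← mul_assoc, mul_inv_cancel₀ Real.two_pi_pos.ne', one_mul,
      intervalIntegral.integral_of_le Real.two_pi_pos.le,
      intervalIntegral.integral_of_le Real.two_pi_pos.le]
    have h3 := (Complex.reCLM.integral_comp_comm
      ((intervalIntegrable_iff_integrableOn_Ioc_of_le Real.two_pi_pos.le).1 hi)).symm
    simp only [Complex.reCLM_apply] at h3
    rw [h3]
    congr 1
    ext θ
    rw [Complex.smul_re, smul_eq_mul]
  have hbd : ∀ j, ∫⁻ θ in Ioc 0 (2 * π), ENNReal.ofReal (pk 0 (polar r θ))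
      * ‖H (polar (ρ j) θ)‖ₑ ^ (-b)
      ≤ ENNReal.ofReal (2 * π * sec (π * b / 2) * ‖H (ρ j * r)‖ ^ (-b)) := by
    intro j
    have hpol : ∀ θ, polar (ρ j) θ = ρ j * polar 1 θ := fun θ => by simp [polar]
    have hpt : ∀ θ, ENNReal.ofReal (pk 0 (polar r θ)) * ‖H (polar (ρ j) θ)‖ₑ ^ (-b)
        ≤ ENNReal.ofReal (sec (π * b / 2) * (pk 0 (polar r θ) * (F j (polar 1 θ)).re)) := by
      intro θ
      have hz := hre _ (hmap j _ (hcirc θ))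
      have hz0 : 0 < ‖H (ρ j * polar 1 θ)‖ := lt_of_lt_of_le hz (Complex.re_le_norm _)
      rw [hpol, ← ofReal_norm, ENNReal.ofReal_rpow_of_pos hz0, ← ENNReal.ofReal_mul
        (pk_polar_pos (by norm_num) hr θ).le]
      refine ENNReal.ofReal_le_ofReal ?_
      rw [mul_left_comm]
      exact mul_le_mul_of_nonneg_left (norm_rpow_neg_le_sec_mul_re hb0 hb1 hz)
        (pk_polar_pos (by norm_num) hr θ).le
    have hcont : Continuous fun θ => sec (π * b / 2) * (pk 0 (polar r θ) * (F j (polar 1 θ)).re) :=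
      continuous_const.mul ((continuous_pk_polar hr).mul (Complex.continuous_re.comp
        ((hFc j).comp_continuous (continuous_polar 1) hcirc)))
    refine (lintegral_mono hpt).trans ?_
    rw [← ofReal_integral_eq_lintegral_ofReal]
    · rw [← intervalIntegral.integral_of_le Real.two_pi_pos.le,
        intervalIntegral.integral_const_mul, hP]
      refine ENNReal.ofReal_le_ofReal ?_
      have h1 : (F j r).re ≤ ‖H (ρ j * r)‖ ^ (-b) := by
        refine (Complex.re_le_norm _).trans (le_of_eq ?_)
        simp only [hF]
        rw [← Complex.ofReal_neg, Complex.norm_cpow_real]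
      nlinarith [mul_le_mul_of_nonneg_left h1 (mul_nonneg Real.two_pi_pos.le hsec.le)]
    · exact (hcont.integrableOn_Icc).mono_set Ioc_subset_Icc_self
    · refine Eventually.of_forall fun θ => ?_
      have hz := hre _ (hmap j _ (hcirc θ))
      have h0 : 0 ≤ sec (π * b / 2) * (F j (polar 1 θ)).re :=
        (Real.rpow_nonneg (norm_nonneg _) _).trans (norm_rpow_neg_le_sec_mul_re hb0 hb1 hz)
      have := mul_nonneg (pk_polar_pos (α := 0) (by norm_num) hr θ).le h0
      simp only [Pi.zero_apply]
      linarith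
  have hcr : Tendsto (fun j => (ρ j : ℂ)) atTop (𝓝 1) := by
    have := (Complex.continuous_ofReal.tendsto _).comp hρt
    rwa [Complex.ofReal_one] at this
  have hlim1 : ∀ z ∈ Metric.closedBall (0 : ℂ) 1,
      Tendsto (fun j => H (ρ j * z)) atTop (𝓝 (H z)) := by
    intro z hz
    have h1 := (hc z hz).tendsto
    refine h1.comp (tendsto_nhdsWithin_iff.2 ⟨?_, Eventually.of_forall fun j =>
      Metric.ball_subset_closedBall (hmap j z hz)⟩)
    simpa using hcr.mul_const z
  have hlim : ∀ θ, liminf (fun j => ENNReal.ofReal (pk 0 (polar r θ))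
      * ‖H (polar (ρ j) θ)‖ₑ ^ (-b)) atTop
      = ENNReal.ofReal (pk 0 (polar r θ)) * ‖H (polar 1 θ)‖ₑ ^ (-b) := by
    intro θ
    have h2 : Continuous fun x : ℝ≥0∞ => x ^ (-b) := ENNReal.continuous_rpow_const
    have h3 := (h2.tendsto _).comp ((hlim1 _ (hcirc θ)).enorm)
    refine Tendsto.liminf_eq ?_
    have h4 := ENNReal.Tendsto.const_mul (a := ENNReal.ofReal (pk 0 (polar r θ))) h3
      (Or.inr ENNReal.ofReal_ne_top)
    refine h4.congr fun j => ?_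
    simp [polar]
  rw [← lintegral_congr hlim]
  refine (lintegral_liminf_le' fun j => ?_).trans ?_
  · refine Measurable.aemeasurable ?_
    refine ((continuous_pk_polar hr).measurable.ennreal_ofReal).mul ?_
    refine Measurable.pow_const ?_ _
    have : Continuous fun θ => H (polar (ρ j) θ) := by
      refine hc.comp_continuous (continuous_polar _) fun θ => ?_
      rw [mem_closedBall_zero_iff, norm_polar, abs_of_pos (hρ j).1]
      exact (hρ j).2.le
    exact this.measurable.enorm
  · have hHr : 0 < ‖H r‖ := lt_of_lt_of_le (hre _ hrb) (Complex.re_le_norm _)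
    have h1 : Tendsto (fun j => ENNReal.ofReal (2 * π * sec (π * b / 2) * ‖H (ρ j * r)‖ ^ (-b)))
        atTop (𝓝 (ENNReal.ofReal (2 * π * sec (π * b / 2) * ‖H r‖ ^ (-b)))) := by
      refine ENNReal.tendsto_ofReal (Tendsto.const_mul _ ?_)
      exact (hlim1 _ (Metric.ball_subset_closedBall hrb)).norm.rpow_const (Or.inl hHr.ne')
    rw [← h1.liminf_eq]
    exact liminf_le_liminf (Eventually.of_forall hbd)

/-- Log-convexity of Gamma at the midpoint of `1` and `1 + α`. -/
theorem cConst_le_one {α : ℝ} (hα : -1 < α) : cConst α ≤ 1 := by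
  have h := Real.Gamma_mul_add_mul_le_rpow_Gamma_mul_rpow_Gamma (s := 1) (t := 1 + α) (a := 1 / 2)
    (b := 1 / 2) one_pos (by linarith) (by norm_num) (by norm_num) (by norm_num)
  have hG : 0 < Real.Gamma (1 + α) := Real.Gamma_pos_of_pos (by linarith)
  have e : (1 / 2 : ℝ) * 1 + 1 / 2 * (1 + α) = α / 2 + 1 := by ring
  rw [e, Real.Gamma_one, Real.one_rpow, one_mul, ← Real.sqrt_eq_rpow] at h
  rw [cConst, div_le_one hG]
  have h0 : 0 ≤ Real.Gamma (α / 2 + 1) := (Real.Gamma_pos_of_pos (by linarith)).le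
  calc Real.Gamma (α / 2 + 1) ^ 2 ≤ √(Real.Gamma (1 + α)) ^ 2 := pow_le_pow_left₀ h0 h 2
    _ = Real.Gamma (1 + α) := Real.sq_sqrt hG.le

theorem ae_sin_sub_ne_zero (s : ℝ) : ∀ᵐ t : ℝ, Real.sin (s - t) ≠ 0 := by
  have hc : {t : ℝ | ¬ Real.sin (s - t) ≠ 0}.Countable := by
    refine (countable_range fun n : ℤ => s - n * π).mono fun t ht => ?_
    obtain ⟨n, hn⟩ := Real.sin_eq_zero_iff.1 (not_not.1 ht)
    exact ⟨n, by simp only; linarith⟩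
  exact hc.measure_zero volume

theorem ae_sin_ne_zero : ∀ᵐ t : ℝ, Real.sin t ≠ 0 := by
  filter_upwards [ae_sin_sub_ne_zero 0] with t ht
  simpa using ht

theorem norm_one_sub_polar_sq (θ : ℝ) : ‖1 - polar 1 θ ^ 2‖ = |2 * Real.sin θ| := by
  have h1 : polar 1 θ ^ 2 = polar 1 (2 * θ) := by
    simp only [polar, Complex.ofReal_one, one_mul]
    rw [← Complex.exp_nat_mul]; congr 1; push_cast; ring
  rw [h1, ← abs_of_nonneg (norm_nonneg (1 - polar 1 (2 * θ))), ← sq_eq_sq_iff_abs_eq_abs,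
    norm_sq_one_sub_polar, Real.cos_two_mul, Real.cos_sq']
  ring

theorem one_sub_mul_ne_zero {r : ℝ} (hr : |r| < 1) {z : ℂ} (hz : ‖z‖ ≤ 1) : 1 - r * z ≠ 0 := by
  intro h
  have h1 : (r : ℂ) * z = 1 := (sub_eq_zero.1 h).symm
  have h2 := congrArg norm h1
  rw [norm_mul, Complex.norm_real, Real.norm_eq_abs, norm_one] at h2
  nlinarith [abs_nonneg r, norm_nonneg z]

/-- The expression is `1 - w²` with `w = (z - r)/(1 - rz)`, a disk automorphism sending `r` to `0`;
hence `|w| < 1`. -/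
theorem re_moebius_pos {r : ℝ} (hr : |r| < 1) {z : ℂ} (hz : ‖z‖ < 1) :
    0 < ((1 - r ^ 2) * (1 - z ^ 2) / (1 - r * z) ^ 2 : ℂ).re := by
  have hne := one_sub_mul_ne_zero hr hz.le
  set w := (z - r) / (1 - r * z) with hw
  have e : ((1 - r ^ 2) * (1 - z ^ 2) / (1 - r * z) ^ 2 : ℂ) = 1 - w ^ 2 := by
    rw [hw]; field_simp; ring
  have hr2 : r ^ 2 < 1 := by rw [← sq_abs]; nlinarith [abs_nonneg r]
  have hw1 : ‖w‖ ^ 2 < 1 := by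
    rw [hw, norm_div, div_pow, div_lt_one (by positivity), ← Complex.normSq_eq_norm_sq,
      ← Complex.normSq_eq_norm_sq]
    have hz2 : Complex.normSq z < 1 := by
      rw [Complex.normSq_eq_norm_sq]; nlinarith [norm_nonneg z]
    rw [Complex.normSq_apply] at *
    simp only [Complex.normSq_apply, Complex.sub_re, Complex.sub_im, Complex.mul_re, Complex.mul_im,
      Complex.ofReal_re, Complex.ofReal_im, Complex.one_re, Complex.one_im]
    nlinarith [mul_pos (sub_pos.2 hr2) (sub_pos.2 hz2)]
  rw [e, Complex.sub_re, Complex.one_re]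
  have : (w ^ 2).re ≤ ‖w‖ ^ 2 := by rw [← norm_pow]; exact Complex.re_le_norm _
  linarith

theorem re_one_sub_sq_pos {z : ℂ} (hz : ‖z‖ < 1) : 0 < (1 - z ^ 2 : ℂ).re := by
  have := re_moebius_pos (r := 0) (by simp) hz
  simpa using this

theorem pk_polar_eq_mul {α r : ℝ} (hr : |r| < 1) (θ : ℝ) :
    pk α (polar r θ) = cConst α * (pk 0 (polar r θ)
      * ((1 - r ^ 2) ^ 2 / (1 - 2 * r * Real.cos θ + r ^ 2)) ^ (α / 2)) := by
  have hD := one_sub_two_mul_cos_pos hr θ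
  have hr2 : 0 < 1 - r ^ 2 := by rw [← sq_abs]; nlinarith [abs_nonneg r]
  rw [pk_polar, pk_polar, cConst_zero, one_mul]
  set A := 1 - r ^ 2
  set D := 1 - 2 * r * Real.cos θ + r ^ 2
  rw [Real.div_rpow (by positivity) hD.le, ← Real.rpow_natCast A 2, ← Real.rpow_mul hr2.le,
    div_eq_mul_inv (A ^ (((2 : ℕ) : ℝ) * (α / 2))), ← Real.rpow_neg hD.le]
  have h1 : A ^ (α + 1) = A ^ ((0 : ℝ) + 1) * A ^ (((2 : ℕ) : ℝ) * (α / 2)) := by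
    rw [← Real.rpow_add hr2]; congr 1; push_cast; ring
  have h2 : D ^ (-(α + 2) / 2) = D ^ (-((0 : ℝ) + 2) / 2) * D ^ (-(α / 2)) := by
    rw [← Real.rpow_add hD]; congr 1; ring
  rw [h1, h2]; ring

/-- `P_α` is `c_α P_0` times the power `α/2` of `(1 - r²)²/|1 - r e^{iθ}|²`. Since `-2b ≤ α ≤ 0`,
that power lies between the exponents `-b` and `0`, and the weighted arithmetic-geometric mean
inequality with weight `-α/(2b)` interpolates. Each endpoint is the boundary modulus of a
holomorphic function with positive real part. -/
theorem pk_polar_mul_rpow_le {α b r : ℝ} (hα : -1 < α) (h0 : α ≤ 0) (hb : 0 < b)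
    (hab : -(2 * b) ≤ α) (hr : |r| < 1) {θ : ℝ} (hθ : Real.sin θ ≠ 0) :
    pk α (polar r θ) * |2 * Real.sin θ| ^ (-b) ≤
      (-α / (2 * b) * (1 - r ^ 2) ^ (-b)) * (pk 0 (polar r θ)
        * ((1 - r ^ 2) * |2 * Real.sin θ| / (1 - 2 * r * Real.cos θ + r ^ 2)) ^ (-b))
      + (1 - -α / (2 * b)) * (pk 0 (polar r θ) * |2 * Real.sin θ| ^ (-b)) := by
  have hD := one_sub_two_mul_cos_pos hr θ
  have hr2 : 0 < 1 - r ^ 2 := by rw [← sq_abs]; nlinarith [abs_nonneg r]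
  have hP := (pk_polar_pos (α := 0) (by norm_num) hr θ).le
  have hS : 0 < |2 * Real.sin θ| := abs_pos.2 (mul_ne_zero two_ne_zero hθ)
  rw [pk_polar_eq_mul hr]
  set A := 1 - r ^ 2
  set D := 1 - 2 * r * Real.cos θ + r ^ 2
  set S := |2 * Real.sin θ|
  set P := pk 0 (polar r θ)
  set μ := -α / (2 * b) with hμ
  have hμ0 : 0 ≤ μ := div_nonneg (by linarith) (by linarith)
  have hμ1 : μ ≤ 1 := by rw [hμ, div_le_one (by linarith)]; linarith
  have hK : 0 < A ^ 2 / D := by positivity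
  have h1 : (A ^ 2 / D) ^ (α / 2) ≤ μ * (A ^ 2 / D) ^ (-b) + (1 - μ) := by
    have h := Real.geom_mean_le_arith_mean2_weighted hμ0 (by linarith : 0 ≤ 1 - μ)
      (Real.rpow_nonneg hK.le (-b)) zero_le_one (by ring)
    rw [← Real.rpow_mul hK.le, Real.one_rpow, mul_one, mul_one] at h
    have e : -b * μ = α / 2 := by rw [hμ]; field_simp
    rwa [e] at h
  have h2 : (A * S / D) ^ (-b) * A ^ (-b) = (A ^ 2 / D) ^ (-b) * S ^ (-b) := by
    rw [← Real.mul_rpow (by positivity) hr2.le, ← Real.mul_rpow hK.le hS.le]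
    congr 1; ring
  have hSb := Real.rpow_nonneg hS.le (-b)
  have hPK : 0 ≤ P * (A ^ 2 / D) ^ (α / 2) := mul_nonneg hP (Real.rpow_nonneg hK.le _)
  calc cConst α * (P * (A ^ 2 / D) ^ (α / 2)) * S ^ (-b)
      ≤ 1 * (P * (A ^ 2 / D) ^ (α / 2)) * S ^ (-b) := by
        exact mul_le_mul_of_nonneg_right (mul_le_mul_of_nonneg_right (cConst_le_one hα) hPK) hSb
    _ ≤ 1 * (P * (μ * (A ^ 2 / D) ^ (-b) + (1 - μ))) * S ^ (-b) := by
        refine mul_le_mul_of_nonneg_right ?_ hSb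
        rw [one_mul, one_mul]
        exact mul_le_mul_of_nonneg_left h1 hP
    _ = μ * P * ((A ^ 2 / D) ^ (-b) * S ^ (-b)) + (1 - μ) * (P * S ^ (-b)) := by ring
    _ = _ := by rw [← h2]; ring

/-- On the circle `|1 - z²| = |2 sin θ|`. The functions `H₁ = 1 - z²` and `H₂ = (1 - r²)(1 - z²)/(1
- rz)²` take the values `1 - r²` and `1` at `r`, so both endpoints of the interpolation contribute
the same bound and the weights add up to one. -/
theorem lintegral_pk_mul_rpow_sin_le {α b r : ℝ} (hα : -1 < α) (h0 : α ≤ 0) (hb : 0 < b)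
    (hb1 : b < 1) (hab : -(2 * b) ≤ α) (hr : |r| < 1) :
    ∫⁻ θ in Ioc 0 (2 * π), ENNReal.ofReal (pk α (polar r θ))
        * ENNReal.ofReal |2 * Real.sin θ| ^ (-b)
      ≤ ENNReal.ofReal (2 * π * sec (π * b / 2) * (1 - r ^ 2) ^ (-b)) := by
  have hr2 : 0 < 1 - r ^ 2 := by rw [← sq_abs]; nlinarith [abs_nonneg r]
  set μ := -α / (2 * b) with hμ
  have hμ0 : 0 ≤ μ := div_nonneg (by linarith) (by linarith)
  have hμ1 : μ ≤ 1 := by rw [hμ, div_le_one (by linarith)]; linarith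
  have hsec := sec_pos hb.le hb1
  set H₂ : ℂ → ℂ := fun z => (1 - r ^ 2) * (1 - z ^ 2) / (1 - r * z) ^ 2 with hH₂
  set H₁ : ℂ → ℂ := fun z => 1 - z ^ 2 with hH₁
  have hH₂d : ∀ z, ‖z‖ ≤ 1 → DifferentiableAt ℂ H₂ z := fun z hz => by
    refine DifferentiableAt.div (by fun_prop) (by fun_prop) ?_
    exact pow_ne_zero 2 (one_sub_mul_ne_zero hr hz)
  have T₂ := lintegral_poisson_rpow_neg_le hb.le hb1 (H := H₂)
    (fun z hz => (hH₂d z (mem_closedBall_zero_iff.1 hz)).continuousAt.continuousWithinAt)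
    (fun z hz => (hH₂d z (mem_ball_zero_iff.1 hz).le).differentiableWithinAt)
    (fun z hz => re_moebius_pos hr (mem_ball_zero_iff.1 hz)) hr
  have T₁ := lintegral_poisson_rpow_neg_le hb.le hb1 (H := H₁)
    (by fun_prop) (by fun_prop) (fun z hz => re_one_sub_sq_pos (mem_ball_zero_iff.1 hz)) hr
  have n₁ : ‖H₁ r‖ = 1 - r ^ 2 := by
    simp only [hH₁]
    rw [← abs_of_pos hr2, ← Real.norm_eq_abs, ← Complex.norm_real]
    push_cast; rfl
  have n₂ : ‖H₂ r‖ = 1 := by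
    have h1 : (1 - (r : ℂ) ^ 2) ≠ 0 := by exact_mod_cast hr2.ne'
    simp only [hH₂]
    rw [← pow_two, ← pow_two, div_self (pow_ne_zero 2 h1), norm_one]
  rw [n₁] at T₁
  rw [n₂, Real.one_rpow, mul_one] at T₂
  have p₁ : ∀ θ, ‖H₁ (polar 1 θ)‖ = |2 * Real.sin θ| := norm_one_sub_polar_sq
  have p₂ : ∀ θ, ‖H₂ (polar 1 θ)‖
      = (1 - r ^ 2) * |2 * Real.sin θ| / (1 - 2 * r * Real.cos θ + r ^ 2) := by
    intro θ
    simp only [hH₂]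
    rw [norm_div, norm_mul, norm_one_sub_polar_sq, norm_pow]
    have e1 : (r : ℂ) * polar 1 θ = polar r θ := by simp [polar]
    have e2 : ‖(1 - (r : ℂ) ^ 2)‖ = 1 - r ^ 2 := by simpa [hH₁] using n₁
    rw [e1, norm_sq_one_sub_polar, e2]
  have hpt : ∀ᵐ θ ∂(volume.restrict (Ioc 0 (2 * π))), ENNReal.ofReal (pk α (polar r θ))
        * ENNReal.ofReal |2 * Real.sin θ| ^ (-b)
      ≤ ENNReal.ofReal (μ * (1 - r ^ 2) ^ (-b))
          * (ENNReal.ofReal (pk 0 (polar r θ)) * ‖H₂ (polar 1 θ)‖ₑ ^ (-b))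
        + ENNReal.ofReal (1 - μ)
          * (ENNReal.ofReal (pk 0 (polar r θ)) * ‖H₁ (polar 1 θ)‖ₑ ^ (-b)) := by
    filter_upwards [ae_restrict_of_ae ae_sin_ne_zero] with θ hθ
    have hS : 0 < |2 * Real.sin θ| := abs_pos.2 (mul_ne_zero two_ne_zero hθ)
    have hD := one_sub_two_mul_cos_pos hr θ
    have hP0 := (pk_polar_pos (α := 0) (by norm_num) hr θ).le
    have h2pos : 0 < (1 - r ^ 2) * |2 * Real.sin θ| / (1 - 2 * r * Real.cos θ + r ^ 2) := by
      positivity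
    rw [← ofReal_norm, ← ofReal_norm, p₁, p₂, ENNReal.ofReal_rpow_of_pos hS,
      ENNReal.ofReal_rpow_of_pos h2pos, ← ENNReal.ofReal_mul (pk_polar_pos hα hr θ).le,
      ← ENNReal.ofReal_mul hP0, ← ENNReal.ofReal_mul hP0,
      ← ENNReal.ofReal_mul (mul_nonneg hμ0 (Real.rpow_nonneg hr2.le _)),
      ← ENNReal.ofReal_mul (by linarith), ← ENNReal.ofReal_add]
    · exact ENNReal.ofReal_le_ofReal (pk_polar_mul_rpow_le hα h0 hb hab hr hθ)
    · exact mul_nonneg (mul_nonneg hμ0 (Real.rpow_nonneg hr2.le _))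
        (mul_nonneg hP0 (Real.rpow_nonneg h2pos.le _))
    · exact mul_nonneg (by linarith) (mul_nonneg hP0 (Real.rpow_nonneg hS.le _))
  have hm : Measurable fun θ => ENNReal.ofReal (pk 0 (polar r θ)) * ‖H₁ (polar 1 θ)‖ₑ ^ (-b) := by
    have h1 : Continuous fun θ => H₁ (polar 1 θ) :=
      continuous_const.sub ((continuous_polar 1).pow 2)
    exact ((continuous_pk_polar hr).measurable.ennreal_ofReal).mul
      (h1.measurable.enorm.pow_const _)
  refine (lintegral_mono_ae hpt).trans ?_
  rw [lintegral_add_right _ (hm.const_mul _), lintegral_const_mul' _ _ ENNReal.ofReal_ne_top,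
    lintegral_const_mul' _ _ ENNReal.ofReal_ne_top]
  refine (add_le_add (mul_le_mul_right T₂ _) (mul_le_mul_right T₁ _)).trans (le_of_eq ?_)
  have hA := Real.rpow_nonneg hr2.le (-b)
  have hπs : 0 ≤ 2 * π * sec (π * b / 2) := mul_nonneg Real.two_pi_pos.le hsec.le
  rw [← ENNReal.ofReal_mul (mul_nonneg hμ0 hA), ← ENNReal.ofReal_mul (by linarith),
    ← ENNReal.ofReal_add (mul_nonneg (mul_nonneg hμ0 hA) hπs)
      (mul_nonneg (by linarith) (mul_nonneg hπs hA))]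
  congr 1
  ring

/-! ### The radial test inequality -/

theorem lintegral_Ioo_radius_substitution {c s : ℝ} (hc : 0 < c) (hs : 0 < s) (G : ℝ → ℝ≥0∞) :
    ∫⁻ r in Ioo (-1) 1, G r = ∫⁻ v in Ioi 0, ENNReal.ofReal (2 * (c * s) / (c * v + s) ^ 2)
      * G ((c * v - s) / (c * v + s)) := by
  have himg : (fun v : ℝ => (c * v - s) / (c * v + s)) '' Ioi 0 = Ioo (-1) 1 := by
    ext r
    constructor
    · rintro ⟨v, hv, rfl⟩
      have hv : 0 < v := hv
      have hD : 0 < c * v + s := by positivity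
      have : 0 < c * v := by positivity
      refine ⟨?_, ?_⟩
      · rw [lt_div_iff₀ hD]; linarith
      · rw [div_lt_one hD]; linarith
    · rintro ⟨h0, h1⟩
      have h2 : 0 < 1 - r := by linarith
      have h3 : 0 < 1 + r := by linarith
      refine ⟨s * (1 + r) / (c * (1 - r)), by simp only [mem_Ioi]; positivity, ?_⟩
      simp only
      field_simp
      ring
  have hinj : InjOn (fun v : ℝ => (c * v - s) / (c * v + s)) (Ioi 0) := by
    intro x hx y hy h
    have hx : 0 < x := hx
    have hy : 0 < y := hy
    simp only at h
    rw [div_eq_div_iff (by positivity) (by positivity)] at h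
    have : 2 * c * s * (x - y) = 0 := by linear_combination h
    have h2 : 2 * c * s ≠ 0 := by positivity
    exact sub_eq_zero.1 ((mul_eq_zero.1 this).resolve_left h2)
  have hder : ∀ v ∈ Ioi (0 : ℝ), HasDerivWithinAt (fun v : ℝ => (c * v - s) / (c * v + s))
      (2 * (c * s) / (c * v + s) ^ 2) (Ioi 0) v := by
    intro v hv
    have hv : 0 < v := hv
    have h1 : HasDerivAt (fun v : ℝ => c * v - s) c v := by
      simpa using ((hasDerivAt_id v).const_mul c).sub_const s
    have h2 : HasDerivAt (fun v : ℝ => c * v + s) c v := by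
      simpa using ((hasDerivAt_id v).const_mul c).add_const s
    refine ((h1.div h2 (by positivity)).congr_deriv ?_).hasDerivWithinAt
    congr 1; ring
  rw [← himg, lintegral_image_eq_lintegral_abs_deriv_mul measurableSet_Ioi hder hinj]
  refine setLIntegral_congr_fun measurableSet_Ioi fun v hv => ?_
  have hv : 0 < v := hv
  rw [abs_of_pos (by positivity)]

/-- With `c = cos(θ/2)` and `s = sin(θ/2)`, the Möbius change of radius turns `|1 - r e^{iθ}|²` into
a multiple of `1 + v²`. The angle survives only in the prefactor and in a power of `c v + s`. -/
theorem radius_integrand_eq {α g c s v : ℝ} (hc : 0 < c) (hs : 0 < s) (hcs : c ^ 2 + s ^ 2 = 1)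
    (hv : 0 < v) : 2 * (c * s) / (c * v + s) ^ 2
      * (cConst α * ((1 - ((c * v - s) / (c * v + s)) ^ 2) ^ (α + 1)
        * (1 - 2 * ((c * v - s) / (c * v + s)) * (c ^ 2 - s ^ 2)
          + ((c * v - s) / (c * v + s)) ^ 2) ^ (-(α + 2) / 2))
        * (1 - ((c * v - s) / (c * v + s)) ^ 2) ^ (-g))
      = cConst α * 2 ^ (α + 1) * (4 * (c * s)) ^ (-g)
        * (v ^ (α + 1 - g) * (1 + v ^ 2) ^ (-((α + 2) / 2))
          * (c * v + s) ^ (-(α + 2 - 2 * g))) := by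
  have hD0 : 0 < c * v + s := by positivity
  have e1 : 1 - ((c * v - s) / (c * v + s)) ^ 2 = 4 * (c * s) * v / (c * v + s) ^ 2 := by
    field_simp; ring
  have e2 : 1 - 2 * ((c * v - s) / (c * v + s)) * (c ^ 2 - s ^ 2)
      + ((c * v - s) / (c * v + s)) ^ 2 = (2 * (c * s) / (c * v + s)) ^ 2 * (1 + v ^ 2) := by
    have h1 : s ^ 2 = 1 - c ^ 2 := by linarith
    field_simp
    linear_combination (-2 * c ^ 2 * v ^ 2 - 2 * s ^ 2) * hcs
  rw [e1, e2]
  set D := c * v + s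
  set m := c * s with hm
  have hm0 : 0 < m := mul_pos hc hs
  have hY0 : 0 < 1 + v ^ 2 := by positivity
  have hA0 : 0 < 4 * m * v / D ^ 2 := by positivity
  have f1 : (4 * m * v / D ^ 2) ^ (α + 1) * (4 * m * v / D ^ 2) ^ (-g)
      = 2 ^ (2 * (α + 1 - g)) * m ^ (α + 1 - g) * v ^ (α + 1 - g) * D ^ (-(2 * (α + 1 - g))) := by
    rw [← Real.rpow_add hA0, ← sub_eq_add_neg, Real.div_rpow (by positivity) (by positivity),
      Real.mul_rpow (by positivity) hv.le, Real.mul_rpow (by norm_num) hm0.le,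
      Real.rpow_neg hD0.le, show (4 : ℝ) = 2 ^ (2 : ℝ) by norm_num, ← Real.rpow_mul (by norm_num),
      ← Real.rpow_natCast D 2, ← Real.rpow_mul hD0.le, div_eq_mul_inv]
    norm_num
  have f2 : ((2 * m / D) ^ 2 * (1 + v ^ 2)) ^ (-(α + 2) / 2)
      = 2 ^ (-(α + 2)) * m ^ (-(α + 2)) * D ^ (α + 2) * (1 + v ^ 2) ^ (-((α + 2) / 2)) := by
    rw [Real.mul_rpow (by positivity) hY0.le, ← Real.rpow_natCast (2 * m / D) 2,
      ← Real.rpow_mul (by positivity), Real.div_rpow (by positivity) hD0.le,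
      Real.mul_rpow (by norm_num) hm0.le,
      show ((2 : ℕ) : ℝ) * (-(α + 2) / 2) = -(α + 2) by push_cast; ring, div_eq_mul_inv,
      ← Real.rpow_neg hD0.le, neg_neg, neg_div]
  have g1 : (2 : ℝ) ^ (2 * (α + 1 - g)) * 2 ^ (-(α + 2)) * 2 = 2 ^ (α + 1) * 4 ^ (-g) := by
    rw [show (4 : ℝ) = 2 ^ (2 : ℝ) by norm_num, ← Real.rpow_mul (by norm_num),
      ← Real.rpow_add two_pos, ← Real.rpow_add two_pos, ← Real.rpow_add_one two_ne_zero]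
    congr 1; ring
  have g2 : m ^ (α + 1 - g) * m ^ (-(α + 2)) * m = m ^ (-g) := by
    rw [← Real.rpow_add hm0, ← Real.rpow_add_one hm0.ne']
    congr 1; ring
  have g3 : D ^ (-(2 * (α + 1 - g))) * D ^ (α + 2) / D ^ 2 = D ^ (-(α + 2 - 2 * g)) := by
    rw [← Real.rpow_natCast D 2, ← Real.rpow_add hD0, ← Real.rpow_sub hD0]
    congr 1; push_cast; ring
  rw [Real.mul_rpow (by norm_num) hm0.le]
  calc _ = cConst α * 2 * m / D ^ 2 * ((4 * m * v / D ^ 2) ^ (α + 1) * (4 * m * v / D ^ 2) ^ (-g))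
        * ((2 * m / D) ^ 2 * (1 + v ^ 2)) ^ (-(α + 2) / 2) := by ring
    _ = cConst α * (2 ^ (2 * (α + 1 - g)) * 2 ^ (-(α + 2)) * 2)
        * (m ^ (α + 1 - g) * m ^ (-(α + 2)) * m)
        * (v ^ (α + 1 - g) * (1 + v ^ 2) ^ (-((α + 2) / 2))
          * (D ^ (-(2 * (α + 1 - g))) * D ^ (α + 2) / D ^ 2)) := by rw [f1, f2]; ring
    _ = _ := by rw [g1, g2, g3]; ring

/-- Both halves are weighted arithmetic-geometric means with weights `c², s²`: from below `c v + s ≥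
c² v + s² ≥ v^{c²}`, since `c, s ≤ 1`, and from above for `(v^{-d})^{c²}`. -/
theorem rpow_neg_convex_bound {c s v d : ℝ} (hc : 0 < c) (hs : 0 < s) (hcs : c ^ 2 + s ^ 2 = 1)
    (hv : 0 < v) (hd : 0 ≤ d) : (c * v + s) ^ (-d) ≤ c ^ 2 * v ^ (-d) + s ^ 2 := by
  have hc1 : c ≤ 1 := by nlinarith
  have hs1 : s ≤ 1 := by nlinarith
  have h1 : v ^ (c ^ 2) ≤ c ^ 2 * v + s ^ 2 := by
    have := Real.geom_mean_le_arith_mean2_weighted (sq_nonneg c) (sq_nonneg s) hv.le zero_le_one hcs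
    rwa [Real.one_rpow, mul_one, mul_one] at this
  have h2 : c ^ 2 * v + s ^ 2 ≤ c * v + s := by nlinarith [mul_pos hc hv]
  have h3 : (v ^ (-d)) ^ (c ^ 2) ≤ c ^ 2 * v ^ (-d) + s ^ 2 := by
    have := Real.geom_mean_le_arith_mean2_weighted (sq_nonneg c) (sq_nonneg s)
      (Real.rpow_nonneg hv.le (-d)) zero_le_one hcs
    rwa [Real.one_rpow, mul_one, mul_one] at this
  refine le_trans ?_ h3
  rw [← Real.rpow_mul hv.le, mul_comm (-d), Real.rpow_mul hv.le]
  exact Real.rpow_le_rpow_of_nonpos (Real.rpow_pos_of_pos hv _) (h1.trans h2) (by linarith)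

theorem beta_comm (a b : ℝ) : ProbabilityTheory.beta a b = ProbabilityTheory.beta b a := by
  simp only [ProbabilityTheory.beta, add_comm a b, mul_comm]

/-- The bound on the power of `c v + s` splits the integral in two with weights `c²` and `s²`. The
two pieces are exchanged by `v ↦ 1/v`, hence are the same Beta value, and the weights sum to one. -/
theorem lintegral_pk_radius_le_of_mem_Ioo {α g θ : ℝ} (hα : -1 < α) (hg : 0 < g)
    (hd : 0 < α + 2 - 2 * g) (hθ : θ ∈ Ioo 0 π) :
    ∫⁻ r in Ioo (-1) 1, ENNReal.ofReal (pk α (polar r θ)) * ENNReal.ofReal ((1 - r ^ 2) ^ (-g))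
      ≤ ENNReal.ofReal (cConst α * 2 ^ α * ProbabilityTheory.beta ((α + 2 - g) / 2) (g / 2)
        * (2 * Real.sin θ) ^ (-g)) := by
  set c := Real.cos (θ / 2) with hcd
  set s := Real.sin (θ / 2) with hsd
  have hc : 0 < c := Real.cos_pos_of_mem_Ioo ⟨by linarith [hθ.1, Real.pi_pos], by linarith [hθ.2]⟩
  have hs : 0 < s := Real.sin_pos_of_pos_of_lt_pi (by linarith [hθ.1])
    (by linarith [hθ.2, Real.pi_pos])
  have hcs : c ^ 2 + s ^ 2 = 1 := Real.cos_sq_add_sin_sq _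
  have hcos : Real.cos θ = c ^ 2 - s ^ 2 := by
    have := Real.cos_two_mul' (θ / 2)
    rwa [mul_div_cancel₀ θ two_ne_zero] at this
  have hsin : 2 * Real.sin θ = 4 * (c * s) := by
    have := Real.sin_two_mul (θ / 2)
    rw [mul_div_cancel₀ θ two_ne_zero] at this
    rw [this]; ring
  set B := ProbabilityTheory.beta ((α + 2 - g) / 2) (g / 2) with hB
  set M := cConst α * 2 ^ (α + 1) * (4 * (c * s)) ^ (-g) with hM
  have hM0 : 0 ≤ M := by have := cConst_pos hα; positivity
  have hB0 : 0 < B := ProbabilityTheory.beta_pos (by linarith) (by linarith)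
  have i1 := lintegral_Ioi_rpow_mul_one_add_sq_rpow (a := α + 2 - g) (c := (α + 2) / 2)
    (by linarith) (by linarith)
  have i2 := lintegral_Ioi_rpow_mul_one_add_sq_rpow (a := g) (c := (α + 2) / 2) hg (by linarith)
  rw [show (α + 2) / 2 - (α + 2 - g) / 2 = g / 2 by ring, ← hB] at i1
  rw [show (α + 2) / 2 - g / 2 = (α + 2 - g) / 2 by ring, beta_comm, ← hB] at i2
  have hpt : ∀ v ∈ Ioi (0 : ℝ), ENNReal.ofReal (2 * (c * s) / (c * v + s) ^ 2)
      * (ENNReal.ofReal (pk α (polar ((c * v - s) / (c * v + s)) θ))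
        * ENNReal.ofReal ((1 - ((c * v - s) / (c * v + s)) ^ 2) ^ (-g)))
      ≤ ENNReal.ofReal (M * c ^ 2) * ENNReal.ofReal (v ^ (g - 1) * (1 + v ^ 2) ^ (-((α + 2) / 2)))
        + ENNReal.ofReal (M * s ^ 2)
          * ENNReal.ofReal (v ^ (α + 2 - g - 1) * (1 + v ^ 2) ^ (-((α + 2) / 2))) := by
    intro v hv
    have hv : 0 < v := hv
    have hr : |(c * v - s) / (c * v + s)| < 1 := by
      have : 0 < c * v := mul_pos hc hv
      rw [abs_lt, lt_div_iff₀ (by positivity), div_lt_iff₀ (by positivity)]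
      constructor <;> linarith
    rw [← ENNReal.ofReal_mul (pk_polar_pos hα hr θ).le, ← ENNReal.ofReal_mul (by positivity),
      ← ENNReal.ofReal_mul (by positivity), ← ENNReal.ofReal_mul (by positivity),
      ← ENNReal.ofReal_add (by positivity) (by positivity), pk_polar, hcos,
      radius_integrand_eq hc hs hcs hv]
    refine ENNReal.ofReal_le_ofReal ?_
    rw [← hM]
    have hb := rpow_neg_convex_bound hc hs hcs hv hd.le
    have hv1 : v ^ (α + 1 - g) * v ^ (-(α + 2 - 2 * g)) = v ^ (g - 1) := by
      rw [← Real.rpow_add hv]; congr 1; ring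
    have hv2 : v ^ (α + 1 - g) = v ^ (α + 2 - g - 1) := by congr 1; ring
    have hnn : 0 ≤ M * (v ^ (α + 1 - g) * (1 + v ^ 2) ^ (-((α + 2) / 2))) := by positivity
    calc _ = M * (v ^ (α + 1 - g) * (1 + v ^ 2) ^ (-((α + 2) / 2)))
          * (c * v + s) ^ (-(α + 2 - 2 * g)) := by ring
      _ ≤ M * (v ^ (α + 1 - g) * (1 + v ^ 2) ^ (-((α + 2) / 2)))
          * (c ^ 2 * v ^ (-(α + 2 - 2 * g)) + s ^ 2) := mul_le_mul_of_nonneg_left hb hnn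
      _ = _ := by rw [← hv2, ← hv1]; ring
  rw [lintegral_Ioo_radius_substitution hc hs]
  refine (setLIntegral_mono' measurableSet_Ioi hpt).trans ?_
  rw [lintegral_add_left (by fun_prop), lintegral_const_mul' _ _ ENNReal.ofReal_ne_top,
    lintegral_const_mul' _ _ ENNReal.ofReal_ne_top, i1, i2, ← ENNReal.ofReal_mul (by positivity),
    ← ENNReal.ofReal_mul (by positivity), ← ENNReal.ofReal_add (by positivity) (by positivity)]
  refine ENNReal.ofReal_le_ofReal (le_of_eq ?_)
  rw [hsin, hM, Real.rpow_add_one two_ne_zero]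
  linear_combination (cConst α * 2 ^ α * (4 * (c * s)) ^ (-g) * B) * hcs

/-- The kernel sees `θ` only through `cos θ`, so `θ` may be replaced by `arccos (cos θ)` in `(0,
π)`. -/
theorem lintegral_pk_radius_le {α g θ : ℝ} (hα : -1 < α) (hg : 0 < g)
    (hd : 0 < α + 2 - 2 * g) (hθ : Real.sin θ ≠ 0) :
    ∫⁻ r in Ioo (-1) 1, ENNReal.ofReal (pk α (polar r θ)) * ENNReal.ofReal ((1 - r ^ 2) ^ (-g))
      ≤ ENNReal.ofReal (cConst α * 2 ^ α * ProbabilityTheory.beta ((α + 2 - g) / 2) (g / 2)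
        * |2 * Real.sin θ| ^ (-g)) := by
  set φ := Real.arccos (Real.cos θ)
  have hcos : Real.cos φ = Real.cos θ := Real.cos_arccos (Real.neg_one_le_cos θ) (Real.cos_le_one θ)
  have hsq : Real.cos θ ^ 2 < 1 := by
    have := Real.sin_sq_add_cos_sq θ
    have h2 : 0 < Real.sin θ ^ 2 := by positivity
    linarith
  have habs := abs_lt.1 ((sq_lt_one_iff_abs_lt_one _).1 hsq)
  have hφ : φ ∈ Ioo 0 π := by
    refine ⟨Real.arccos_pos.2 habs.2, lt_of_le_of_ne (Real.arccos_le_pi _) fun h => ?_⟩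
    rw [h, Real.cos_pi] at hcos
    linarith [habs.1]
  have hsin : |2 * Real.sin θ| = 2 * Real.sin φ := by
    rw [abs_mul, abs_of_pos two_pos, Real.sin_arccos, Real.abs_sin_eq_sqrt_one_sub_cos_sq]
  have h := lintegral_pk_radius_le_of_mem_Ioo hα hg hd hφ
  rw [hsin]
  simpa only [pk_polar, hcos] using h

/-! ### The Riesz–Fejér inequality for Poisson integrals -/

/-- Hölder for `N F = (N W^{-1/p})^{1/q} (N W^{1/q} F^p)^{1/p}`: the step of Schur's test with a
weight `W`. -/
theorem lintegral_mul_rpow_le_of_weight {X : Type*} [MeasurableSpace X] {μ : Measure X} {p q : ℝ}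
    (hpq : p.HolderConjugate q) {N F W : X → ℝ≥0∞} (hN : AEMeasurable N μ) (hF : AEMeasurable F μ)
    (hW : AEMeasurable W μ) (hW0 : ∀ᵐ x ∂μ, W x ≠ 0) (hWt : ∀ᵐ x ∂μ, W x ≠ ∞) :
    (∫⁻ x, N x * F x ∂μ) ^ p
      ≤ (∫⁻ x, N x * W x ^ (-p⁻¹) ∂μ) ^ (p - 1) * ∫⁻ x, N x * W x ^ q⁻¹ * F x ^ p ∂μ := by
  have hp0 := hpq.pos
  have hq0 := hpq.symm.pos
  have hsum := hpq.inv_add_inv_eq_one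
  have e : ∀ᵐ x ∂μ, N x * F x
      = (N x * W x ^ (-p⁻¹)) ^ q⁻¹ * (N x * W x ^ q⁻¹ * F x ^ p) ^ p⁻¹ := by
    filter_upwards [hW0, hWt] with x h0 ht
    have hq1 : 0 ≤ q⁻¹ := inv_nonneg.2 hq0.le
    have hp1 : 0 ≤ p⁻¹ := inv_nonneg.2 hp0.le
    rw [ENNReal.mul_rpow_of_nonneg _ _ hq1, ENNReal.mul_rpow_of_nonneg _ _ hp1,
      ENNReal.mul_rpow_of_nonneg _ _ hp1, ← ENNReal.rpow_mul, ← ENNReal.rpow_mul,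
      ← ENNReal.rpow_mul, mul_inv_cancel₀ hp0.ne', ENNReal.rpow_one]
    have h1 : N x ^ q⁻¹ * N x ^ p⁻¹ = N x := by
      rw [← ENNReal.rpow_add_of_nonneg _ _ hq1 hp1, add_comm, hsum, ENNReal.rpow_one]
    have h2 : W x ^ (-p⁻¹ * q⁻¹) * W x ^ (q⁻¹ * p⁻¹) = 1 := by
      rw [← ENNReal.rpow_add _ _ h0 ht, show -p⁻¹ * q⁻¹ + q⁻¹ * p⁻¹ = 0 by ring,
        ENNReal.rpow_zero]
    calc N x * F x = (N x ^ q⁻¹ * N x ^ p⁻¹) * (W x ^ (-p⁻¹ * q⁻¹) * W x ^ (q⁻¹ * p⁻¹)) * F x := by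
          rw [h1, h2, mul_one]
      _ = _ := by ring
  have hA : AEMeasurable (fun x => N x * W x ^ (-p⁻¹)) μ := hN.mul (hW.pow_const _)
  have hB : AEMeasurable (fun x => N x * W x ^ q⁻¹ * F x ^ p) μ :=
    (hN.mul (hW.pow_const _)).mul (hF.pow_const _)
  have h := ENNReal.lintegral_mul_le_Lp_mul_Lq μ hpq.symm (hA.pow_const q⁻¹) (hB.pow_const p⁻¹)
  simp only [Pi.mul_apply, ← ENNReal.rpow_mul, inv_mul_cancel₀ hp0.ne', inv_mul_cancel₀ hq0.ne',
    ENNReal.rpow_one] at h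
  rw [lintegral_congr_ae e]
  refine (ENNReal.rpow_le_rpow h hp0.le).trans (le_of_eq ?_)
  rw [ENNReal.mul_rpow_of_nonneg _ _ hp0.le, ← ENNReal.rpow_mul, ← ENNReal.rpow_mul,
    one_div_mul_cancel hp0.ne', ENNReal.rpow_one]
  congr 2
  have hq : q⁻¹ = 1 - p⁻¹ := by linarith
  rw [one_div, hq]
  field_simp

theorem measurable_pk_polar_sub (α s : ℝ) :
    Measurable fun x : ℝ × ℝ => pk α (polar x.1 (s - x.2)) := by
  simp only [pk_polar]
  fun_prop

theorem enorm_pInt_le {α : ℝ} (hα : -1 < α) (f : ℝ → ℂ) {r : ℝ} (hr : |r| < 1) (s : ℝ) :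
    ‖pInt α f (polar r s)‖ₑ ≤ ENNReal.ofReal (2 * π)⁻¹
      * ∫⁻ t in Ioc 0 (2 * π), ENNReal.ofReal (pk α (polar r (s - t))) * ‖f t‖ₑ := by
  rw [pInt_polar, enorm_mul, intervalIntegral.integral_of_le Real.two_pi_pos.le]
  refine mul_le_mul' (le_of_eq ?_) ((enorm_integral_le_lintegral_enorm _).trans (le_of_eq ?_))
  · rw [← ofReal_norm]
    congr 1
    have : (2 * (π : ℂ))⁻¹ = (((2 * π)⁻¹ : ℝ) : ℂ) := by push_cast; rfl
    rw [this, Complex.norm_real, Real.norm_eq_abs, abs_of_pos (inv_pos.2 Real.two_pi_pos)]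
  · refine lintegral_congr fun t => ?_
    rw [enorm_mul]
    congr 1
    rw [← ofReal_norm, Complex.norm_real, Real.norm_eq_abs, abs_of_pos (pk_polar_pos hα hr _)]

theorem lintegral_pk_sub_mul_rpow_sin_le {α b r : ℝ} (hα : -1 < α) (h0 : α ≤ 0) (hb : 0 < b)
    (hb1 : b < 1) (hab : -(2 * b) ≤ α) (hr : |r| < 1) (s : ℝ) :
    ∫⁻ t in Ioc 0 (2 * π), ENNReal.ofReal (pk α (polar r (s - t)))
        * ENNReal.ofReal |2 * Real.sin (s - t)| ^ (-b)
      ≤ ENNReal.ofReal (2 * π * sec (π * b / 2) * (1 - r ^ 2) ^ (-b)) := by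
  have h1 := lintegral_pk_mul_rpow_sin_le hα h0 hb hb1 hab hr
  have hper : Function.Periodic (fun θ => ENNReal.ofReal (pk α (polar r θ))
      * ENNReal.ofReal |2 * Real.sin θ| ^ (-b)) (2 * π) := by
    intro θ
    simp only [Real.sin_add_two_pi, pk_polar, Real.cos_add_two_pi]
  rwa [← setLIntegral_comp_sub_left_of_periodic hper s] at h1

theorem measurable_ofReal_sin_sub (s : ℝ) :
    Measurable fun t : ℝ => ENNReal.ofReal |2 * Real.sin (s - t)| := by
  have : Continuous fun t : ℝ => |2 * Real.sin (s - t)| := by fun_prop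
  exact this.measurable.ennreal_ofReal

/-- Schur's test at a fixed radius, with weight `|2 sin (s-t)|` and the angular inequality at `b =
1/p`. The condition `α + 2/p > 0` is used as `-2b ≤ α`. -/
theorem enorm_pInt_rpow_le {α p : ℝ} (hα : -1 < α) (h0 : α ≤ 0) (hp : 1 < p)
    (hαp : 0 < α + 2 / p) {f : ℝ → ℂ} (hf : IntervalIntegrable f volume 0 (2 * π)) (s : ℝ)
    {r : ℝ} (hr : |r| < 1) :
    ‖pInt α f (polar r s)‖ₑ ^ p
      ≤ ENNReal.ofReal ((2 * π)⁻¹ ^ p * (2 * π * sec (π * p⁻¹ / 2)) ^ (p - 1))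
        * ∫⁻ t in Ioc 0 (2 * π), ENNReal.ofReal (pk α (polar r (s - t)))
          * ENNReal.ofReal ((1 - r ^ 2) ^ (-(1 - p⁻¹)))
          * (ENNReal.ofReal |2 * Real.sin (s - t)| ^ (1 - p⁻¹) * ‖f t‖ₑ ^ p) := by
  have hp0 : 0 < p := by linarith
  have hpq : p.HolderConjugate (p / (p - 1)) := Real.HolderConjugate.conjExponent hp
  have hb0 : 0 < p⁻¹ := inv_pos.2 hp0
  have hb1 : p⁻¹ < 1 := inv_lt_one_of_one_lt₀ hp
  have hgb : (p / (p - 1))⁻¹ = 1 - p⁻¹ := by linarith [hpq.inv_add_inv_eq_one]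
  have hab : -(2 * p⁻¹) ≤ α := by rw [div_eq_mul_inv] at hαp; linarith
  have hfm := ((intervalIntegrable_iff_integrableOn_Ioc_of_le
      Real.two_pi_pos.le).1 hf).aestronglyMeasurable.enorm
  have hNr : Measurable fun t => ENNReal.ofReal (pk α (polar r (s - t))) :=
    ((measurable_pk_polar_sub α s).comp (measurable_const.prodMk measurable_id)).ennreal_ofReal
  have hW0 : ∀ᵐ t ∂(volume.restrict (Ioc 0 (2 * π))),
      ENNReal.ofReal |2 * Real.sin (s - t)| ≠ 0 := by
    filter_upwards [ae_restrict_of_ae (ae_sin_sub_ne_zero s)] with t ht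
    simpa using ht
  have hS0 : 0 < 2 * π * sec (π * p⁻¹ / 2) := mul_pos Real.two_pi_pos (sec_pos hb0.le hb1)
  have hA := lintegral_pk_sub_mul_rpow_sin_le hα h0 hb0 hb1 hab hr s
  generalize 2 * π * sec (π * p⁻¹ / 2) = S at *
  have hr2 : 0 < 1 - r ^ 2 := by rw [← sq_abs]; nlinarith [abs_nonneg r]
  have h1 := lintegral_mul_rpow_le_of_weight hpq hNr.aemeasurable hfm
    (measurable_ofReal_sin_sub s).aemeasurable hW0
    (Eventually.of_forall fun _ => ENNReal.ofReal_ne_top)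
  rw [hgb] at h1
  have h2 := (ENNReal.rpow_le_rpow hA (show 0 ≤ p - 1 by linarith))
  -- The power `p - 1` of `(1 - r²)^{-1/p}` is `(1 - r²)^{-(1 - 1/p)}`, the radial weight for `g = 1
  -- - 1/p`.
  have h2' : ENNReal.ofReal (S * (1 - r ^ 2) ^ (-p⁻¹)) ^ (p - 1)
      = ENNReal.ofReal (S ^ (p - 1)) * ENNReal.ofReal ((1 - r ^ 2) ^ (-(1 - p⁻¹))) := by
    rw [ENNReal.ofReal_rpow_of_pos (by positivity), Real.mul_rpow hS0.le (by positivity),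
      ← Real.rpow_mul hr2.le, ENNReal.ofReal_mul (by positivity)]
    congr 3
    field_simp
  rw [h2'] at h2
  have h3 := ENNReal.rpow_le_rpow (enorm_pInt_le hα f hr s) hp0.le
  rw [ENNReal.mul_rpow_of_nonneg _ _ hp0.le, ENNReal.ofReal_rpow_of_pos
      (inv_pos.2 Real.two_pi_pos)] at h3
  refine h3.trans ((mul_le_mul_right (h1.trans (mul_le_mul_left h2 _)) _).trans (le_of_eq ?_))
  rw [ENNReal.ofReal_mul (by positivity)]
  have h4 : ∀ t, ENNReal.ofReal (pk α (polar r (s - t)))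
      * ENNReal.ofReal ((1 - r ^ 2) ^ (-(1 - p⁻¹)))
      * (ENNReal.ofReal |2 * Real.sin (s - t)| ^ (1 - p⁻¹) * ‖f t‖ₑ ^ p)
      = ENNReal.ofReal ((1 - r ^ 2) ^ (-(1 - p⁻¹))) * (ENNReal.ofReal (pk α (polar r (s - t)))
        * ENNReal.ofReal |2 * Real.sin (s - t)| ^ (1 - p⁻¹) * ‖f t‖ₑ ^ p) := fun t => by ring
  simp only [h4]
  rw [lintegral_const_mul' _ _ ENNReal.ofReal_ne_top]
  ring

theorem rfConst_eq_mul {α p : ℝ} (hp : 1 < p) :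
    (2 * π)⁻¹ ^ p * (2 * π * sec (π * p⁻¹ / 2)) ^ (p - 1) * (cConst α * 2 ^ α
      * ProbabilityTheory.beta ((α + 2 - (1 - p⁻¹)) / 2) ((1 - p⁻¹) / 2)) = rfConst α p := by
  have hp0 : 0 < p := by linarith
  have e1 : π / (2 * p) = π * p⁻¹ / 2 := by field_simp
  have hsec := sec_pos (inv_pos.2 hp0).le (inv_lt_one_of_one_lt₀ hp)
  rw [rfConst, one_div p, e1, show (α + 2 - (1 - p⁻¹)) / 2 = 1 / 2 * (1 + α + p⁻¹) by ring,
    show (1 - p⁻¹) / 2 = 1 / 2 * (1 - p⁻¹) by ring, Real.mul_rpow Real.two_pi_pos.le hsec.le,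
    Real.inv_rpow Real.two_pi_pos.le, Real.rpow_sub_one Real.two_pi_pos.ne',
    Real.rpow_sub_one two_ne_zero]
  have hπ := (Real.rpow_pos_of_pos Real.two_pi_pos p).ne'
  generalize (2 * π) ^ p = X at *
  generalize sec (π * p⁻¹ / 2) ^ (p - 1) = Y at *
  generalize ProbabilityTheory.beta _ _ = Z
  generalize (2 : ℝ) ^ α = V
  have := Real.pi_pos.ne'
  field_simp

/-- Integrate the fixed-radius bound over `r`, exchange the integrals, and apply the radial
inequality with `g = 1 - 1/p`; its requirement `α + 2 - 2g > 0` is then `α + 2/p > 0`. -/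
theorem lintegral_pInt_rpow_le {α p : ℝ} (hα : -1 < α) (h0 : α ≤ 0) (hp : 1 < p)
    (hαp : 0 < α + 2 / p) {f : ℝ → ℂ} (hf : IntervalIntegrable f volume 0 (2 * π)) (s : ℝ) :
    ∫⁻ r in Ioo (-1 : ℝ) 1, ‖pInt α f (polar r s)‖ₑ ^ p
      ≤ ENNReal.ofReal (rfConst α p) * ∫⁻ t in Ioc (0 : ℝ) (2 * π), ‖f t‖ₑ ^ p := by
  have hp0 : 0 < p := by linarith
  have hb0 : 0 < p⁻¹ := inv_pos.2 hp0
  have hb1 : p⁻¹ < 1 := inv_lt_one_of_one_lt₀ hp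
  have hab : -(2 * p⁻¹) < α := by rw [div_eq_mul_inv] at hαp; linarith
  have hpt := fun r (hr : r ∈ Ioo (-1 : ℝ) 1) =>
    enorm_pInt_rpow_le hα h0 hp hαp hf s (abs_lt.2 hr)
  have hS0 : 0 < 2 * π * sec (π * p⁻¹ / 2) := mul_pos Real.two_pi_pos (sec_pos hb0.le hb1)
  have hconst := rfConst_eq_mul (α := α) hp
  have hBt := fun (t : ℝ) (ht : Real.sin (s - t) ≠ 0) => lintegral_pk_radius_le (α := α)
    (g := 1 - p⁻¹) hα (by linarith) (by linarith) ht
  have hT0 : 0 ≤ cConst α * 2 ^ α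
      * ProbabilityTheory.beta ((α + 2 - (1 - p⁻¹)) / 2) ((1 - p⁻¹) / 2) := by
    have h1 := cConst_pos hα
    have h2 := ProbabilityTheory.beta_pos (show 0 < (α + 2 - (1 - p⁻¹)) / 2 by linarith)
      (show 0 < (1 - p⁻¹) / 2 by linarith)
    positivity
  generalize 2 * π * sec (π * p⁻¹ / 2) = S at *
  generalize cConst α * 2 ^ α
    * ProbabilityTheory.beta ((α + 2 - (1 - p⁻¹)) / 2) ((1 - p⁻¹) / 2) = T at *
  have hfm := ((intervalIntegrable_iff_integrableOn_Ioc_of_le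
      Real.two_pi_pos.le).1 hf).aestronglyMeasurable.enorm
  have hNm := (measurable_pk_polar_sub α s).ennreal_ofReal
  have hAm : Measurable fun r : ℝ => ENNReal.ofReal ((1 - r ^ 2) ^ (-(1 - p⁻¹))) := by fun_prop
  have hmeas : AEMeasurable (Function.uncurry fun r t => ENNReal.ofReal (pk α (polar r (s - t)))
      * ENNReal.ofReal ((1 - r ^ 2) ^ (-(1 - p⁻¹)))
      * (ENNReal.ofReal |2 * Real.sin (s - t)| ^ (1 - p⁻¹) * ‖f t‖ₑ ^ p))
      ((volume.restrict (Ioo (-1 : ℝ) 1)).prod (volume.restrict (Ioc 0 (2 * π)))) := by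
    refine AEMeasurable.mul (Measurable.aemeasurable (hNm.mul (hAm.comp measurable_fst))) ?_
    exact (((measurable_ofReal_sin_sub s).pow_const _).aemeasurable.mul
      (hfm.pow_const _)).comp_snd
  refine (setLIntegral_mono' measurableSet_Ioo hpt).trans ?_
  rw [lintegral_const_mul' _ _ ENNReal.ofReal_ne_top, lintegral_lintegral_swap hmeas]
  have hin : ∀ᵐ t ∂(volume.restrict (Ioc 0 (2 * π))), ∫⁻ r in Ioo (-1 : ℝ) 1,
      ENNReal.ofReal (pk α (polar r (s - t))) * ENNReal.ofReal ((1 - r ^ 2) ^ (-(1 - p⁻¹)))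
      * (ENNReal.ofReal |2 * Real.sin (s - t)| ^ (1 - p⁻¹) * ‖f t‖ₑ ^ p)
      ≤ ENNReal.ofReal T * ‖f t‖ₑ ^ p := by
    filter_upwards [ae_restrict_of_ae (ae_sin_sub_ne_zero s)] with t ht
    have hm1 : Measurable fun r : ℝ => ENNReal.ofReal (pk α (polar r (s - t)))
        * ENNReal.ofReal ((1 - r ^ 2) ^ (-(1 - p⁻¹))) :=
      (hNm.comp (measurable_id.prodMk measurable_const)).mul hAm
    rw [lintegral_mul_const _ hm1, ← mul_assoc]
    refine mul_le_mul_left ((mul_le_mul_left (hBt t ht) _).trans (le_of_eq ?_)) _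
    have hpos : 0 < |2 * Real.sin (s - t)| := abs_pos.2 (mul_ne_zero two_ne_zero ht)
    -- The sine weights from the two tests are inverse to each other; this needs `sin (s - t) ≠ 0`,
    -- true almost everywhere.
    rw [ENNReal.ofReal_mul hT0, ← ENNReal.ofReal_rpow_of_pos hpos, mul_assoc,
      ← ENNReal.rpow_add _ _ (by simpa using hpos.ne') ENNReal.ofReal_ne_top, neg_add_cancel,
      ENNReal.rpow_zero, mul_one]
  refine (mul_le_mul_right (lintegral_mono_ae hin) _).trans (le_of_eq ?_)
  rw [lintegral_const_mul' _ _ ENNReal.ofReal_ne_top, ← mul_assoc, ← ENNReal.ofReal_mul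
    (by positivity), hconst]

theorem rieszFejerBound_rfConst {α p : ℝ} (hα : -1 < α) (h0 : α ≤ 0) (hp : 1 < p)
    (hαp : 0 < α + 2 / p) (s : ℝ) : RieszFejerBound α p s (rfConst α p) := by
  intro u hu
  obtain ⟨f, -, hf, he, hlim⟩ := hu.exists_boundary hα h0 hp
  have h1 : ∫⁻ r in Ioo (-1 : ℝ) 1, ‖u (polar r s)‖ₑ ^ p
      = ∫⁻ r in Ioo (-1 : ℝ) 1, ‖pInt α f (polar r s)‖ₑ ^ p :=
    setLIntegral_congr_fun measurableSet_Ioo fun r hr => by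
      simp only [he _ (polar_mem_ball (abs_lt.2 hr) s)]
  have h2 : ∫⁻ t in Ioc (0 : ℝ) (2 * π), ‖radialLimit u t‖ₑ ^ p
      = ∫⁻ t in Ioc (0 : ℝ) (2 * π), ‖f t‖ₑ ^ p := by
    refine lintegral_congr_ae ?_
    filter_upwards [ae_restrict_of_ae hlim] with t ht
    rw [radialLimit_eq ht]
  rw [h1, h2]
  exact lintegral_pInt_rpow_le hα h0 hp hαp hf s

/-! ### The constant -/

/-- Euler's reflection formula. It turns the Beta factor at `α = 0` into the missing power of the
secant and also evaluates the test integrals for sharpness. -/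
theorem beta_half_eq {x : ℝ} : ProbabilityTheory.beta ((1 + x) / 2) ((1 - x) / 2)
    = π * sec (π * x / 2) := by
  have h := Real.Gamma_mul_Gamma_one_sub ((1 + x) / 2)
  rw [show 1 - (1 + x) / 2 = (1 - x) / 2 by ring] at h
  rw [ProbabilityTheory.beta, h, show (1 + x) / 2 + (1 - x) / 2 = 1 by ring, Real.Gamma_one,
    div_one, sec, show π * ((1 + x) / 2) = π * x / 2 + π / 2 by ring, Real.sin_add_pi_div_two,
    mul_one_div]

theorem rfConst_zero {p : ℝ} (hp : 1 < p) :
    rfConst 0 p = (1 / 2) * sec (π / (2 * p)) ^ p := by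
  have hp0 : 0 < p := by linarith
  have e1 : π / (2 * p) = π * p⁻¹ / 2 := by field_simp
  have hsec := sec_pos (inv_pos.2 hp0).le (inv_lt_one_of_one_lt₀ hp)
  have hb := beta_half_eq (x := p⁻¹)
  rw [rfConst, cConst_zero, one_div p, show (1 / 2 : ℝ) * (1 + 0 + p⁻¹) = (1 + p⁻¹) / 2 by ring,
    show (1 / 2 : ℝ) * (1 - p⁻¹) = (1 - p⁻¹) / 2 by ring, hb, e1, zero_sub, Real.rpow_neg_one,
    Real.rpow_sub_one hsec.ne']
  have := Real.pi_pos.ne'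
  have := hsec.ne'
  generalize sec (π * p⁻¹ / 2) = S at *
  field_simp

theorem continuousAt_Gamma_of_pos {x : ℝ} (hx : 0 < x) : ContinuousAt Real.Gamma x :=
  (Real.differentiableAt_Gamma fun m => by
    have : (0 : ℝ) ≤ m := Nat.cast_nonneg m
    linarith).continuousAt

theorem continuousAt_cConst_zero : ContinuousAt cConst 0 := by
  unfold cConst
  refine ContinuousAt.div (ContinuousAt.pow ?_ 2) ?_ (by simp)
  · exact ContinuousAt.comp (f := fun α : ℝ => α / 2 + 1)
      (continuousAt_Gamma_of_pos (by norm_num)) (by fun_prop)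
  · exact ContinuousAt.comp (f := fun α : ℝ => 1 + α)
      (continuousAt_Gamma_of_pos (by norm_num)) (by fun_prop)

theorem continuousAt_rfConst_zero {p : ℝ} (hp : 1 < p) :
    ContinuousAt (fun α => rfConst α p) 0 := by
  have hp0 : 0 < 1 / p := by positivity
  have hp1 : 1 / p < 1 := by rw [div_lt_one (by linarith)]; exact hp
  unfold rfConst ProbabilityTheory.beta
  refine ContinuousAt.mul (ContinuousAt.mul (ContinuousAt.div_const (ContinuousAt.mul ?_
    continuousAt_cConst_zero) _) (ContinuousAt.div (ContinuousAt.mul ?_ continuousAt_const) ?_ ?_))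
    continuousAt_const
  · exact ContinuousAt.rpow (by fun_prop) (by fun_prop) (Or.inl two_ne_zero)
  · exact ContinuousAt.comp (f := fun α : ℝ => 1 / 2 * (1 + α + 1 / p))
      (continuousAt_Gamma_of_pos (by linarith))
      (by fun_prop)
  · exact ContinuousAt.comp (f := fun α : ℝ => 1 / 2 * (1 + α + 1 / p) + 1 / 2 * (1 - 1 / p))
      (continuousAt_Gamma_of_pos (by linarith)) (by fun_prop)
  · exact (Real.Gamma_pos_of_pos (by linarith)).ne'

/-! ### Poisson integrals of bounded functions -/

theorem setLIntegral_Ioc_of_even {G : ℝ → ℝ≥0∞} (hp : Function.Periodic G (2 * π))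
    (he : ∀ t, G (-t) = G t) :
    ∫⁻ t in Ioc 0 (2 * π), G t = 2 * ∫⁻ t in Ioo 0 π, G t := by
  have h1 := setLIntegral_Ioc_of_periodic hp 0 (-π)
  rw [zero_add, show -π + 2 * π = π by ring] at h1
  have h2 : Ioc (-π) π = Ioc (-π) 0 ∪ Ioc 0 π :=
    (Ioc_union_Ioc_eq_Ioc (by linarith [Real.pi_pos]) Real.pi_pos.le).symm
  have h3 : ∫⁻ t in Ioc (-π) 0, G t = ∫⁻ t in Ioo 0 π, G t := by
    have h4 := (Measure.measurePreserving_neg (volume : Measure ℝ)).setLIntegral_comp_emb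
      (Homeomorph.neg ℝ).measurableEmbedding G (Ioo 0 π)
    rw [← restrict_Ioo_eq_restrict_Ioc]
    simpa [he] using h4.symm
  rw [h1, h2, lintegral_union measurableSet_Ioc
    (by rw [Ioc_disjoint_Ioc]; simp), h3, restrict_Ioo_eq_restrict_Ioc, two_mul]

/-- The kernel has uniformly bounded mass on circles, so a bounded density has a bounded Poisson
integral. Using bounded test functions therefore makes Hardy membership immediate. -/
theorem memHardy_pInt {α p M : ℝ} (hα : -1 < α) (h0 : α ≤ 0) (hp : 1 < p)
    {f : ℝ → ℂ} (hf : IntervalIntegrable f volume 0 (2 * π)) (hM : ∀ t, ‖f t‖ ≤ M) :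
    MemHardy α p (pInt α f) := by
  have hharm := isAlphaHarmonic_pInt α hf
  have hM0 : 0 ≤ M := (norm_nonneg _).trans (hM 0)
  set C : ℝ≥0∞ := ENNReal.ofReal (2 * π)⁻¹
    * (2 * ENNReal.ofReal ((1 / 4) ^ (α / 2) * π) * ENNReal.ofReal M) with hC
  have hCt : C ≠ ∞ := by
    simp [hC, ENNReal.mul_eq_top]
  have hb : ∀ r ∈ Ico (0 : ℝ) 1, ∀ θ, ‖pInt α f (polar r θ)‖ ≤ C.toReal := by
    intro r hr θ
    have hr' : |r| < 1 := by rw [abs_of_nonneg hr.1]; exact hr.2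
    rw [← toReal_enorm]
    refine ENNReal.toReal_mono hCt ((enorm_pInt_le hα f hr' θ).trans (mul_le_mul_right ?_ _))
    have h1 : ∀ t, ENNReal.ofReal (pk α (polar r (θ - t))) * ‖f t‖ₑ
        ≤ ENNReal.ofReal (pk α (polar r (θ - t))) * ENNReal.ofReal M := fun t => by
      refine mul_le_mul_right ?_ _
      rw [← ofReal_norm]
      exact ENNReal.ofReal_le_ofReal (hM t)
    refine (lintegral_mono h1).trans ?_
    rw [lintegral_mul_const' _ _ ENNReal.ofReal_ne_top]
    refine mul_le_mul_left ?_ _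
    have hper : Function.Periodic (fun t => ENNReal.ofReal (pk α (polar r t))) (2 * π) := fun t =>
      congrArg ENNReal.ofReal (pk_polar_periodic α r t)
    rw [setLIntegral_comp_sub_left_of_periodic hper θ, setLIntegral_Ioc_of_even hper
      (fun t => by rw [pk_polar_neg]), lintegral_pk_polar_Ioo_eq hα hr']
    exact mul_le_mul_right (ENNReal.ofReal_le_ofReal (integral_pk_polar_le hα h0 hr)) _
  refine ⟨hharm, (1 / (2 * π) * ∫ θ in (0 : ℝ)..(2 * π), C.toReal ^ p) ^ (1 / p), fun r hr => ?_⟩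
  have hr' : |r| < 1 := by rw [abs_of_nonneg hr.1]; exact hr.2
  have hcont : Continuous fun θ => ‖pInt α f (polar r θ)‖ ^ p :=
    (hharm.continuous_polar hr').norm.rpow_const fun _ => Or.inr (by linarith)
  rw [integralMean]
  refine Real.rpow_le_rpow (mul_nonneg (by positivity) (intervalIntegral.integral_nonneg
    Real.two_pi_pos.le fun θ _ => by positivity)) (mul_le_mul_of_nonneg_left ?_ (by positivity))
    (by positivity)
  exact intervalIntegral.integral_mono_on Real.two_pi_pos.le (hcont.intervalIntegrable _ _)
    (by simp) fun θ _ => Real.rpow_le_rpow (norm_nonneg _) (hb r hr θ) (by linarith)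

/-- An inequality for the Poisson integral of a bounded nonnegative function that any
admissible constant has to satisfy. -/
theorem RieszFejerBound.lintegral_le {α p s K M : ℝ} (hK : RieszFejerBound α p s K) (hα : -1 < α)
    (h0 : α ≤ 0) (hp : 1 < p) {F : ℝ → ℝ} (hF : Measurable F) (hF0 : ∀ t, 0 ≤ F t)
    (hFM : ∀ t, F t ≤ M) (hper : Function.Periodic F (2 * π)) :
    ∫⁻ r in Ioo (-1 : ℝ) 1, (∫⁻ t in Ioc 0 (2 * π),
        ENNReal.ofReal ((2 * π)⁻¹ * (pk α (polar r t) * F t))) ^ p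
      ≤ ENNReal.ofReal K * ∫⁻ t in Ioc 0 (2 * π), ENNReal.ofReal (F t) ^ p := by
  -- Reflecting about `s` removes the direction from the resulting inequality, which is why the
  -- lower bound is uniform in `s`.
  set f : ℝ → ℂ := fun t => (F (s - t) : ℂ) with hfd
  have hfper : Function.Periodic f (2 * π) := fun t => by
    simp only [hfd]
    rw [← hper.sub_eq, show s - (t + 2 * π) = s - t - 2 * π by ring, hper.sub_eq, hper.sub_eq]
  have hfb : ∀ t, ‖f t‖ ≤ M := fun t => by
    rw [hfd, Complex.norm_real, Real.norm_eq_abs, abs_of_nonneg (hF0 _)]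
    exact hFM _
  have hFs : Measurable fun t => F (s - t) := hF.comp (measurable_const.sub measurable_id)
  have hfi : IntervalIntegrable f volume 0 (2 * π) := by
    rw [intervalIntegrable_iff_integrableOn_Ioc_of_le Real.two_pi_pos.le]
    exact Integrable.of_bound (Complex.measurable_ofReal.comp hFs).aestronglyMeasurable M
      (Eventually.of_forall hfb)
  have h := hK _ (memHardy_pInt hα h0 hp hfi hfb)
  have e1 : ∫⁻ θ in Ioc 0 (2 * π), ‖radialLimit (pInt α f) θ‖ₑ ^ p
      = ∫⁻ t in Ioc 0 (2 * π), ENNReal.ofReal (F t) ^ p := by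
    have h1 : ∀ᵐ θ ∂(volume.restrict (Ioc 0 (2 * π))), ‖radialLimit (pInt α f) θ‖ₑ ^ p
        = ENNReal.ofReal (F (s - θ)) ^ p := by
      filter_upwards [ae_restrict_of_ae (ae_tendsto_pInt hα h0 hfper hfi)] with θ hθ
      rw [radialLimit_eq hθ, ← ofReal_norm, hfd, Complex.norm_real, Real.norm_eq_abs,
        abs_of_nonneg (hF0 _)]
    rw [lintegral_congr_ae h1]
    exact setLIntegral_comp_sub_left_of_periodic (F := fun t => ENNReal.ofReal (F t) ^ p)
      (fun t => by simp only [hper t]) s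
  have e2 : ∫⁻ r in Ioo (-1 : ℝ) 1, ‖pInt α f (polar r s)‖ₑ ^ p
      = ∫⁻ r in Ioo (-1 : ℝ) 1, (∫⁻ t in Ioc 0 (2 * π),
        ENNReal.ofReal ((2 * π)⁻¹ * (pk α (polar r t) * F t))) ^ p := by
    refine setLIntegral_congr_fun measurableSet_Ioo fun r hr => ?_
    have hr' : |r| < 1 := abs_lt.2 hr
    congr 1
    have hnn : ∀ t, 0 ≤ pk α (polar r (s - t)) * F (s - t) := fun t =>
      mul_nonneg (pk_polar_pos hα hr' _).le (hF0 _)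
    have hint : Integrable (fun t => (2 * π)⁻¹ * (pk α (polar r (s - t)) * F (s - t)))
        (volume.restrict (Ioc 0 (2 * π))) := by
      refine Integrable.const_mul ?_ _
      have hc : Continuous fun t => pk α (polar r (s - t)) :=
        (continuous_pk_polar hr').comp (by fun_prop)
      have h1 : Integrable (fun t => pk α (polar r (s - t)))
          (volume.restrict (Ioc 0 (2 * π))) :=
        (hc.integrableOn_Icc).mono_set Ioc_subset_Icc_self
      refine h1.mul_bdd (c := M) hFs.aestronglyMeasurable (Eventually.of_forall fun t => ?_)
      rw [Real.norm_eq_abs, abs_of_nonneg (hF0 _)]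
      exact hFM _
    have h2 : pInt α f (polar r s) = ((∫ t in Ioc 0 (2 * π),
        (2 * π)⁻¹ * (pk α (polar r (s - t)) * F (s - t)) : ℝ) : ℂ) := by
      rw [pInt_polar, intervalIntegral.integral_of_le Real.two_pi_pos.le, integral_const_mul]
      push_cast [← integral_complex_ofReal]
      rfl
    have h3 : 0 ≤ ∫ t in Ioc 0 (2 * π), (2 * π)⁻¹ * (pk α (polar r (s - t)) * F (s - t)) :=
      integral_nonneg fun t => mul_nonneg (by positivity) (hnn t)
    rw [h2, ← ofReal_norm, Complex.norm_real, Real.norm_eq_abs, abs_of_nonneg h3,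
      ofReal_integral_eq_lintegral_ofReal hint
        (Eventually.of_forall fun t => mul_nonneg (by positivity) (hnn t))]
    exact setLIntegral_comp_sub_left_of_periodic
      (F := fun t => ENNReal.ofReal ((2 * π)⁻¹ * (pk α (polar r t) * F t)))
      (fun t => by simp only [hper t, pk_polar_periodic α r t]) s
  rwa [e1, e2] at h

/-! ### Asymptotic sharpness -/

/-- The function `|cot (t / 2)| ^ β`. -/
noncomputable def cotPow (β t : ℝ) : ℝ := |Real.cos (t / 2) / Real.sin (t / 2)| ^ β

theorem cotPow_nonneg (β t : ℝ) : 0 ≤ cotPow β t := Real.rpow_nonneg (abs_nonneg _) _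

theorem measurable_cotPow (β : ℝ) : Measurable (cotPow β) := by
  unfold cotPow
  have h1 : Measurable fun t : ℝ => Real.cos (t / 2) / Real.sin (t / 2) :=
    Measurable.div (by fun_prop) (by fun_prop)
  have h2 : Measurable fun t : ℝ => |Real.cos (t / 2) / Real.sin (t / 2)| := h1.abs
  exact h2.pow_const β

theorem cotPow_periodic (β : ℝ) : Function.Periodic (cotPow β) (2 * π) := by
  intro t
  simp only [cotPow]
  rw [show (t + 2 * π) / 2 = t / 2 + π by ring, Real.cos_add_pi, Real.sin_add_pi, neg_div_neg_eq]

theorem cotPow_neg (β t : ℝ) : cotPow β (-t) = cotPow β t := by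
  simp only [cotPow]
  rw [neg_div, Real.cos_neg, Real.sin_neg, div_neg, abs_neg]

theorem cotPow_rpow (β p t : ℝ) : cotPow β t ^ p = cotPow (β * p) t := by
  rw [cotPow, cotPow, Real.rpow_mul (abs_nonneg _)]

theorem cotPow_two_arctan {β x : ℝ} (hx : 0 < x) : cotPow β (2 * arctan x) = x⁻¹ ^ β := by
  rw [cotPow, mul_div_cancel_left₀ _ two_ne_zero, Real.cos_arctan, Real.sin_arctan]
  have : 0 < √(1 + x ^ 2) := by positivity
  congr 1
  rw [div_div_div_cancel_right₀ this.ne', one_div, abs_of_pos (inv_pos.2 hx)]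

/-- In the variable `v = τ tan(θ/2)`, with `τ = (1+r)/(1-r)`, the density at `α = 0` is `2/(1 + v²)`
and `cot(θ/2) = τ/v`, so `τ^β` factors out and a Beta integral remains. -/
theorem lintegral_poisson_cotPow {β r : ℝ} (hβ0 : 0 ≤ β) (hβ1 : β < 1) (hr : |r| < 1) :
    ∫⁻ t in Ioc 0 (2 * π), ENNReal.ofReal (pk 0 (polar r t)) * ENNReal.ofReal (cotPow β t)
      = ENNReal.ofReal (2 * π * sec (π * β / 2) * ((1 + r) / (1 - r)) ^ β) := by
  obtain ⟨hr1, hr2⟩ := abs_lt.1 hr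
  rw [setLIntegral_Ioc_of_even (fun t => by
    have h1 := pk_polar_periodic 0 r t
    simp only at h1 ⊢
    rw [h1, cotPow_periodic β t])
    (fun t => by rw [pk_polar_neg, cotPow_neg])]
  set τ := (1 + r) / (1 - r) with hτ
  have hτ0 : 0 < τ := div_pos (by linarith) (by linarith)
  have h := lintegral_pk_polar_mul_eq 0 hτ0 fun θ => ENNReal.ofReal (cotPow β θ)
  rw [radius_substitution hr2] at h
  have hb := lintegral_Ioi_rpow_mul_one_add_sq_rpow (a := 1 - β) (c := 1) (by linarith)
    (by linarith)
  rw [show 1 - (1 - β) / 2 = (1 + β) / 2 by ring, beta_comm, beta_half_eq] at hb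
  have e : ∀ v ∈ Ioi (0 : ℝ), ENNReal.ofReal (cConst 0 * 2 ^ ((0 : ℝ) + 1) *
        (((τ ^ 2 + v ^ 2) / (τ + 1) ^ 2) ^ ((0 : ℝ) / 2) * (1 + v ^ 2) ^ (-((0 : ℝ) + 2) / 2))) *
        ENNReal.ofReal (cotPow β (2 * arctan (v / τ)))
      = ENNReal.ofReal (2 * τ ^ β)
        * ENNReal.ofReal (v ^ (1 - β - 1) * (1 + v ^ 2) ^ (-(1 : ℝ))) := by
    intro v hv
    have hv : 0 < v := hv
    rw [cotPow_two_arctan (div_pos hv hτ0), cConst_zero, zero_div, Real.rpow_zero, zero_add,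
      Real.rpow_one, zero_add, neg_div, div_self two_ne_zero, inv_div,
      Real.div_rpow hτ0.le hv.le, ← ENNReal.ofReal_mul (by positivity),
      ← ENNReal.ofReal_mul (by positivity), show 1 - β - 1 = -β by ring, Real.rpow_neg hv.le β]
    congr 1
    ring
  rw [h, setLIntegral_congr_fun measurableSet_Ioi e,
    lintegral_const_mul' _ _ ENNReal.ofReal_ne_top, hb, ← ENNReal.ofReal_mul (by positivity),
    show (2 : ℝ≥0∞) = ENNReal.ofReal 2 by simp, ← ENNReal.ofReal_mul two_pos.le]
  congr 1
  ring

theorem lintegral_cotPow {β : ℝ} (hβ0 : 0 ≤ β) (hβ1 : β < 1) :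
    ∫⁻ t in Ioc 0 (2 * π), ENNReal.ofReal (cotPow β t)
      = ENNReal.ofReal (2 * π * sec (π * β / 2)) := by
  have h := lintegral_poisson_cotPow hβ0 hβ1 (r := 0) (by simp)
  simpa [pk_polar, cConst_zero] using h

/-- Substituting `v = (1+r)/(1-r)` gives twice `B(1+q, 1-q)`, which the reflection formula
evaluates. -/
theorem lintegral_Ioo_ratio_rpow {q : ℝ} (hq0 : 0 < q) (hq1 : q < 1) :
    ∫⁻ r in Ioo (-1 : ℝ) 1, ENNReal.ofReal (((1 + r) / (1 - r)) ^ q)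
      = ENNReal.ofReal (2 * π * q / Real.sin (π * q)) := by
  have hb := lintegral_Ioi_beta (a := 1 + q) (b := 1 - q) (by linarith) (by linarith)
  have e : ∀ v ∈ Ioi (0 : ℝ), ENNReal.ofReal (2 * (1 * 1) / (1 * v + 1) ^ 2)
      * ENNReal.ofReal (((1 + (1 * v - 1) / (1 * v + 1)) / (1 - (1 * v - 1) / (1 * v + 1))) ^ q)
      = ENNReal.ofReal 2 * ENNReal.ofReal (v ^ (1 + q - 1) * (1 + v) ^ (-(1 + q + (1 - q)))) := by
    intro v hv
    have hv : 0 < v := hv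
    have e1 : (1 + (1 * v - 1) / (1 * v + 1)) / (1 - (1 * v - 1) / (1 * v + 1)) = v := by
      field_simp; ring
    rw [e1, ← ENNReal.ofReal_mul (by positivity), ← ENNReal.ofReal_mul (by positivity),
      show -(1 + q + (1 - q)) = -((2 : ℕ) : ℝ) by push_cast; ring, Real.rpow_neg (by positivity),
      Real.rpow_natCast, add_sub_cancel_left, add_comm 1 v]
    congr 1
    field_simp
  rw [lintegral_Ioo_radius_substitution one_pos one_pos, setLIntegral_congr_fun measurableSet_Ioi e,
    lintegral_const_mul' _ _ ENNReal.ofReal_ne_top, hb, ← ENNReal.ofReal_mul two_pos.le]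
  congr 1
  rw [ProbabilityTheory.beta, show 1 + q + (1 - q) = 2 by ring, Real.Gamma_two, div_one,
    add_comm 1 q,
    Real.Gamma_add_one hq0.ne', mul_assoc, Real.Gamma_mul_Gamma_one_sub]
  ring

theorem lintegral_poisson_cotPow_rpow {β p : ℝ} (hβ : 0 < β) (hp : 1 < p) (hβp : β * p < 1) :
    ∫⁻ r in Ioo (-1 : ℝ) 1, (∫⁻ t in Ioc 0 (2 * π),
        ENNReal.ofReal ((2 * π)⁻¹ * (pk 0 (polar r t) * cotPow β t))) ^ p
      = ENNReal.ofReal (sec (π * β / 2) ^ p * (2 * π * (β * p) / Real.sin (π * (β * p)))) := by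
  have hβ1 : β < 1 := by nlinarith
  have hsec := sec_pos hβ.le hβ1
  have e : ∀ r ∈ Ioo (-1 : ℝ) 1, (∫⁻ t in Ioc 0 (2 * π),
      ENNReal.ofReal ((2 * π)⁻¹ * (pk 0 (polar r t) * cotPow β t))) ^ p
      = ENNReal.ofReal (sec (π * β / 2) ^ p) * ENNReal.ofReal (((1 + r) / (1 - r)) ^ (β * p)) := by
    intro r hr
    have hr' : |r| < 1 := abs_lt.2 hr
    have hτ0 : 0 < (1 + r) / (1 - r) := div_pos (by linarith [hr.1]) (by linarith [hr.2])
    have h1 : ∀ t, ENNReal.ofReal ((2 * π)⁻¹ * (pk 0 (polar r t) * cotPow β t))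
        = ENNReal.ofReal (2 * π)⁻¹
          * (ENNReal.ofReal (pk 0 (polar r t)) * ENNReal.ofReal (cotPow β t)) := fun t => by
      rw [ENNReal.ofReal_mul (by positivity),
        ENNReal.ofReal_mul (pk_polar_pos (by norm_num) hr' t).le]
    simp only [h1]
    rw [lintegral_const_mul' _ _ ENNReal.ofReal_ne_top, lintegral_poisson_cotPow hβ.le hβ1 hr',
      ← ENNReal.ofReal_mul (by positivity), ENNReal.ofReal_rpow_of_pos (by positivity),
      ← ENNReal.ofReal_mul (by positivity), Real.rpow_mul hτ0.le,
      ← Real.mul_rpow hsec.le (by positivity)]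
    congr 2
    have := Real.pi_pos.ne'
    generalize sec (π * β / 2) = S
    field_simp
  rw [setLIntegral_congr_fun measurableSet_Ioo e, lintegral_const_mul' _ _ ENNReal.ofReal_ne_top,
    lintegral_Ioo_ratio_rpow (by positivity) hβp, ← ENNReal.ofReal_mul (by positivity)]

/-- Fatou's lemma for iterated integrals. -/
theorem lintegral_lintegral_rpow_le_liminf {X Y : Type*} [MeasurableSpace X] [MeasurableSpace Y]
    {μ : Measure X} {ν : Measure Y} [SFinite ν] {k : ℕ → X → Y → ℝ≥0∞} {l : X → Y → ℝ≥0∞} {p : ℝ}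
    (hp : 0 < p) (hk : ∀ n, Measurable (Function.uncurry (k n)))
    (hl : ∀ᵐ x ∂μ, ∀ y, Tendsto (fun n => k n x y) atTop (𝓝 (l x y))) :
    ∫⁻ x, (∫⁻ y, l x y ∂ν) ^ p ∂μ
      ≤ liminf (fun n => ∫⁻ x, (∫⁻ y, k n x y ∂ν) ^ p ∂μ) atTop := by
  have h1 : ∀ᵐ x ∂μ, (∫⁻ y, l x y ∂ν) ^ p
      ≤ liminf (fun n => (∫⁻ y, k n x y ∂ν) ^ p) atTop := by
    filter_upwards [hl] with x hx
    have h2 : ∫⁻ y, l x y ∂ν ≤ liminf (fun n => ∫⁻ y, k n x y ∂ν) atTop := by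
      have h3 : ∫⁻ y, liminf (fun n => k n x y) atTop ∂ν
          ≤ liminf (fun n => ∫⁻ y, k n x y ∂ν) atTop := lintegral_liminf_le fun n =>
        (hk n).comp (measurable_const.prodMk measurable_id)
      refine le_trans (le_of_eq (lintegral_congr fun y => ?_)) h3
      exact (hx y).liminf_eq.symm
    have h4 := (ENNReal.monotone_rpow_of_nonneg hp.le).map_liminf_of_continuousAt
      (F := atTop) (fun n => ∫⁻ y, k n x y ∂ν)
      (ENNReal.continuous_rpow_const.continuousAt)
    exact (ENNReal.rpow_le_rpow h2 hp.le).trans (le_of_eq h4)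
  refine (lintegral_mono_ae h1).trans (lintegral_liminf_le fun n => ?_)
  exact (hk n).lintegral_prod_right'.pow_const p

theorem measurable_pk_polar (α : ℝ) : Measurable fun x : ℝ × ℝ => pk α (polar x.1 x.2) := by
  simp only [pk_polar]
  fun_prop

theorem continuousAt_pk_polar_zero {r : ℝ} (hr : |r| < 1) (t : ℝ) :
    ContinuousAt (fun α => pk α (polar r t)) 0 := by
  simp only [pk_polar]
  have hr2 : 0 < 1 - r ^ 2 := by rw [← sq_abs]; nlinarith [abs_nonneg r]
  refine continuousAt_cConst_zero.mul (ContinuousAt.mul ?_ ?_)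
  · exact ContinuousAt.rpow (by fun_prop) (by fun_prop) (Or.inl hr2.ne')
  · exact ContinuousAt.rpow (by fun_prop) (by fun_prop)
      (Or.inl (one_sub_two_mul_cos_pos hr t).ne')

/-- By the double-angle formula the quotient of the two explicit integrals is `sec^p(πβ/2) βp / (2
sin(πβp/2))`, continuous up to `β = 1/p`, where it equals the target constant. At `β = 1/p` itself
the integrals diverge, so `β` is taken slightly smaller. -/
theorem exists_cotPow_ratio_gt {p c : ℝ} (hp : 1 < p) (hc : c < (1 / 2) * sec (π / (2 * p)) ^ p) :
    ∃ β, 0 < β ∧ β * p < 1 ∧ c * (2 * π * sec (π * (β * p) / 2))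
      < sec (π * β / 2) ^ p * (2 * π * (β * p) / Real.sin (π * (β * p))) := by
  have hp0 : 0 < p := by linarith
  have hcos : 0 < Real.cos (π * p⁻¹ / 2) := by
    have := sec_pos (inv_pos.2 hp0).le (inv_lt_one_of_one_lt₀ hp)
    rwa [sec, one_div, inv_pos] at this
  have h1 : ContinuousAt (fun β : ℝ => sec (π * β / 2) ^ p
      * (β * p / (2 * Real.sin (π * (β * p) / 2)))) p⁻¹ := by
    unfold sec
    refine ContinuousAt.mul (ContinuousAt.rpow_const ?_ (Or.inr hp0.le)) ?_
    · exact ContinuousAt.div (by fun_prop) (by fun_prop) hcos.ne'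
    · refine ContinuousAt.div (by fun_prop) (by fun_prop) ?_
      rw [inv_mul_cancel₀ hp0.ne', mul_one, Real.sin_pi_div_two]
      norm_num
  have h2 : c < sec (π * p⁻¹ / 2) ^ p * (p⁻¹ * p / (2 * Real.sin (π * (p⁻¹ * p) / 2))) := by
    rw [inv_mul_cancel₀ hp0.ne', mul_one, Real.sin_pi_div_two,
      show π * p⁻¹ / 2 = π / (2 * p) by field_simp]
    linarith
  have h3 := (h1.eventually (lt_mem_nhds h2)).filter_mono (nhdsWithin_le_nhds (s := Iio p⁻¹))
  obtain ⟨β, hβ, hβ2⟩ := (h3.and (Ioo_mem_nhdsLT (inv_pos.2 hp0))).exists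
  have hq : β * p < 1 := by
    have := mul_lt_mul_of_pos_right hβ2.2 hp0
    rwa [inv_mul_cancel₀ hp0.ne'] at this
  have hq0 : 0 < β * p := mul_pos hβ2.1 hp0
  refine ⟨β, hβ2.1, hq, ?_⟩
  have hsec := sec_pos hq0.le hq
  have hQ : 0 < 2 * π * sec (π * (β * p) / 2) := mul_pos Real.two_pi_pos hsec
  refine (mul_lt_mul_of_pos_right hβ hQ).trans_le (le_of_eq ?_)
  have hcos2 : 0 < Real.cos (π * (β * p) / 2) := by rwa [sec, one_div, inv_pos] at hsec
  have hsin2 : 0 < Real.sin (π * (β * p) / 2) :=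
    Real.sin_pos_of_pos_of_lt_pi (by positivity) (by nlinarith [Real.pi_pos])
  have hs : Real.sin (π * (β * p))
      = 2 * Real.sin (π * (β * p) / 2) * Real.cos (π * (β * p) / 2) := by
    rw [← Real.sin_two_mul]; congr 1; ring
  rw [hs, sec.eq_1 (π * (β * p) / 2)]
  generalize sec (π * β / 2) ^ p = S
  generalize Real.sin (π * (β * p) / 2) = x at *
  generalize Real.cos (π * (β * p) / 2) = y at *
  field_simp

/-- The strict inequality for the cotangent power at `α = 0` leaves room for two perturbations,
truncation and then a change of `α`. Both only need lower semicontinuity of the diameter integral,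
because truncation decreases the boundary integral, which does not depend on `α`. -/
theorem eventually_le_of_rieszFejerBound {p c : ℝ} (hp : 1 < p) (hc0 : 0 ≤ c)
    (hc : c < (1 / 2) * sec (π / (2 * p)) ^ p) :
    ∀ᶠ α : ℝ in 𝓝[≤] (0 : ℝ), ∀ s K : ℝ, RieszFejerBound α p s K → c ≤ K := by
  have hp0 : 0 < p := by linarith
  obtain ⟨β, hβ, hq, hlt⟩ := exists_cotPow_ratio_gt hp hc
  have hq0 : 0 < β * p := mul_pos hβ hp0
  have hQ : 0 < 2 * π * sec (π * (β * p) / 2) := mul_pos Real.two_pi_pos (sec_pos hq0.le hq)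
  have hnorm := lintegral_cotPow hq0.le hq
  have hlim := lintegral_poisson_cotPow_rpow hβ hp hq
  set Q := 2 * π * sec (π * (β * p) / 2)
  have hlt' : ENNReal.ofReal (c * Q) < ∫⁻ r in Ioo (-1 : ℝ) 1, (∫⁻ t in Ioc 0 (2 * π),
        ENNReal.ofReal ((2 * π)⁻¹ * (pk 0 (polar r t) * cotPow β t))) ^ p := by
    rw [hlim]
    exact (ENNReal.ofReal_lt_ofReal_iff ((mul_nonneg hc0 hQ.le).trans_lt hlt)).2 hlt
  set k : ℝ → ℕ → ℝ → ℝ → ℝ≥0∞ := fun α N r t =>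
    ENNReal.ofReal ((2 * π)⁻¹ * (pk α (polar r t) * min (cotPow β t) N)) with hk
  have hkm : ∀ α N, Measurable (Function.uncurry (k α N)) := fun α N => by
    refine Measurable.ennreal_ofReal (measurable_const.mul ((measurable_pk_polar α).mul ?_))
    exact ((measurable_cotPow β).comp measurable_snd).min measurable_const
  -- The truncation level is fixed before `α` moves, so that the test function stays bounded and
  -- independent of `α`.
  obtain ⟨N, hN⟩ : ∃ N : ℕ, ENNReal.ofReal (c * Q)
      < ∫⁻ r in Ioo (-1 : ℝ) 1, (∫⁻ t in Ioc 0 (2 * π), k 0 N r t) ^ p := by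
    refine (eventually_lt_of_lt_liminf (hlt'.trans_le
      (lintegral_lintegral_rpow_le_liminf hp0 (hkm 0) (Eventually.of_forall fun r t => ?_)))).exists
    refine tendsto_const_nhds.congr' ?_
    obtain ⟨M, hM⟩ := exists_nat_ge (cotPow β t)
    filter_upwards [eventually_ge_atTop M] with n hn
    simp only [hk]
    rw [min_eq_left (hM.trans (by exact_mod_cast hn))]
  have hα : ∀ᶠ α in 𝓝[≤] (0 : ℝ), ENNReal.ofReal (c * Q)
      < ∫⁻ r in Ioo (-1 : ℝ) 1, (∫⁻ t in Ioc 0 (2 * π), k α N r t) ^ p := by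
    -- Fatou's lemma is sequential, so the limit in `α` is tested along sequences.
    rw [eventually_iff_seq_eventually]
    intro x hx
    have hx0 : Tendsto x atTop (𝓝 0) := hx.mono_right nhdsWithin_le_nhds
    refine eventually_lt_of_lt_liminf (hN.trans_le
      (lintegral_lintegral_rpow_le_liminf hp0 (fun n => hkm (x n) N)
        ((ae_restrict_iff' measurableSet_Ioo).2 (Eventually.of_forall fun r hr t => ?_))))
    refine ENNReal.tendsto_ofReal (Tendsto.const_mul _ (Tendsto.mul_const _ ?_))
    exact (continuousAt_pk_polar_zero (abs_lt.2 hr) t).tendsto.comp hx0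
  have hα1 : ∀ᶠ α in 𝓝[≤] (0 : ℝ), -1 < α :=
    (lt_mem_nhds (by norm_num : (-1 : ℝ) < 0)).filter_mono nhdsWithin_le_nhds
  filter_upwards [hα, hα1, self_mem_nhdsWithin] with α h1 h2 h3 s K hK
  have h4 := hK.lintegral_le h2 h3 hp (F := fun t => min (cotPow β t) N) (M := N)
    ((measurable_cotPow β).min measurable_const)
    (fun t => le_min (cotPow_nonneg β t) (Nat.cast_nonneg N)) (fun t => min_le_right _ _)
    (fun t => by simp only [cotPow_periodic β t])
  have h5 : ∫⁻ t in Ioc 0 (2 * π), ENNReal.ofReal (min (cotPow β t) N) ^ p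
      ≤ ENNReal.ofReal Q := by
    rw [← hnorm]
    refine lintegral_mono fun t => ?_
    rw [← cotPow_rpow, ← ENNReal.ofReal_rpow_of_nonneg (cotPow_nonneg β t) hp0.le]
    exact ENNReal.rpow_le_rpow (ENNReal.ofReal_le_ofReal (min_le_left _ _)) hp0.le
  have h6 := (h1.trans_le h4).trans_le (mul_le_mul_right h5 _)
  rw [← ENNReal.ofReal_mul' hQ.le] at h6
  have h7 := (ENNReal.ofReal_lt_ofReal_iff_of_nonneg (mul_nonneg hc0 hQ.le)).1 h6
  exact (lt_of_mul_lt_mul_right h7 hQ.le).le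

end AlphaHarmonic
/-- Riesz-Fejér inequality for `α`-harmonic Hardy spaces, with the boundary function well defined
and in `L^p`, and with a constant that is asymptotically sharp as `α → 0`: it tends to its value
`(1/2) sec^p(π/(2p))` at `α = 0`, and the ratio of the best possible constant to `C(α, p)` tends
to `1`. -/
theorem theorem1p5 (p : ℝ) (hp : 1 < p) :
    (∀ α : ℝ, -1 < α → α ≤ 0 → 0 < α + 2 / p →
      (∀ u : ℂ → ℂ, AlphaHarmonic.MemHardy α p u →
        (∀ᵐ θ : ℝ, Tendsto (fun r : ℝ => u (AlphaHarmonic.polar r θ)) (𝓝[<] (1 : ℝ))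
          (𝓝 (AlphaHarmonic.radialLimit u θ))) ∧
        MemLp (AlphaHarmonic.radialLimit u) (ENNReal.ofReal p)
          (volume.restrict (Ioc (0 : ℝ) (2 * π)))) ∧
      ∀ s : ℝ, AlphaHarmonic.RieszFejerBound α p s (AlphaHarmonic.rfConst α p)) ∧
    AlphaHarmonic.rfConst 0 p = (1 / 2) * AlphaHarmonic.sec (π / (2 * p)) ^ p ∧
    Tendsto (fun α : ℝ => AlphaHarmonic.rfConst α p) (𝓝[≤] (0 : ℝ))
      (𝓝 ((1 / 2) * AlphaHarmonic.sec (π / (2 * p)) ^ p)) ∧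
    (∀ ε : ℝ, 0 < ε → ∀ᶠ α : ℝ in 𝓝[≤] (0 : ℝ), ∀ s K : ℝ,
      AlphaHarmonic.RieszFejerBound α p s K → (1 - ε) * AlphaHarmonic.rfConst α p ≤ K) := by
  have hC0 := AlphaHarmonic.rfConst_zero hp
  have hT : Tendsto (fun α : ℝ => AlphaHarmonic.rfConst α p) (𝓝[≤] (0 : ℝ))
      (𝓝 ((1 / 2) * AlphaHarmonic.sec (π / (2 * p)) ^ p)) := by
    rw [← hC0]
    exact (AlphaHarmonic.continuousAt_rfConst_zero hp).tendsto.mono_left nhdsWithin_le_nhds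
  refine ⟨fun α hα h0 hαp => ⟨fun u hu => ?_, AlphaHarmonic.rieszFejerBound_rfConst hα h0 hp hαp⟩,
    hC0, hT, fun ε hε => ?_⟩
  · obtain ⟨f, -, hf, -, hlim⟩ := hu.exists_boundary hα h0 hp
    have heq : ∀ᵐ θ : ℝ, f θ = AlphaHarmonic.radialLimit u θ := by
      filter_upwards [hlim] with θ hθ
      exact (AlphaHarmonic.radialLimit_eq hθ).symm
    refine ⟨?_, (hu.memLp_boundary hp hf hlim).ae_eq (ae_restrict_of_ae heq)⟩
    filter_upwards [hlim, heq] with θ h1 h2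
    rwa [← h2]
  · have hsec : 0 < (1 / 2) * AlphaHarmonic.sec (π / (2 * p)) ^ p := by
      have h1 := AlphaHarmonic.sec_pos (b := p⁻¹) (by positivity) (inv_lt_one_of_one_lt₀ hp)
      rw [show π * p⁻¹ / 2 = π / (2 * p) by field_simp] at h1
      positivity
    set A := (1 / 2) * AlphaHarmonic.sec (π / (2 * p)) ^ p
    -- Capping at `1/2` keeps `1 - δ` positive. The gap between `1 - δ` and `1 - δ/2` absorbs the
    -- difference between `rfConst α p` and its limit `A`.
    set δ := min ε (1 / 2) with hδ
    have hδ0 : 0 < δ := lt_min hε (by norm_num)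
    have hδ1 : δ ≤ 1 / 2 := min_le_right _ _
    have hlt : (1 - δ / 2) * A < A := by nlinarith
    have h1 := AlphaHarmonic.eventually_le_of_rieszFejerBound hp
      (c := (1 - δ / 2) * A) (mul_nonneg (by linarith) hsec.le) hlt
    have h2 : ∀ᶠ α : ℝ in 𝓝[≤] (0 : ℝ),
        (1 - δ) * AlphaHarmonic.rfConst α p < (1 - δ / 2) * A :=
      (hT.const_mul (1 - δ)).eventually (gt_mem_nhds (by nlinarith))
    have h3 : ∀ᶠ α : ℝ in 𝓝[≤] (0 : ℝ), 0 < AlphaHarmonic.rfConst α p :=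
      hT.eventually (lt_mem_nhds hsec)
    filter_upwards [h1, h2, h3] with α h4 h5 h6 s K hK
    have h7 : (1 - ε) * AlphaHarmonic.rfConst α p ≤ (1 - δ) * AlphaHarmonic.rfConst α p :=
      mul_le_mul_of_nonneg_right (by linarith [min_le_left ε (1 / 2)]) h6.le
    exact h7.trans (h5.le.trans (h4 s K hK))
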